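/- **Proposition 3.2.** Let $R$ be a complete discrete valuation ring and let $n\ge 1$ be an integer that is invertible in $R$ and such that $R$ contains a primitive $n$-th root of unity. Let $G$ be a finite abelian group whose exponent divides $n$. Let $Y$ be a regular (locally Noetherian) scheme, flat over $S=\mathrm{Spec}(R)$, and let $\pi:X\to Y$ be a $G$-cover with $X$ regular: $G$ acts on $X$ over $Y$, the morphism $\pi$ is finite, and $\mathcal O_Y=(\pi_*\mathcal O_X)^G$. Suppose that $\pi$ is generically a $G$-torsor, i.e. it is a $G$-torsor over a dense open subscheme of $Y$. For $x\in X$ let $I_x$ be its inertia group and $e_x=|I_x|$; suppose that every codimension one point $x$ of $X$ with $I_x\neq 1$ lies on the special fibre of $X\to S$. Let $\mathcal K_X$, $\mathcal K_Y$ be the sheaves of meromorphic functions. Let $D=\sum_x d_x x$ be a $G$-invariant divisor on $X$ such that $d_x=0$ whenever $I_x=1$, and put $\mathcal F=\mathcal O_X(D)\subset\mathcal K_X$. For a character $\varphi:G\to R^\times$, let $\mathcal F_\varphi\subset\pi_*\mathcal F$ be the subsheaf of local sections on which $G$ acts through $\varphi$. For a codimension one point $x$ of $X$ on the special fibre, let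 $\psi_x:I_x\to R^\times$ be the character whose reduction gives the action of $I_x$ on the cotangent space $\mathfrak m_x/\mathfrak m_x^2$, and let $n(\varphi,x)$ be the unique integer with $0\le n(\varphi,x)<e_x$ and $\varphi|_{I_x}=\psi_x^{n(\varphi,x)}$. The numbers $e_x$, $d_x$ and $n(\varphi,x)$ depend only on $y=\pi(x)$, and are denoted $e_y$, $d_y$ and $n(\varphi,y)$. With $\{a\}=a-\lfloor a\rfloor$, put $$f_{\mathcal F}(\varphi,y)=\frac{d_y}{e_y}-\left\{\frac{n(\varphi,y)+d_y}{e_y}\right\}.$$ Then the numbers $n f_{\mathcal F}(\varphi,y)$ are integers, and $n$-fold multiplication in $\pi_*\mathcal K_X$ identifies $\mathcal F_\varphi^{\otimes n}$ (tensor power over $\mathcal O_Y$) with the subsheaf $\mathcal O_Y(F_{\mathcal F}(\varphi))$ of $\mathcal K_Y\subset\pi_*\mathcal K_X$, where $$F_{\mathcal F}(\varphi)=\sum_y n f_{\mathcal F}(\varphi,y)\,y$$ and $y$ runs over the codimension one points of $Y$ contained in the special fibre of $Y\to S$. -/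

import Mathlib

open CategoryTheory CategoryTheory.Limits AlgebraicGeometry TopologicalSpace
open scoped TensorProduct

universe u v

namespace TameCover

/-- A regular scheme: locally Noetherian, all of whose local rings are regular. -/
class IsRegularScheme (X : Scheme.{u}) : Prop where
  locallyNoetherian : IsLocallyNoetherian X
  regular_stalk : ∀ x : X, IsRegularLocalRing (X.presheaf.stalk x)

/-! ### Rational functions and divisor sheaves -/

/-- The sections over `U` of the sheaf `𝒦_X` of meromorphic functions of a reduced locally
Noetherian scheme `X`: families of elements of the local rings of `X` at the generic points of the
irreducible components of `X` that meet `U`. If `U` is affine, Noetherian and reduced, this is the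
total ring of fractions of `Γ(X, U)`. -/
def Mero (X : Scheme.{u}) (U : X.Opens) : Type u :=
  ∀ ξ : {ξ : X // ξ ∈ U ∧ ξ ∈ genericPoints X}, X.presheaf.stalk ξ.1

noncomputable instance (X : Scheme.{u}) (U : X.Opens) : CommRing (Mero X U) :=
  inferInstanceAs (CommRing (∀ ξ : {ξ : X // ξ ∈ U ∧ ξ ∈ genericPoints X}, X.presheaf.stalk ξ.1))

/-- A function on `U` regarded as a meromorphic function on `U`. -/
noncomputable def toMero (X : Scheme.{u}) (U : X.Opens) : Γ(X, U) →+* Mero X U :=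
  RingHom.pi fun ξ : {ξ : X // ξ ∈ U ∧ ξ ∈ genericPoints X} =>
    (X.presheaf.germ U ξ.1 ξ.2.1).hom

noncomputable instance (X : Scheme.{u}) (U : X.Opens) : Algebra Γ(X, U) (Mero X U) :=
  (toMero X U).toAlgebra

/-- Let `ξ` be a generization of `x` such that `𝒪_{X,x}` is a discrete valuation ring with fraction
field `𝒪_{X,ξ}`. Then this says that `s ∈ 𝒪_{X,ξ}` lies in the fractional ideal `𝔪_x ^ (-d)`, that
is, `s = 0` or `ord_x s ≥ -d`. -/
def OrdGE {X : Scheme.{u}} {ξ x : X} (h : ξ ⤳ x) (d : ℤ) (s : X.presheaf.stalk ξ) : Prop :=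
  ∀ a ∈ IsLocalRing.maximalIdeal (X.presheaf.stalk x) ^ d.toNat,
    ∃ b ∈ IsLocalRing.maximalIdeal (X.presheaf.stalk x) ^ (-d).toNat,
      (X.presheaf.stalkSpecializes h).hom a * s = (X.presheaf.stalkSpecializes h).hom b

theorem OrdGE.zero {X : Scheme.{u}} {ξ x : X} (h : ξ ⤳ x) (d : ℤ) :
    OrdGE h d (0 : X.presheaf.stalk ξ) :=
  fun _ _ => ⟨0, Ideal.zero_mem _, by simp⟩

theorem OrdGE.add {X : Scheme.{u}} {ξ x : X} {h : ξ ⤳ x} {d : ℤ} {s t : X.presheaf.stalk ξ}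
    (hs : OrdGE h d s) (ht : OrdGE h d t) : OrdGE h d (s + t) := by
  intro a ha
  obtain ⟨b, hb, e⟩ := hs a ha
  obtain ⟨c, hc, e'⟩ := ht a ha
  exact ⟨b + c, Ideal.add_mem _ hb hc, by rw [mul_add, e, e', map_add]⟩

theorem OrdGE.mul {X : Scheme.{u}} {ξ x : X} {h : ξ ⤳ x} {d : ℤ} {s : X.presheaf.stalk ξ}
    (r : X.presheaf.stalk x) (hs : OrdGE h d s) :
    OrdGE h d ((X.presheaf.stalkSpecializes h).hom r * s) := by
  intro a ha
  obtain ⟨b, hb, e⟩ := hs a ha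
  exact ⟨r * b, Ideal.mul_mem_left _ _ hb, by rw [mul_left_comm, e, map_mul]⟩

/-- The sections over `U` of `𝒪_X(D)`, for a divisor `D = ∑ₓ D(x) x` on a regular scheme `X` (with
`x` running through the points of codimension one): the meromorphic functions `s` on `U` such that
`s = 0` near `x` or `ord_x s ≥ -D(x)`, for every point `x ∈ U` of codimension one. -/
noncomputable def divisorSheaf (X : Scheme.{u}) (D : X → ℤ) (U : X.Opens) :
    Submodule Γ(X, U) (Mero X U) where
  carrier := {s | ∀ (x : X) (_ : x ∈ U) (_ : Order.coheight x = 1)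
    (ξ : {ξ : X // ξ ∈ U ∧ ξ ∈ genericPoints X}) (h : ξ.1 ⤳ x), OrdGE h (D x) (s ξ)}
  zero_mem' := fun x _ _ _ h => OrdGE.zero h (D x)
  add_mem' := fun hs ht x hx hc ξ h => (hs x hx hc ξ h).add (ht x hx hc ξ h)
  smul_mem' := by
    intro r s hs x hx hc ξ h
    have := (hs x hx hc ξ h).mul ((X.presheaf.germ U x hx).hom r)
    rwa [← CommRingCat.comp_apply, X.presheaf.germ_stalkSpecializes] at this

/-! ### Group actions on covers -/

section Action

variable {X Y : Scheme.{u}} {π : X ⟶ Y} {G : Type v} [CommGroup G]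

/-- The automorphism of `X` by which `g` acts. -/
abbrev act (ρ : G →* Aut (Over.mk π)) (g : G) : X ⟶ X := (ρ g).hom.left

theorem act_comp (ρ : G →* Aut (Over.mk π)) (g : G) : act ρ g ≫ π = π := Over.w (ρ g).hom

theorem act_one (ρ : G →* Aut (Over.mk π)) : act ρ 1 = 𝟙 X := by
  simp only [act, map_one]
  rfl

theorem act_mul (ρ : G →* Aut (Over.mk π)) (g h : G) : act ρ (g * h) = act ρ h ≫ act ρ g := by
  simp only [act, map_mul]
  rfl

theorem act_inv_comp (ρ : G →* Aut (Over.mk π)) (g : G) : act ρ g⁻¹ ≫ act ρ g = 𝟙 X := by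
  rw [← act_mul, mul_inv_cancel, act_one]

theorem act_comp_inv (ρ : G →* Aut (Over.mk π)) (g : G) : act ρ g ≫ act ρ g⁻¹ = 𝟙 X := by
  rw [← act_mul, inv_mul_cancel, act_one]

/-- The action on functions: the pullback `Γ(X, π⁻¹V) → Γ(X, π⁻¹V)` along the automorphism `g`. -/
noncomputable def pullbackFun (ρ : G →* Aut (Over.mk π)) (g : G) (V : Y.Opens) :
    Γ(X, π ⁻¹ᵁ V) →+* Γ(X, π ⁻¹ᵁ V) :=
  ((act ρ g).appLE (π ⁻¹ᵁ V) (π ⁻¹ᵁ V)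
    (by rw [← Scheme.Hom.comp_preimage, act_comp])).hom

/-- `π : X ⟶ Y` is a `G`-cover: a finite morphism that identifies `Y` with the quotient of `X` by
the action of `G`, that is, `𝒪_Y = (π_* 𝒪_X)^G`. -/
structure IsGCover (ρ : G →* Aut (Over.mk π)) : Prop where
  finite : IsFinite π
  injective : ∀ V : Y.Opens, Function.Injective (π.app V).hom
  invariant : ∀ (V : Y.Opens) (s : Γ(X, π ⁻¹ᵁ V)), (∀ g, pullbackFun ρ g V s = s) →
    s ∈ Set.range (π.app V).hom

/-- The morphism `G × X ⟶ X ×_Y X`, `(g, x) ↦ (x, g x)`. -/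
noncomputable def torsorMap [Finite G] (ρ : G →* Aut (Over.mk π)) :
    (∐ fun _ : G => X) ⟶ pullback π π :=
  Sigma.desc fun g => pullback.lift (𝟙 X) (act ρ g) (by rw [Category.id_comp, act_comp])

/-- `π` is a `G`-torsor over the open subscheme `U` of `Y`. (Used for finite `π`, where flat and
surjective over a locally Noetherian `U` is the same as finite locally free and surjective.) -/
structure IsTorsorOver [Finite G] (ρ : G →* Aut (Over.mk π)) (U : Y.Opens) : Prop where
  flat : Flat (π ∣_ U)
  surjective : Surjective (π ∣_ U)
  isIso : IsIso (torsorMap ρ ∣_ ((pullback.fst π π ≫ π) ⁻¹ᵁ U))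

/-- The inertia group `I_x`: the elements of `G` that fix `x` and act trivially on the residue
field of `x`, that is, whose action fixes the canonical morphism `Spec κ(x) ⟶ X`. -/
noncomputable def inertia (ρ : G →* Aut (Over.mk π)) (x : X) : Subgroup G where
  carrier := {g | X.fromSpecResidueField x ≫ act ρ g = X.fromSpecResidueField x}
  one_mem' := by rw [Set.mem_ofPred_eq, act_one, Category.comp_id]
  mul_mem' := by
    intro g h hg hh
    rw [Set.mem_ofPred_eq] at hg hh ⊢
    rw [act_mul, ← Category.assoc, hh, hg]
  inv_mem' := by
    intro g hg
    rw [Set.mem_ofPred_eq] at hg ⊢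
    calc X.fromSpecResidueField x ≫ act ρ g⁻¹
        = (X.fromSpecResidueField x ≫ act ρ g) ≫ act ρ g⁻¹ := by rw [hg]
      _ = X.fromSpecResidueField x := by rw [Category.assoc, act_comp_inv, Category.comp_id]

theorem act_apply_of_mem_inertia (ρ : G →* Aut (Over.mk π)) {x : X} {g : G}
    (hg : g ∈ inertia ρ x) : act ρ g x = x := by
  have h : X.fromSpecResidueField x ≫ act ρ g = X.fromSpecResidueField x := hg
  have z : Spec (X.residueField x) := IsLocalRing.closedPoint (X.residueField x)
  have := congrArg (fun k : Spec (X.residueField x) ⟶ X => k z) h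
  simpa using this

/-- The action of `g ∈ I_x` on the local ring at `x`, by pullback of functions. -/
noncomputable def inertiaAct (ρ : G →* Aut (Over.mk π)) (x : X) (g : inertia ρ x) :
    X.presheaf.stalk x →+* X.presheaf.stalk x :=
  (X.presheaf.stalkSpecializes (specializes_of_eq (act_apply_of_mem_inertia ρ g.2)) ≫
    (act ρ g.1).stalkMap x).hom

theorem act_mem_genericPoints (ρ : G →* Aut (Over.mk π)) (g : G) {ξ : X}
    (h : ξ ∈ genericPoints X) : act ρ g ξ ∈ genericPoints X := by
  have key : ∀ (k : G) (a b : X), a ⤳ b → act ρ k a ⤳ act ρ k b :=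
    fun k a b hab => hab.map (act ρ k).continuous
  have e : ∀ a : X, act ρ g (act ρ g⁻¹ a) = a := fun a => by
    rw [← Scheme.Hom.comp_apply, act_inv_comp]; rfl
  have e' : ∀ a : X, act ρ g⁻¹ (act ρ g a) = a := fun a => by
    rw [← Scheme.Hom.comp_apply, act_comp_inv]; rfl
  refine ⟨isIrreducible_singleton.closure, ?_⟩
  intro Z hZ hle
  have hcont := (act ρ g⁻¹).continuous
  have hZ' : IsIrreducible ((act ρ g⁻¹) '' Z) := hZ.image _ hcont.continuousOn
  have hsub : closure {ξ} ⊆ closure ((act ρ g⁻¹) '' Z) := by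
    apply closure_mono
    rw [Set.singleton_subset_iff]
    exact ⟨act ρ g ξ, hle (subset_closure rfl), e' ξ⟩
  have hmax := h.2 hZ'.closure hsub
  intro z hz
  have hz1 : ξ ⤳ act ρ g⁻¹ z :=
    specializes_iff_mem_closure.2 (hmax (subset_closure ⟨z, hz, rfl⟩))
  have hz2 := key g _ _ hz1
  rw [e] at hz2
  exact specializes_iff_mem_closure.1 hz2

/-- The sections of `π_* 𝒦_X` over `V`. -/
def MeroPush (π : X ⟶ Y) (V : Y.Opens) : Type u := Mero X (π ⁻¹ᵁ V)

noncomputable instance (V : Y.Opens) : CommRing (MeroPush π V) :=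
  inferInstanceAs (CommRing (Mero X (π ⁻¹ᵁ V)))

noncomputable instance (V : Y.Opens) : Algebra Γ(Y, V) (MeroPush π V) :=
  ((toMero X (π ⁻¹ᵁ V)).comp (π.app V).hom).toAlgebra

/-- The action of `G` on the generic points of `X` in `π⁻¹V`. -/
noncomputable def actGeneric (ρ : G →* Aut (Over.mk π)) (g : G) (V : Y.Opens)
    (ξ : {ξ : X // ξ ∈ π ⁻¹ᵁ V ∧ ξ ∈ genericPoints X}) :
    {ξ : X // ξ ∈ π ⁻¹ᵁ V ∧ ξ ∈ genericPoints X} :=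
  ⟨act ρ g ξ.1, by
    have h := ξ.2.1
    change π (act ρ g ξ.1) ∈ V
    rwa [← Scheme.Hom.comp_apply, act_comp], act_mem_genericPoints ρ g ξ.2.2⟩

/-- The action of `G` on the sections of `π_* 𝒦_X`, by pullback of functions. -/
noncomputable def pullbackMero (ρ : G →* Aut (Over.mk π)) (g : G) (V : Y.Opens) :
    MeroPush π V →+* MeroPush π V :=
  RingHom.pi fun ξ : {ξ : X // ξ ∈ π ⁻¹ᵁ V ∧ ξ ∈ genericPoints X} =>
    ((act ρ g).stalkMap ξ.1).hom.comp
      (Pi.evalRingHom (fun ξ : {ξ : X // ξ ∈ π ⁻¹ᵁ V ∧ ξ ∈ genericPoints X} =>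
        X.presheaf.stalk ξ.1) (actGeneric ρ g V ξ))

/-! ### Resolvent sheaves -/

/-- A meromorphic function `s` on `π⁻¹V` is the pullback of the meromorphic function `t` on `V`. -/
def IsPullback (π : X ⟶ Y) (V : Y.Opens) (t : Mero Y V) (s : MeroPush π V) : Prop :=
  ∀ ξ : {ξ : X // ξ ∈ π ⁻¹ᵁ V ∧ ξ ∈ genericPoints X},
    ∃ h : π ξ.1 ∈ genericPoints Y, s ξ = (π.stalkMap ξ.1).hom (t ⟨π ξ.1, ξ.2.1, h⟩)

/-- For a scheme `Z` over `Spec R`: the structure map from `R` to the functions on `U`. -/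
noncomputable def scalar {R : Type u} [CommRing R] {Z : Scheme.{u}}
    (f : Z ⟶ Spec (CommRingCat.of R)) (U : Z.Opens) : R →+* Γ(Z, U) :=
  ((Scheme.ΓSpecIso (CommRingCat.of R)).inv ≫ f.appLE ⊤ U le_top).hom

/-- For a scheme `Z` over `Spec R`: the structure map from `R` to the local ring at `z`. -/
noncomputable def scalarStalk {R : Type u} [CommRing R] {Z : Scheme.{u}}
    (f : Z ⟶ Spec (CommRingCat.of R)) (z : Z) : R →+* Z.presheaf.stalk z :=
  (Z.presheaf.germ ⊤ z trivial).hom.comp (scalar f ⊤)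

theorem germ_app_congr {Z : Scheme.{u}} {p q : Z ⟶ Y} (e : p = q) (V : Y.Opens) (z : Z)
    (hp : z ∈ p ⁻¹ᵁ V) (hq : z ∈ q ⁻¹ᵁ V) (r : Γ(Y, V)) :
    (Z.presheaf.germ (p ⁻¹ᵁ V) z hp).hom ((p.app V).hom r) =
      (Z.presheaf.germ (q ⁻¹ᵁ V) z hq).hom ((q.app V).hom r) := by
  subst e
  rfl

theorem pullbackMero_smul (ρ : G →* Aut (Over.mk π)) (g : G) (V : Y.Opens) (r : Γ(Y, V))
    (s : MeroPush π V) : pullbackMero ρ g V (r • s) = r • pullbackMero ρ g V s := by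
  rw [Algebra.smul_def, Algebra.smul_def, map_mul]
  congr 1
  funext ξ
  refine (Scheme.Hom.germ_stalkMap_apply (act ρ g) (π ⁻¹ᵁ V) ξ.1
    (actGeneric ρ g V ξ).2.1 ((π.app V).hom r)).trans ?_
  have := germ_app_congr (act_comp ρ g) V ξ.1 (by rw [act_comp]; exact ξ.2.1) ξ.2.1 r
  rw [Scheme.Hom.comp_app] at this
  exact this

/-- The sections over `V` of the resolvent sheaf `ℱ_φ` of `ℱ = 𝒪_X(D)`: the sections of
`π_* 𝒪_X(D)` on which `G` acts by the character `φ : G → Rˣ`. -/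
noncomputable def resolventSheaf {R : Type u} [CommRing R] (f : Y ⟶ Spec (CommRingCat.of R))
    (ρ : G →* Aut (Over.mk π)) (D : X → ℤ) (φ : G →* Rˣ) (V : Y.Opens) :
    Submodule Γ(Y, V) (MeroPush π V) where
  carrier := {s | s ∈ divisorSheaf X D (π ⁻¹ᵁ V) ∧
    ∀ g, pullbackMero ρ g V s = scalar f V (φ g) • s}
  zero_mem' := ⟨Submodule.zero_mem _, fun g => by
    rw [smul_zero, map_zero]⟩
  add_mem' := fun {s t} hs ht => ⟨Submodule.add_mem _ hs.1 ht.1, fun g => by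
    rw [smul_add, map_add, hs.2 g, ht.2 g]⟩
  smul_mem' := fun r s hs => ⟨Submodule.smul_mem _ ((π.app V).hom r) hs.1, fun g => by
    rw [pullbackMero_smul, hs.2 g, smul_comm]⟩

/-! ### The numerical invariants -/

/-- The action of `I_x` on the cotangent space `𝔪_x / 𝔪_x²` is through the character `ψ`. -/
def IsCotangentCharacter {R : Type u} [CommRing R] (f : Y ⟶ Spec (CommRingCat.of R))
    (ρ : G →* Aut (Over.mk π)) (x : X) (ψ : inertia ρ x →* Rˣ) : Prop :=
  ∀ g : inertia ρ x, ∀ t ∈ IsLocalRing.maximalIdeal (X.presheaf.stalk x),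
    inertiaAct ρ x g t - scalarStalk (π ≫ f) x (ψ g) * t ∈
      IsLocalRing.maximalIdeal (X.presheaf.stalk x) ^ 2

open Classical in
/-- The character `ψ_x` of the inertia group `I_x`, with values in `Rˣ`, that gives its action on
the cotangent space at `x`. -/
noncomputable def cotangentCharacter {R : Type u} [CommRing R] (f : Y ⟶ Spec (CommRingCat.of R))
    (ρ : G →* Aut (Over.mk π)) (x : X) : inertia ρ x →* Rˣ :=
  if h : ∃ ψ, IsCotangentCharacter f ρ x ψ then h.choose else 1

/-- The integer `n(φ, x)`: the least natural number `m` such that the restriction of `φ` to `I_x`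
is `ψ_x ^ m`. As `ψ_x` is faithful and `I_x` has order `e_x`, it is the unique such `m` with
`0 ≤ m < e_x`. -/
noncomputable def charExponent {R : Type u} [CommRing R] (f : Y ⟶ Spec (CommRingCat.of R))
    (ρ : G →* Aut (Over.mk π)) (φ : G →* Rˣ) (x : X) : ℕ :=
  sInf {m | ∀ g : inertia ρ x, φ g = cotangentCharacter f ρ x g ^ m}

/-- The rational number `d_x / e_x - {(n(φ, x) + d_x) / e_x}`, where `e_x` is the order of the
inertia group of `x` and `d_x` is the coefficient of `D` at `x`. -/
noncomputable def resolventCoeff {R : Type u} [CommRing R] (f : Y ⟶ Spec (CommRingCat.of R))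
    (ρ : G →* Aut (Over.mk π)) (D : X → ℤ) (φ : G →* Rˣ) (x : X) : ℚ :=
  (D x : ℚ) / (Nat.card (inertia ρ x) : ℚ) -
    Int.fract (((charExponent f ρ φ x : ℚ) + (D x : ℚ)) / (Nat.card (inertia ρ x) : ℚ))

end Action

end TameCover

/-! Over an open of `Y` with coordinate domain `A`, let `B` be the coordinate ring of the cover:
both rings are regular and `A = B^G`. As `|G|` is invertible and `R` has enough roots of unity, `B`
is the direct sum of its eigenspaces `B_χ`. Miracle flatness makes `B` flat over `A`
(`flat_of_isRegularRing`), so each `B_χ` is locally free; its rank is at most one because `|G|`-th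
powers of eigenfunctions lie in `A` (`exists_generator_eigen`).

Tameness also controls the ramification. A nontrivial element of the inertia group at `q` cannot act
trivially modulo the square of the maximal ideal of `B_q` (`eq_one_of_mem_inertia`). So for a
ramified prime divisor `P ≤ q` some eigenfunction lies in `P` but not in that square; it generates a
prime ideal of the regular ring `B_q`, which must be that of `P` (`exists_eigen_generating`). Thus,
near a given prime of `A`, a ramified `P` and its conjugates are cut out by one eigenfunction `t`.
Its character restricts to `ψ_P` on the inertia group, and the order at `P` of an eigenfunction for
`φ` is congruent to `n(φ,P)` modulo `e_P` (`char_eq_pow_of_hasOrdAt`).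

Let `m_P` be the least integer `≥ -d_P` congruent to `n(φ,P)` modulo `e_P`; then `f(φ,P) = -m_P /
e_P` (`resolventCoeff_eq`). Multiplying a generator of `B_φ` by powers, of either sign, of elements
of `A` with order `e_P` along the orbit of `P` yields a rational eigenfunction `s` with order
exactly `m_P` at each prime divisor near the given prime (`exists_eigen_forall_hasOrdAt`). A section
of `ℱ_φ` has order at least `-d_P` and in the right class, hence at least `m_P`. Its quotient by `s`
is an invariant rational function without poles in codimension one, so it is regular
(`dvd_of_forall_height_one`). Hence `s` generates `ℱ_φ`, and `s ^ n`, a rational function on `Y` of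
order `n m_P / e_P` at the image of `P`, generates the divisor sheaf (`exists_local_generator`).
Multiplication carries one generator to the other, so it is an isomorphism
(`exists_piTensorProduct_equiv`).

An affine open that is not integral is handled one component at a time, through idempotents and
extension by zero. Since codimension one ramification lies over the closed point, the divisor is
supported in the special fibre. -/

namespace TameCover

open IsLocalRing Pointwise

/-! ### Regular local rings -/

section Regular

variable {S : Type u} [CommRing S]

theorem spanFinrank_maximalIdeal_quotient_succ_le [IsLocalRing S] [IsNoetherianRing S] {x : S}
    (hx : x ∈ maximalIdeal S) (hx2 : x ∉ maximalIdeal S ^ 2) [IsLocalRing (S ⧸ Ideal.span {x})] :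
    (maximalIdeal (S ⧸ Ideal.span {x})).spanFinrank + 1 ≤ (maximalIdeal S).spanFinrank := by
  classical
  rw [spanFinrank_maximalIdeal_eq_finrank_cotangentSpace (R := S)]
  set v : CotangentSpace S := (maximalIdeal S).toCotangent ⟨x, hx⟩ with hv
  have hv0 : v ≠ 0 := by
    rw [hv, Ne, Ideal.toCotangent_eq_zero]; exact hx2
  have hfr := Submodule.finrank_quotient_add_finrank (ResidueField S ∙ v)
  rw [finrank_span_singleton hv0] at hfr
  rw [← hfr]
  gcongr
  -- Lifts of a basis of the cotangent space modulo the class of `x`, together with `x`, generate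
  -- the maximal ideal by Nakayama. The lifts alone then generate it modulo `x`, and there is one
  -- fewer of them.
  let b := Module.finBasis (ResidueField S) (CotangentSpace S ⧸ (ResidueField S ∙ v))
  have hs : ∀ i, ∃ y : maximalIdeal S,
      Submodule.Quotient.mk ((maximalIdeal S).toCotangent y) = b i := by
    intro i
    obtain ⟨c, hc⟩ := Submodule.Quotient.mk_surjective _ (b i)
    obtain ⟨y, rfl⟩ := (maximalIdeal S).toCotangent_surjective c
    exact ⟨y, hc⟩
  choose y hy using hs
  have htop : Submodule.span (ResidueField S) ((maximalIdeal S).toCotangent ''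
      (insert ⟨x, hx⟩ (Set.range y))) = ⊤ := by
    rw [eq_top_iff]
    intro c _
    have hc : (Submodule.Quotient.mk c : CotangentSpace S ⧸ (ResidueField S ∙ v)) ∈
        Submodule.span (ResidueField S) (Set.range b) := by rw [b.span_eq]; trivial
    have hb : Set.range b = (Submodule.mkQ (ResidueField S ∙ v)) ''
        ((maximalIdeal S).toCotangent '' Set.range y) := by
      rw [← Set.range_comp, ← Set.range_comp]
      congr 1
      funext i
      exact (hy i).symm
    rw [hb, ← Submodule.map_span] at hc
    obtain ⟨c', hc', e⟩ := hc
    have h2 : c - c' ∈ (ResidueField S ∙ v) := by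
      rw [← Submodule.Quotient.eq]; exact e.symm
    rw [Set.image_insert_eq, Submodule.span_insert, ← sub_add_cancel c c']
    exact Submodule.add_mem_sup h2 hc'
  rw [CotangentSpace.span_image_eq_top_iff] at htop
  have hm : maximalIdeal (S ⧸ Ideal.span {x}) =
      Ideal.span (Set.range fun i => Ideal.Quotient.mk (Ideal.span {x}) (y i).1) := by
    have h1 : maximalIdeal S = Ideal.span (insert x (Set.range fun i => (y i).1)) := by
      have := congrArg (Submodule.map (maximalIdeal S).subtype) htop
      rw [Submodule.map_span, Submodule.map_top, Submodule.range_subtype] at this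
      refine this.symm.trans ?_
      rw [Set.image_insert_eq, ← Set.range_comp]
      rfl
    have h2 : maximalIdeal (S ⧸ Ideal.span {x}) =
        (maximalIdeal S).map (Ideal.Quotient.mk (Ideal.span {x})) := by
      refine (eq_maximalIdeal ?_).symm
      refine Ideal.IsMaximal.map_of_surjective_of_ker_le Ideal.Quotient.mk_surjective ?_
      rw [Ideal.mk_ker, Ideal.span_singleton_le_iff_mem]
      exact hx
    refine h2.trans ((congrArg (Ideal.map _) h1).trans ?_)
    rw [Ideal.map_span, Set.image_insert_eq]
    have : Ideal.Quotient.mk (Ideal.span {x}) x = 0 :=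
      Ideal.Quotient.eq_zero_iff_mem.2 (Ideal.mem_span_singleton_self x)
    rw [this, Ideal.span_insert_zero, ← Set.range_comp]
    rfl
  rw [hm]
  refine (Submodule.spanFinrank_span_le_ncard_of_finite (Set.finite_range _)).trans ?_
  rw [← Set.image_univ]
  refine (Set.ncard_image_le Set.finite_univ).trans ?_
  rw [Set.ncard_univ, Nat.card_eq_fintype_card, Fintype.card_fin]

theorem exists_ringKrullDim_eq_natCast (S : Type u) [CommRing S] [IsLocalRing S]
    [IsNoetherianRing S] : ∃ d : ℕ, ringKrullDim S = d := by
  have h0 : ringKrullDim S ≠ ⊥ := ringKrullDim_ne_bot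
  have h1 : ringKrullDim S ≠ ⊤ := ringKrullDim_ne_top
  obtain ⟨e, he⟩ := WithBot.ne_bot_iff_exists.1 h0
  obtain ⟨d, hd⟩ := ENat.ne_top_iff_exists.1 (show e ≠ ⊤ by
    rintro rfl
    exact h1 he.symm)
  exact ⟨d, by rw [← he, ← hd]; rfl⟩

/-- The embedding dimension drops by at least one and the Krull dimension by at most one. Since the
dimension never exceeds the embedding dimension, both drop by exactly one. -/
theorem isRegularLocalRing_quotient [IsRegularLocalRing S] {x : S}
    (hx : x ∈ maximalIdeal S) (hx2 : x ∉ maximalIdeal S ^ 2) :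
    IsRegularLocalRing (S ⧸ Ideal.span {x}) ∧
      ringKrullDim (S ⧸ Ideal.span {x}) + 1 = ringKrullDim S := by
  have : Nontrivial (S ⧸ Ideal.span {x}) := Ideal.Quotient.nontrivial_iff.2 (by
    rw [Ne, Ideal.span_singleton_eq_top]; exact hx)
  have : IsLocalRing (S ⧸ Ideal.span {x}) :=
    IsLocalRing.of_surjective' _ Ideal.Quotient.mk_surjective
  have h1 := spanFinrank_maximalIdeal_quotient_succ_le hx hx2
  have h2 := ringKrullDim_le_ringKrullDim_quotient_add_card (R := S) {x}
    (by simpa [ringJacobson_eq_maximalIdeal] using hx)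
  have h3 := ringKrullDim_le_spanFinrank_maximalIdeal (S ⧸ Ideal.span {x})
  have h4 := IsRegularLocalRing.spanFinrank_maximalIdeal (R := S)
  rw [Finset.card_singleton] at h2
  obtain ⟨d, hd⟩ := exists_ringKrullDim_eq_natCast (S ⧸ Ideal.span {x})
  rw [Finset.coe_singleton, hd, ← h4] at h2
  rw [hd] at h3
  norm_cast at h2 h3
  refine ⟨(isRegularLocalRing_iff _).2 ?_, ?_⟩
  · rw [hd]; norm_cast; omega
  · rw [hd, ← h4]; norm_cast; omega

theorem maximalIdeal_eq_bot_of_le_sq [IsLocalRing S] [IsNoetherianRing S]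
    (h : maximalIdeal S ≤ maximalIdeal S ^ 2) : maximalIdeal S = ⊥ := by
  refine Submodule.eq_bot_of_le_smul_of_le_jacobson_bot (maximalIdeal S) _
    (IsNoetherian.noetherian _) ?_ (maximalIdeal_le_jacobson _)
  rwa [smul_eq_mul, ← sq]

theorem exists_mem_maximalIdeal_notMem_sq [IsLocalRing S] [IsNoetherianRing S]
    (h : maximalIdeal S ≠ ⊥) : ∃ x ∈ maximalIdeal S, x ∉ maximalIdeal S ^ 2 := by
  by_contra! hc
  exact h (maximalIdeal_eq_bot_of_le_sq hc)

/-- Induction on the dimension: for a parameter `x` outside every minimal prime, the quotient by `x`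
is a domain, so a minimal prime `p` lies in `(x)`. As `x ∉ p`, this forces `p = x p`, and Nakayama
gives `p = 0`. -/
theorem isDomain_of_isRegularLocalRing_of_dim (d : ℕ) : ∀ (S : Type u) [CommRing S]
    [IsRegularLocalRing S], ringKrullDim S = d → IsDomain S := by
  induction d with
  | zero =>
    intro S _ _ hd
    have h := IsRegularLocalRing.spanFinrank_maximalIdeal (R := S)
    rw [hd] at h
    norm_cast at h
    rw [Submodule.spanFinrank_eq_zero_iff_eq_bot (IsNoetherian.noetherian _)] at h
    exact (isField_iff_maximalIdeal_eq.2 h).isDomain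
  | succ d ih =>
    intro S _ _ hd
    have hbot : ¬ maximalIdeal S ≤ maximalIdeal S ^ 2 := by
      intro h
      have h := maximalIdeal_eq_bot_of_le_sq h
      have h' := ringKrullDim_eq_zero_of_isField (isField_iff_maximalIdeal_eq.2 h)
      rw [hd] at h'
      norm_cast at h'
    have hmin : ∀ p ∈ minimalPrimes S, ¬ maximalIdeal S ≤ p := by
      intro p hp h
      have := hp.1.1
      have e : p = maximalIdeal S := le_antisymm (le_maximalIdeal this.ne_top) h
      subst e
      have h1 : (maximalIdeal S).height = 0 := by
        exact Ideal.height_eq_zero_iff.2 hp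
      have h2 := maximalIdeal_height_eq_ringKrullDim (R := S)
      rw [h1, hd] at h2
      norm_cast at h2
    -- Prime avoidance still applies although the square of the maximal ideal is not prime, since
    -- exceptional ideals are allowed.
    obtain ⟨x, hxm, hx⟩ : ∃ x ∈ maximalIdeal S, x ∉ ⋃ i ∈ insert (maximalIdeal S ^ 2)
        (minimalPrimes S), (i : Set S) := by
      by_contra! hc
      obtain ⟨i, hi, hle⟩ := (Ideal.subset_union_prime_finite
        (f := id) (Set.Finite.insert (maximalIdeal S ^ 2) (minimalPrimes.finite_of_isNoetherianRing S))
        (maximalIdeal S ^ 2) (maximalIdeal S ^ 2) (fun i hi h _ => by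
          rcases hi with rfl | hi
          · exact absurd rfl h
          · exact hi.1.1)).1 (fun z hz => hc z hz)
      rcases hi with rfl | hi
      · exact hbot hle
      · exact hmin i hi hle
    simp only [Set.mem_iUnion, not_exists] at hx
    have hx2 := hx _ (Set.mem_insert _ _)
    obtain ⟨hreg, hdim⟩ := isRegularLocalRing_quotient hxm hx2
    have hd' : ringKrullDim (S ⧸ Ideal.span {x}) = d := by
      obtain ⟨k, hk⟩ := exists_ringKrullDim_eq_natCast (S ⧸ Ideal.span {x})
      rw [hk, hd] at hdim
      rw [hk]
      norm_cast at hdim ⊢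
      omega
    have hdom := ih _ hd'
    have hprime := (Ideal.Quotient.isDomain_iff_prime _).1 hdom
    obtain ⟨p, hp, hple⟩ := Ideal.exists_minimalPrimes_le (bot_le : ⊥ ≤ Ideal.span {x})
    have := hp.1.1
    have hp0 : p = ⊥ := by
      refine Submodule.eq_bot_of_le_smul_of_le_jacobson_bot (maximalIdeal S) p
        (IsNoetherian.noetherian _) ?_ (maximalIdeal_le_jacobson _)
      intro a ha
      obtain ⟨c, rfl⟩ := Ideal.mem_span_singleton'.1 (hple ha)
      have hc : c ∈ p := (this.mem_or_mem ha).resolve_right (hx p (Set.mem_insert_of_mem _ hp))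
      rw [mul_comm]
      exact Submodule.smul_mem_smul hxm hc
    subst hp0
    exact IsDomain.of_bot_isPrime S

instance (priority := 50) isDomain_of_isRegularLocalRing [IsRegularLocalRing S] : IsDomain S :=
  let ⟨d, hd⟩ := exists_ringKrullDim_eq_natCast S
  isDomain_of_isRegularLocalRing_of_dim d S hd

theorem isPrime_span_singleton [IsRegularLocalRing S] {x : S}
    (hx : x ∈ maximalIdeal S) (hx2 : x ∉ maximalIdeal S ^ 2) : (Ideal.span {x}).IsPrime := by
  have := (isRegularLocalRing_quotient hx hx2).1
  exact (Ideal.Quotient.isDomain_iff_prime _).1 inferInstance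

theorem exists_isRegular_of_dim (d : ℕ) : ∀ (S : Type u) [CommRing S]
    [IsRegularLocalRing S], ringKrullDim S = d → ∃ rs : List S, rs.length = d ∧
      (∀ r ∈ rs, r ∈ maximalIdeal S) ∧ RingTheory.Sequence.IsRegular S rs := by
  induction d with
  | zero =>
    intro S _ _ hd
    exact ⟨[], rfl, by simp, RingTheory.Sequence.IsRegular.nil _ _⟩
  | succ d ih =>
    intro S _ _ hd
    obtain ⟨x, hxm, hx2⟩ := exists_mem_maximalIdeal_notMem_sq (S := S) (by
      intro h
      have h' := ringKrullDim_eq_zero_of_isField (isField_iff_maximalIdeal_eq.2 h)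
      rw [hd] at h'
      norm_cast at h')
    have hx0 : x ≠ 0 := by rintro rfl; exact hx2 (Ideal.zero_mem _)
    obtain ⟨hreg, hdim⟩ := isRegularLocalRing_quotient hxm hx2
    have hd' : ringKrullDim (S ⧸ Ideal.span {x}) = d := by
      obtain ⟨k, hk⟩ := exists_ringKrullDim_eq_natCast (S ⧸ Ideal.span {x})
      rw [hk, hd] at hdim
      rw [hk]
      norm_cast at hdim ⊢
      omega
    obtain ⟨rs, hlen, hmem, hrs⟩ := ih _ hd'
    choose g hg using Ideal.Quotient.mk_surjective (I := Ideal.span {x})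
    refine ⟨x :: rs.map g, by simp [hlen], ?_, ?_⟩
    · intro r hr
      rcases List.mem_cons.1 hr with rfl | hr
      · exact hxm
      · obtain ⟨t, ht, rfl⟩ := List.mem_map.1 hr
        have := hmem t ht
        rw [mem_maximalIdeal] at this ⊢
        intro hu
        rw [← hg t] at this
        exact this (hu.map _)
    · rw [RingTheory.Sequence.isRegular_cons_iff]
      refine ⟨?_, ?_⟩
      · exact IsSMulRegular.of_ne_zero hx0
      · have e : (x • (⊤ : Submodule S S)) = Ideal.span {x} := by
          rw [← Submodule.ideal_span_singleton_smul, smul_eq_mul, Ideal.mul_top]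
        refine (AddEquiv.isRegular_congr
          (e := (Submodule.quotEquivOfEq _ _ e).toAddEquiv) ?_).2 hrs
        rw [List.forall₂_map_left_iff, List.forall₂_same]
        intro t _ z
        obtain ⟨z, rfl⟩ := Submodule.Quotient.mk_surjective _ z
        conv_rhs => rw [← hg t]
        rfl

/-- The form of "depth at least two" needed for extending functions over codimension two: `x` is a
regular parameter, so `(x)` is prime, and `y` is any element of the maximal ideal outside it. -/
theorem exists_regular_pair [IsRegularLocalRing S] (h : 1 < ringKrullDim S) :
    ∃ x ∈ maximalIdeal S, ∃ y ∈ maximalIdeal S, x ≠ 0 ∧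
      ∀ c d : S, c * y = d * x → x ∣ c := by
  obtain ⟨x, hxm, hx2⟩ := exists_mem_maximalIdeal_notMem_sq (S := S) (by
    intro h'
    have h' := ringKrullDim_eq_zero_of_isField (isField_iff_maximalIdeal_eq.2 h')
    rw [h'] at h
    exact absurd h (by norm_num))
  have hx0 : x ≠ 0 := by rintro rfl; exact hx2 (Ideal.zero_mem _)
  obtain ⟨hreg, hdim⟩ := isRegularLocalRing_quotient hxm hx2
  have hp := isPrime_span_singleton hxm hx2
  have : ¬ maximalIdeal S ≤ Ideal.span {x} := by
    intro hle
    have e : maximalIdeal S = Ideal.span {x} :=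
      le_antisymm hle ((Ideal.span_singleton_le_iff_mem _).2 hxm)
    have : IsField (S ⧸ Ideal.span {x}) :=
      (Ideal.Quotient.maximal_ideal_iff_isField_quotient _).1 (e ▸ maximalIdeal.isMaximal S)
    rw [ringKrullDim_eq_zero_of_isField this] at hdim
    rw [← hdim] at h
    exact absurd h (by norm_num)
  obtain ⟨y, hy, hyx⟩ := SetLike.not_le_iff_exists.1 this
  refine ⟨x, hxm, y, hy, hx0, fun c d e => ?_⟩
  have h1 : c * y ∈ Ideal.span {x} := Ideal.mem_span_singleton'.2 ⟨d, e.symm⟩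
  exact Ideal.mem_span_singleton.1 ((hp.mem_or_mem h1).resolve_right hyx)

theorem isDiscreteValuationRing_of_dim_one [IsRegularLocalRing S] (h : ringKrullDim S = 1) :
    IsDiscreteValuationRing S := by
  have h1 := IsRegularLocalRing.spanFinrank_maximalIdeal (R := S)
  rw [h] at h1
  norm_cast at h1
  have hF : ¬ IsField S := fun hF => by
    rw [ringKrullDim_eq_zero_of_isField hF] at h
    exact absurd h (by norm_num)
  rw [spanFinrank_maximalIdeal_eq_finrank_cotangentSpace] at h1
  exact ((IsDiscreteValuationRing.TFAE S hF).out 0 5).2 h1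

end Regular

end TameCover

namespace TameCover

open IsLocalRing Pointwise

/-! ### Divisibility in codimension one -/

theorem notMem_of_dvd_localization {A : Type u} [CommRing A] {p : Ideal A} [p.IsPrime] {a c : A}
    (h : algebraMap A (Localization.AtPrime p) a ∣ algebraMap A (Localization.AtPrime p) c) :
    ∃ u ∉ p, a ∣ u * c := by
  obtain ⟨d, hd⟩ := h
  obtain ⟨⟨d, s⟩, rfl⟩ := IsLocalization.mk'_surjective p.primeCompl d
  dsimp only at hd
  have hd := congrArg (· * algebraMap A (Localization.AtPrime p) s) hd
  simp only [mul_assoc, IsLocalization.mk'_spec] at hd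
  rw [← map_mul, ← map_mul, IsLocalization.eq_iff_exists p.primeCompl] at hd
  obtain ⟨t, ht⟩ := hd
  exact ⟨t * s, mul_mem t.2 s.2, d * t, by
    calc (t : A) * s * c = t * (c * s) := by ring
    _ = t * (a * d) := by rw [ht]
    _ = a * (d * t) := by ring⟩

/-- In a Noetherian domain with regular local rings, divisibility may be tested at the primes of
height one. -/
theorem dvd_of_forall_height_one {A : Type u} [CommRing A] [IsDomain A] [IsNoetherianRing A]
    (hA : ∀ (p : Ideal A) [p.IsPrime], IsRegularLocalRing (Localization.AtPrime p))
    {a b : A} (ha : a ≠ 0)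
    (h : ∀ (p : Ideal A) [p.IsPrime], p.height = 1 →
      algebraMap A (Localization.AtPrime p) a ∣ algebraMap A (Localization.AtPrime p) b) :
    a ∣ b := by
  by_contra hab
  set y : A ⧸ Ideal.span {a} := Ideal.Quotient.mk _ b with hy
  have hy0 : y ≠ 0 := by
    rw [hy, Ne, Ideal.Quotient.eq_zero_iff_mem, Ideal.mem_span_singleton]; exact hab
  have : Nontrivial (Submodule.span A {y}) := by
    refine ⟨⟨⟨y, Submodule.mem_span_singleton_self y⟩, 0, fun e => hy0 (congrArg Subtype.val e)⟩⟩
  -- An associated prime of the submodule spanned by the class of `b` is the annihilator, modulo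
  -- `a`, of some multiple `c` of `b`. The failure of divisibility is thus concentrated at `p`.
  obtain ⟨p, hp⟩ := associatedPrimes.nonempty A (Submodule.span A {y})
  obtain ⟨hpp, f, hf⟩ := (isAssociatedPrime_iff_exists_injective_linearMap p _).1 hp
  obtain ⟨r, hr⟩ := Submodule.mem_span_singleton.1 (f (Ideal.Quotient.mk p 1)).2
  set c := r * b with hc
  have hpc : ∀ z, z ∈ p ↔ a ∣ z * c := by
    intro z
    rw [← Ideal.Quotient.eq_zero_iff_mem, ← map_eq_zero_iff f hf]
    have e1 : Ideal.Quotient.mk p z = z • Ideal.Quotient.mk p 1 := by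
      rw [← mul_one z, map_mul, mul_one]; rfl
    rw [e1, map_smul, ← Subtype.val_inj, Submodule.coe_smul, ← hr, Submodule.coe_zero,
      ← Ideal.mem_span_singleton, ← Ideal.Quotient.eq_zero_iff_mem, hc, map_mul, map_mul]
    rfl
  have hap : a ∈ p := (hpc a).2 (dvd_mul_right a c)
  have hnd : ¬ algebraMap A (Localization.AtPrime p) a ∣ algebraMap A (Localization.AtPrime p) c := by
    intro hd
    obtain ⟨u, hu, hud⟩ := notMem_of_dvd_localization hd
    exact hu ((hpc u).2 hud)
  have := hA p
  have hdim : ringKrullDim (Localization.AtPrime p) = p.height := by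
    rw [IsLocalization.AtPrime.ringKrullDim_eq_height p]
  by_cases h1 : 1 < ringKrullDim (Localization.AtPrime p)
  -- In depth at least two, both `x c` and `y c` are multiples of `a`. Comparing the two quotients
  -- shows that the first is divisible by `x`, so `a` already divides `c` locally, a contradiction.
  · obtain ⟨x, hx, y, hy, hx0, hxy⟩ := exists_regular_pair h1
    have hm : ∀ z ∈ maximalIdeal (Localization.AtPrime p),
        algebraMap A (Localization.AtPrime p) a ∣ z * algebraMap A (Localization.AtPrime p) c := by
      intro z hz
      rw [← Ideal.mem_span_singleton]
      have hle : (maximalIdeal (Localization.AtPrime p)) ≤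
          Submodule.comap (LinearMap.mulRight _ (algebraMap A (Localization.AtPrime p) c))
            (Ideal.span {algebraMap A (Localization.AtPrime p) a}) := by
        rw [← Localization.AtPrime.map_eq_maximalIdeal, Ideal.map_le_iff_le_comap]
        intro w hw
        change algebraMap A (Localization.AtPrime p) w * algebraMap A (Localization.AtPrime p) c ∈
          Ideal.span {algebraMap A (Localization.AtPrime p) a}
        rw [Ideal.mem_span_singleton, ← map_mul]
        obtain ⟨t, ht⟩ := (hpc w).1 hw
        exact ⟨algebraMap A _ t, by rw [← map_mul, ← ht]⟩
      exact hle hz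
    obtain ⟨α, hα⟩ := hm x hx
    obtain ⟨β, hβ⟩ := hm y hy
    have ha' : algebraMap A (Localization.AtPrime p) a ≠ 0 := by
      rw [Ne, FaithfulSMul.algebraMap_eq_zero_iff]; exact ha
    have e : α * y = β * x := by
      apply mul_left_cancel₀ ha'
      calc _ = (algebraMap A (Localization.AtPrime p) a * α) * y := by ring
      _ = (algebraMap A (Localization.AtPrime p) a * β) * x := by rw [← hα, ← hβ]; ring
      _ = _ := by ring
    obtain ⟨γ, rfl⟩ := hxy _ _ e
    exact hnd ⟨γ, mul_left_cancel₀ hx0 (by rw [hα]; ring)⟩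
  · rw [hdim] at h1
    have h1' : p.height ≤ 1 := by
      rw [not_lt] at h1
      exact_mod_cast h1
    rcases Order.le_one_iff.1 h1' with h0 | h1
    · rw [Ideal.height_eq_zero_iff] at h0
      have : p = ⊥ := by
        rw [IsDomain.minimalPrimes_eq_singleton_bot] at h0
        exact h0
      rw [this] at hap
      exact ha hap
    · refine hnd ((h p h1).trans ?_)
      rw [hc, map_mul]
      exact dvd_mul_left _ _

/-! ### Freeness from regular sequences -/

/-- Freeness of `M / rM` over `A / r` lifts to `M` when `r` is `M`-regular. Dividing out a regular
sequence that generates the maximal ideal ends over a field, where every module is free. -/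
theorem free_of_isWeaklyRegular (k : ℕ) : ∀ (A : Type u) [CommRing A] [IsLocalRing A]
    [IsNoetherianRing A] (M : Type u) [AddCommGroup M] [Module A M] [Module.Finite A M]
    (rs : List A), rs.length = k → Ideal.ofList rs = maximalIdeal A →
    RingTheory.Sequence.IsWeaklyRegular M rs → Module.Free A M := by
  induction k with
  | zero =>
    intro A _ _ _ M _ _ _ rs hl hrs _
    rw [List.length_eq_zero_iff] at hl
    subst hl
    rw [Ideal.ofList_nil] at hrs
    let := (isField_iff_maximalIdeal_eq.2 hrs.symm).toField
    exact Module.Free.of_divisionRing A M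
  | succ k ih =>
    intro A _ _ _ M _ _ _ rs hl hrs hreg
    match rs, hl with
    | r :: rs, hl =>
      rw [RingTheory.Sequence.isWeaklyRegular_cons_iff'] at hreg
      have hr : r ∈ maximalIdeal A := by
        rw [← hrs, Ideal.ofList_cons]
        exact Ideal.mem_sup_left (Ideal.mem_span_singleton_self r)
      have : Nontrivial (A ⧸ Ideal.span {r}) := Ideal.Quotient.nontrivial_iff.2 (by
        rw [Ne, Ideal.span_singleton_eq_top]; exact hr)
      have : IsLocalRing (A ⧸ Ideal.span {r}) :=
        IsLocalRing.of_surjective' _ Ideal.Quotient.mk_surjective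
      have := Module.finitePresentation_of_finite A M
      have := Module.Finite.of_restrictScalars_finite A (A ⧸ Ideal.span {r}) (QuotSMulTop r M)
      refine (Module.free_quotSMulTop_iff_free A M (x := r)
        (maximalIdeal_le_jacobson _ hr) hreg.1).1 ?_
      · refine ih _ _ (rs.map (Ideal.Quotient.mk (Ideal.span {r}))) ?_ ?_ hreg.2
        · simpa using hl
        · have h2 : maximalIdeal (A ⧸ Ideal.span {r}) =
              (maximalIdeal A).map (Ideal.Quotient.mk (Ideal.span {r})) := by
            refine (eq_maximalIdeal ?_).symm
            refine Ideal.IsMaximal.map_of_surjective_of_ker_le Ideal.Quotient.mk_surjective ?_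
            rw [Ideal.mk_ker, Ideal.span_singleton_le_iff_mem]
            exact hr
          rw [h2, ← hrs, Ideal.ofList_cons, Ideal.map_sup, Ideal.map_span, Set.image_singleton,
            Ideal.Quotient.eq_zero_iff_mem.2 (Ideal.mem_span_singleton_self r),
            Ideal.span_singleton_eq_bot.2 rfl, bot_sup_eq, Ideal.map_ofList]

/-- Vanishing of `Hom(N, M)` yields an `M`-regular element annihilating `N`, so no associated prime
of `M` contains the extension of the maximal ideal of `A`. Prime avoidance among the contractions of
these primes finds the regular element inside `A`. The extra ideal `I` allows the element to be
chosen in a new cotangent direction. -/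
theorem exists_isSMulRegular_of_subsingleton_hom {A S : Type u} [CommRing A] [IsLocalRing A]
    [CommRing S] [IsNoetherianRing S] [Algebra A S] {M N : Type u} [AddCommGroup M] [Module S M]
    [Module.Finite S M] [AddCommGroup N] [Module S N] [Module.Finite S N]
    (hN : PrimeSpectrum.zeroLocus ((maximalIdeal A).map (algebraMap A S)) ⊆ Module.support S N)
    (h : Subsingleton (N →ₗ[S] M)) (I : Ideal A) (hI : ¬ maximalIdeal A ≤ I) :
    ∃ a ∈ maximalIdeal A, a ∉ I ∧ IsSMulRegular M (algebraMap A S a) := by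
  obtain ⟨x, hx, hxr⟩ := IsSMulRegular.subsingleton_linearMap_iff.1 h
  rw [Module.support_eq_zeroLocus] at hN
  have key : ∀ P ∈ associatedPrimes S M, ¬ maximalIdeal A ≤ P.comap (algebraMap A S) := by
    intro P hP hle
    have hPp : P.IsPrime := hP.isPrime
    have h1 := hN (a := ⟨P, hPp⟩) (Ideal.map_le_iff_le_comap.2 hle)
    have h2 : x ∈ P := h1 hx
    have h3 : x ∈ ⋃ P ∈ associatedPrimes S M, (P : Set S) := Set.mem_biUnion hP h2
    rw [biUnion_associatedPrimes_eq_compl_regular] at h3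
    exact h3 hxr
  have hfin := associatedPrimes.finite S M
  obtain ⟨a, ham, ha⟩ : ∃ a ∈ maximalIdeal A, a ∉ ⋃ i ∈ insert I
      ((fun P : Ideal S => P.comap (algebraMap A S)) '' associatedPrimes S M), (i : Set A) := by
    by_contra! hc
    obtain ⟨i, hi, hle⟩ := (Ideal.subset_union_prime_finite (f := id)
      (Set.Finite.insert I (hfin.image _)) I I (fun i hi h _ => by
        rcases hi with rfl | ⟨P, hP, rfl⟩
        · exact absurd rfl h
        · have : P.IsPrime := hP.isPrime
          exact Ideal.comap_isPrime _ _)).1 (fun z hz => hc z hz)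
    rcases hi with rfl | ⟨P, hP, rfl⟩
    · exact hI hle
    · exact key P hP hle
  simp only [Set.mem_iUnion, not_exists] at ha
  refine ⟨a, ham, ha I (Set.mem_insert _ _), ?_⟩
  by_contra hreg
  have h3 : algebraMap A S a ∈ (⋃ P ∈ associatedPrimes S M, (P : Set S)) := by
    rw [biUnion_associatedPrimes_eq_compl_regular]
    exact hreg
  obtain ⟨P, hP, hm⟩ := Set.mem_iUnion₂.1 h3
  exact ha _ (Set.mem_insert_of_mem _ ⟨P, hP, rfl⟩) hm

open Abelian in
-- Each vanishing Ext group supplies one regular element from `A`, taken outside the preimage of the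
-- current subspace `W` so that the spanned space grows. The number `k` of vanishing degrees bounds
-- the codimension of `W`, so the cotangent space is exhausted before the Ext groups are. By
-- Nakayama the sequence obtained from `W = 0` then generates the maximal ideal, which an arbitrary
-- maximal regular sequence need not do.
theorem exists_isWeaklyRegular_span_cotangent {A S : Type u} [CommRing A] [IsLocalRing A]
    [IsNoetherianRing A] [CommRing S] [IsNoetherianRing S] [Algebra A S] (N : ModuleCat.{u} S)
    [Module.Finite S N]
    (hN : PrimeSpectrum.zeroLocus ((maximalIdeal A).map (algebraMap A S)) ⊆ Module.support S N)
    (k : ℕ) : ∀ (M : ModuleCat.{u} S) [Module.Finite S M]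
    (W : Submodule (ResidueField A) (CotangentSpace A)),
    Module.finrank (ResidueField A) (CotangentSpace A) ≤ Module.finrank (ResidueField A) W + k →
    (∀ i < k, Subsingleton (Ext N M i)) →
    ∃ rs : List (maximalIdeal A),
      RingTheory.Sequence.IsWeaklyRegular M
        (rs.map fun a : maximalIdeal A => algebraMap A S (a : A)) ∧
      W ⊔ Submodule.span (ResidueField A) ((maximalIdeal A).toCotangent '' {a | a ∈ rs}) = ⊤ := by
  induction k with
  | zero =>
    intro M _ W hW _
    refine ⟨[], RingTheory.Sequence.IsWeaklyRegular.nil _ _, ?_⟩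
    have : W = ⊤ := Submodule.eq_top_of_finrank_eq (le_antisymm (Submodule.finrank_le W) hW)
    rw [this, top_sup_eq]
  | succ k ih =>
    intro M _ W hW hExt
    by_cases hWt : W = ⊤
    · exact ⟨[], RingTheory.Sequence.IsWeaklyRegular.nil _ _, by rw [hWt, top_sup_eq]⟩
    let I : Ideal A := ((W.restrictScalars A).comap (maximalIdeal A).toCotangent).map
      (maximalIdeal A).subtype
    have hI : ¬ maximalIdeal A ≤ I := by
      intro hle
      apply hWt
      rw [eq_top_iff]
      intro c _
      obtain ⟨a, rfl⟩ := (maximalIdeal A).toCotangent_surjective c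
      obtain ⟨b, hb, e⟩ := hle a.2
      rw [← Subtype.ext e]
      exact hb
    have : Subsingleton (N ⟶ M) :=
      Ext.addEquiv₀.subsingleton_congr.mp (hExt 0 k.zero_lt_succ)
    have hsub : Subsingleton (N →ₗ[S] M) := ModuleCat.homAddEquiv.symm.subsingleton
    obtain ⟨a, ham, haI, hreg⟩ := exists_isSMulRegular_of_subsingleton_hom hN hsub I hI
    set v : CotangentSpace A := (maximalIdeal A).toCotangent ⟨a, ham⟩ with hv
    have hvW : v ∉ W := fun h => haI ⟨⟨a, ham⟩, h, rfl⟩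
    -- In the long exact sequence for multiplication by `a`, the degree `i` group of the quotient is
    -- squeezed between the groups of `M` in degrees `i` and `i + 1`; one degree is lost.
    have hExt' : ∀ i < k, Subsingleton
        (Ext N (ModuleCat.of S (QuotSMulTop (algebraMap A S a) M)) i) := by
      intro i hi
      have zero1 := AddCommGrpCat.isZero_of_iff_subsingleton.mpr (hExt i (by omega))
      have zero2 := AddCommGrpCat.isZero_of_iff_subsingleton.mpr (hExt (i + 1) (by omega))
      exact AddCommGrpCat.subsingleton_of_isZero <| ShortComplex.Exact.isZero_of_both_zeros
        ((Ext.covariant_sequence_exact₃' N hreg.smulShortComplex_shortExact) i (i + 1) rfl)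
        (zero1.eq_zero_of_src _) (zero2.eq_zero_of_tgt _)
    obtain ⟨rs, hrs, htop⟩ := ih (ModuleCat.of S (QuotSMulTop (algebraMap A S a) M))
      (W ⊔ Submodule.span _ {v}) (by
        have hlt : W < W ⊔ Submodule.span (ResidueField A) {v} := by
          refine lt_of_le_of_ne le_sup_left fun e => hvW ?_
          rw [e]
          exact Submodule.mem_sup_right (Submodule.mem_span_singleton_self v)
        have := Submodule.finrank_lt_finrank_of_lt hlt
        omega) hExt'
    refine ⟨⟨a, ham⟩ :: rs, ?_, ?_⟩
    · rw [List.map_cons, RingTheory.Sequence.isWeaklyRegular_cons_iff]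
      exact ⟨hreg, hrs⟩
    · rw [← htop, sup_assoc]
      congr 1
      rw [← Submodule.span_union]
      congr 1
      have : {b | b ∈ (⟨a, ham⟩ : maximalIdeal A) :: rs} = insert ⟨a, ham⟩ {b | b ∈ rs} := by
        ext b; simp
      rw [this, Set.image_insert_eq]
      rfl

end TameCover

namespace TameCover

open IsLocalRing Pointwise

/-! ### Miracle flatness for quotients by finite groups -/

open Abelian in
theorem exists_isWeaklyRegular_ofList_eq {A S : Type u} [CommRing A] [IsRegularLocalRing A]
    [CommRing S] [IsRegularLocalRing S] [Algebra A S]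
    (hdim : ringKrullDim A ≤ ringKrullDim S)
    (hfin : ∀ P : Ideal S, P.IsPrime → (maximalIdeal A).map (algebraMap A S) ≤ P →
      P = maximalIdeal S) :
    ∃ rs : List A, Ideal.ofList rs = maximalIdeal A ∧
      RingTheory.Sequence.IsWeaklyRegular S (rs.map (algebraMap A S)) := by
  obtain ⟨d, hd⟩ := exists_ringKrullDim_eq_natCast S
  obtain ⟨rs, hlen, hmem, hreg⟩ := exists_isRegular_of_dim d S hd
  let J := (maximalIdeal A).map (algebraMap A S)
  have hsupp : Module.support S (S ⧸ J) = PrimeSpectrum.zeroLocus J := by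
    rw [Module.support_eq_zeroLocus, Ideal.annihilator_quotient]
  -- The closed fibre is supported at the closed point, and the regular ring `S` has a regular
  -- sequence of length `d`; so the Ext groups below degree `d` vanish.
  have hext : ∀ i < d, Subsingleton (Ext (ModuleCat.of S (S ⧸ J)) (ModuleCat.of S S) i) := by
    rw [← hlen]
    refine ModuleCat.subsingleton_ext_of_exists_isRegular (maximalIdeal S)
      (ModuleCat.of S (S ⧸ J)) ?_ (ModuleCat.of S S) ?_ rs hmem hreg
    · refine hsupp.trans_subset ?_
      intro P hP
      exact (hfin P.asIdeal P.isPrime hP).ge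
    · change maximalIdeal S • (⊤ : Submodule S S) < ⊤
      rw [smul_eq_mul, Ideal.mul_top]
      exact lt_top_iff_ne_top.2 (maximalIdeal.isMaximal S).ne_top
  obtain ⟨as, has, htop⟩ := exists_isWeaklyRegular_span_cotangent (A := A)
    (ModuleCat.of S (S ⧸ J)) hsupp.ge d (ModuleCat.of S S) ⊥ (by
      rw [← spanFinrank_maximalIdeal_eq_finrank_cotangentSpace]
      have := IsRegularLocalRing.spanFinrank_maximalIdeal (R := A)
      rw [← this, hd] at hdim
      norm_cast at hdim
      omega) hext
  refine ⟨as.map Subtype.val, ?_, by simpa [List.map_map, Function.comp_def] using has⟩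
  rw [bot_sup_eq, CotangentSpace.span_image_eq_top_iff] at htop
  have := congrArg (Submodule.map (maximalIdeal A).subtype) htop
  rw [Submodule.map_span, Submodule.map_top, Submodule.range_subtype] at this
  refine Eq.trans ?_ this
  rw [Ideal.ofList]
  congr 1
  ext z
  simp

/-- Miracle flatness at `q` gives a generating sequence of the maximal ideal of `A` that is regular
on the localization of `B`. Automorphisms over `A` move every maximal ideal to `q`, so the sequence
is regular on `B` itself, and regularity along generators of the maximal ideal gives freeness. -/
theorem free_of_isRegularLocalRing {A B : Type u} [CommRing A] [IsRegularLocalRing A] [CommRing B]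
    [Algebra A B] [Module.Finite A B] (q : Ideal B) [q.IsPrime]
    [IsRegularLocalRing (Localization.AtPrime q)]
    (hq : (maximalIdeal A).map (algebraMap A B) ≤ q)
    (hdim : ringKrullDim A ≤ ringKrullDim (Localization.AtPrime q))
    (htrans : ∀ q' : Ideal B, q'.IsMaximal → ∃ σ : B ≃ₐ[A] B, ∀ b, b ∈ q' ↔ σ b ∈ q) :
    Module.Free A B := by
  have hint : Algebra.IsIntegral A B := inferInstance
  have hcomap : ∀ P : Ideal B, P.IsPrime → (maximalIdeal A).map (algebraMap A B) ≤ P →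
      P.IsMaximal := by
    intro P hP hle
    have : P.comap (algebraMap A B) = maximalIdeal A :=
      (IsLocalRing.eq_maximalIdeal (Ideal.IsMaximal.eq_of_le (maximalIdeal.isMaximal A)
        (Ideal.comap_ne_top _ hP.ne_top) (Ideal.map_le_iff_le_comap.1 hle) ▸
          maximalIdeal.isMaximal A))
    exact Ideal.isMaximal_of_isIntegral_of_isMaximal_comap P (this ▸ maximalIdeal.isMaximal A)
  have hqm := hcomap q inferInstance hq
  have hmap : (maximalIdeal A).map (algebraMap A (Localization.AtPrime q)) =
      ((maximalIdeal A).map (algebraMap A B)).map (algebraMap B (Localization.AtPrime q)) := by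
    rw [Ideal.map_map, ← IsScalarTower.algebraMap_eq]
  obtain ⟨rs, hrs, hreg⟩ := exists_isWeaklyRegular_ofList_eq (A := A)
    (S := Localization.AtPrime q) hdim (by
      intro P hP hle
      rw [hmap, Ideal.map_le_iff_le_comap] at hle
      have h1 := hcomap _ (Ideal.comap_isPrime _ P) hle
      have h2 : P.comap (algebraMap B (Localization.AtPrime q)) ≤ q :=
        (Ideal.comap_mono (le_maximalIdeal hP.ne_top)).trans
          (Localization.AtPrime.under_maximalIdeal (I := q)).le
      have h3 := h1.eq_of_le hqm.ne_top h2
      refine (IsLocalRing.eq_maximalIdeal ?_)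
      have h4 : P = q.map (algebraMap B (Localization.AtPrime q)) :=
        (IsLocalization.map_under q.primeCompl _ P).symm.trans (congrArg (Ideal.map _) h3)
      rw [h4, Localization.AtPrime.map_eq_maximalIdeal]
      exact maximalIdeal.isMaximal _)
  rw [RingTheory.Sequence.isWeaklyRegular_map_algebraMap_iff] at hreg
  refine free_of_isWeaklyRegular rs.length A B rs rfl hrs ⟨fun i hi => ?_⟩
  have hi' := hreg.regular_mod_prev i hi
  set J := Ideal.ofList (rs.take i) with hJ
  set a := rs[i]
  rw [isSMulRegular_iff_right_eq_zero_of_smul] at hi' ⊢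
  intro z hz
  obtain ⟨b, rfl⟩ := Submodule.Quotient.mk_surjective _ z
  rw [← Submodule.Quotient.mk_smul, Submodule.Quotient.mk_eq_zero, Ideal.smul_top_eq_map] at hz
  rw [Submodule.Quotient.mk_eq_zero, Ideal.smul_top_eq_map]
  change a • b ∈ J.map (algebraMap A B) at hz
  change b ∈ J.map (algebraMap A B)
  have hσ : ∀ (σ : B ≃ₐ[A] B) {x : B}, x ∈ J.map (algebraMap A B) →
      σ x ∈ J.map (algebraMap A B) := by
    intro σ x hx
    have := Ideal.mem_map_of_mem (σ : B →+* B) hx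
    rwa [Ideal.map_map, show (σ : B →+* B).comp (algebraMap A B) = algebraMap A B from
      σ.toAlgHom.comp_algebraMap] at this
  -- The colon ideal of `b`. If proper, it lies in some maximal ideal, which an automorphism carries
  -- to `q`; regularity at `q` then contradicts this containment.
  let I : Ideal B := Submodule.comap (LinearMap.mulRight B b) (J.map (algebraMap A B))
  by_contra hb
  have hI : I ≠ ⊤ := fun h => hb (by
    have : (1 : B) ∈ I := h ▸ trivial
    simpa [I] using! this)
  obtain ⟨q', hq', hle⟩ := Ideal.exists_le_maximal I hI
  obtain ⟨σ, hs⟩ := htrans q' hq'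
  have h1 := hi' (Submodule.Quotient.mk (algebraMap B (Localization.AtPrime q) (σ b))) (by
    rw [← Submodule.Quotient.mk_smul, Submodule.Quotient.mk_eq_zero, Ideal.smul_top_eq_map]
    have := Ideal.mem_map_of_mem (algebraMap B (Localization.AtPrime q)) (hσ σ hz)
    rw [Ideal.map_map, ← IsScalarTower.algebraMap_eq, map_smul, Algebra.smul_def, map_mul,
      ← IsScalarTower.algebraMap_apply] at this
    rw [Algebra.smul_def]
    exact this)
  rw [Submodule.Quotient.mk_eq_zero, Ideal.smul_top_eq_map] at h1
  change algebraMap B (Localization.AtPrime q) (σ b) ∈ J.map (algebraMap A _) at h1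
  rw [IsScalarTower.algebraMap_eq A B, ← Ideal.map_map,
    IsLocalization.algebraMap_mem_map_algebraMap_iff q.primeCompl] at h1
  obtain ⟨u, hu, hub⟩ := h1
  have h2 : σ.symm u ∈ I := by
    change σ.symm u * b ∈ J.map (algebraMap A B)
    have := hσ σ.symm hub
    simpa using this
  exact hu (by simpa using (hs _).1 (hle h2))

end TameCover

/-! ### Flatness of a regular ring over its regular ring of invariants -/

namespace TameCover
open IsLocalRing Pointwise

section Invariant

variable (A B : Type u) [CommRing A] [CommRing B] [Algebra A B] (G : Type v) [Group G] [Finite G]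
  [MulSemiringAction G B] [SMulCommClass G A B] [Algebra.IsInvariant A B G]

include G in
-- Lift the smaller prime, go up from it to a prime over the same prime as `Q`, and translate the
-- whole chain by a group element so that its top becomes `Q`.
theorem hasGoingDown_of_isInvariant [FaithfulSMul A B] : Algebra.HasGoingDown A B where
  exists_ideal_le_liesOver_of_lt := by
    intro p _ Q _ hlt
    have := Algebra.IsInvariant.isIntegral A B G
    obtain ⟨P, -, hP, hPp⟩ := Ideal.exists_ideal_over_prime_of_isIntegral p (⊥ : Ideal B)
      (by
        rw [← RingHom.ker_eq_comap_bot,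
          (RingHom.injective_iff_ker_eq_bot _).1 (FaithfulSMul.algebraMap_injective A B)]
        exact bot_le)
    obtain ⟨Q', hQ', hQ'p, hQ'c⟩ := Ideal.exists_ideal_over_prime_of_isIntegral (Q.under A) P
      (hPp.le.trans hlt.le)
    obtain ⟨g, hg⟩ := Algebra.IsInvariant.exists_smul_of_under_eq A B G Q' Q hQ'c
    refine ⟨g • P, hg ▸ Ideal.pointwise_smul_le_pointwise_smul_iff.2 hQ', hP.smul g, ⟨?_⟩⟩
    rw [Ideal.under_smul]
    exact hPp.symm

theorem height_under_eq [Algebra.IsIntegral A B] [Algebra.HasGoingDown A B] [IsNoetherianRing A]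
    [IsNoetherianRing B] (P : Ideal B) [P.IsPrime] : (P.under A).height = P.height := by
  apply le_antisymm
  · rw [Ideal.height_eq_height_add_of_liesOver_of_hasGoingDown (P.under A) P]
    exact le_self_add
  · have h := Order.height_le_height_apply_of_strictMono
      (PrimeSpectrum.comap (algebraMap A B))
      (fun P Q h => by
        rw [← PrimeSpectrum.asIdeal_lt_asIdeal] at h ⊢
        exact Ideal.IsIntegral.comap_lt_comap h) ⟨P, inferInstance⟩
    have h1 := PrimeSpectrum.height_eq_orderHeight (⟨P, inferInstance⟩ : PrimeSpectrum B)
    have h2 := PrimeSpectrum.height_eq_orderHeight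
      (PrimeSpectrum.comap (algebraMap A B) ⟨P, inferInstance⟩)
    exact (h1.trans_le h).trans h2.symm.le

attribute [local instance] Algebra.TensorProduct.rightAlgebra in
include G in
theorem flat_of_isRegularRing [FaithfulSMul A B] [IsRegularRing A] [IsRegularRing B]
    [Module.Finite A B] : Module.Flat A B := by
  have := hasGoingDown_of_isInvariant A B G
  have := Algebra.IsInvariant.isIntegral A B G
  refine Module.flat_of_localized_maximal _ fun p hp => ?_
  let L := Localization.AtPrime p
  -- After localizing at `p`, every localization of the fibre algebra at a prime is a localization
  -- of `B`, hence regular. Transitivity of `G` on the primes over `p` provides the automorphisms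
  -- required for freeness.
  have key : Module.Free L (L ⊗[A] B) := by
    have hloc : IsLocalization (Algebra.algebraMapSubmonoid B p.primeCompl) (L ⊗[A] B) :=
      inferInstance
    have hunder : ∀ q : Ideal (L ⊗[A] B), (q.under B).under A = (q.under L).under A := by
      intro q
      rw [Ideal.under_under, Ideal.under_under]
    have hloc' : ∀ q : Ideal (L ⊗[A] B), (q.under B).map (algebraMap B (L ⊗[A] B)) = q :=
      IsLocalization.map_under (Algebra.algebraMapSubmonoid B p.primeCompl) _
    have hinj : Function.Injective (algebraMap L (L ⊗[A] B)) := by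
      have h := Module.Flat.lTensor_preserves_injective_linearMap (M := L)
        (Algebra.linearMap A B) (FaithfulSMul.algebraMap_injective A B)
      have e : ∀ l : L, algebraMap L (L ⊗[A] B) l =
          (Algebra.linearMap A B).lTensor L (l ⊗ₜ[A] (1 : A)) := fun l => by simp
      intro x y hxy
      rw [e, e] at hxy
      have h3 := h hxy
      have := congrArg (TensorProduct.rid A L) h3
      simpa using this
    obtain ⟨q, -, hq, hqm⟩ := Ideal.exists_ideal_over_prime_of_isIntegral (S := L ⊗[A] B)
      (maximalIdeal L) ⊥ (by
        rw [← RingHom.ker_eq_comap_bot, (RingHom.injective_iff_ker_eq_bot _).1 hinj]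
        exact bot_le)
    have hqp : (q.under B).under A = p := by
      rw [hunder, show q.under L = maximalIdeal L from hqm]
      exact Localization.AtPrime.under_maximalIdeal (I := p)
    have hat : IsLocalization.AtPrime (Localization.AtPrime q) (q.under B) :=
      IsLocalization.isLocalization_isLocalization_atPrime_isLocalization
        (Algebra.algebraMapSubmonoid B p.primeCompl) (Localization.AtPrime q) q
    have : IsRegularLocalRing (Localization.AtPrime q) :=
      IsRegularLocalRing.of_ringEquiv (IsLocalization.algEquiv (q.under B).primeCompl
        (Localization.AtPrime (q.under B)) (Localization.AtPrime q)).toRingEquiv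
    refine free_of_isRegularLocalRing (A := L) q (Ideal.map_le_iff_le_comap.2 hqm.ge) ?_ ?_
    · rw [IsLocalization.AtPrime.ringKrullDim_eq_height p,
        IsLocalization.AtPrime.ringKrullDim_eq_height (q.under B), ← height_under_eq A B, hqp]
    · intro q' hq'
      have hq'm : q'.under L = maximalIdeal L :=
        IsLocalRing.eq_maximalIdeal (Ideal.isMaximal_comap_of_isIntegral_of_isMaximal q')
      obtain ⟨g, hg⟩ := Algebra.IsInvariant.exists_smul_of_under_eq A B G (q'.under B) (q.under B)
        (by rw [hunder, hunder, hq'm]; exact congrArg _ hqm.symm)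
      let σ : (L ⊗[A] B) ≃ₐ[L] (L ⊗[A] B) :=
        Algebra.TensorProduct.congr AlgEquiv.refl (MulSemiringAction.toAlgEquiv A B g)
      refine ⟨σ, ?_⟩
      have : q' = q.comap σ := by
        rw [← hloc' q', ← hloc' (q.comap σ)]
        congr 1
        have hg' : q'.under B = g⁻¹ • q.under B := by rw [hg, inv_smul_smul]
        rw [hg']
        ext b
        rw [Ideal.mem_inv_pointwise_smul_iff]
        have e : ∀ c : B, algebraMap B (L ⊗[A] B) c = 1 ⊗ₜ c := fun _ => rfl
        simp only [Ideal.under_def, Ideal.mem_comap, e]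
        simp [σ]
      intro b
      rw [this, Ideal.mem_comap]
  have : Module.Flat A (L ⊗[A] B) := Module.Flat.trans A L _
  exact Module.Flat.of_linearEquiv
    ((LocalizedModule.equivTensorProduct p.primeCompl B).restrictScalars A)

end Invariant

end TameCover

/-! ### Tame groups and eigenspaces -/

namespace TameCover
open IsLocalRing Pointwise

set_option linter.unusedSectionVars false

/-- The order of the finite group `G` is invertible in `R`, and the `R`-valued characters of `G`
separate its elements. -/
class IsTameGroup (R : Type u) [CommRing R] (G : Type v) [CommGroup G] : Prop where
  isUnit_card : IsUnit (Nat.card G : R)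
  enough : HasEnoughRootsOfUnity R (Monoid.exponent G)

attribute [instance] IsTameGroup.enough

theorem IsTameGroup.of_exponent_dvd {R : Type u} [CommRing R] [IsDomain R] {G : Type v}
    [CommGroup G] [Finite G] {n : ℕ} (hn : IsUnit (n : R)) (hζ : ∃ ζ : R, IsPrimitiveRoot ζ n)
    (hG : Monoid.exponent G ∣ n) : IsTameGroup R G where
  isUnit_card := by
    -- The order of a finite abelian group divides a power of its exponent, so it is invertible as
    -- soon as `n` is.
    refine isUnit_of_dvd_unit (Nat.cast_dvd_cast (card_dvd_exponent_pow_rank G)) ?_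
    rw [Nat.cast_pow]
    exact (isUnit_of_dvd_unit (Nat.cast_dvd_cast hG) hn).pow _
  enough := by
    have h0 : n ≠ 0 := by
      rintro rfl
      simp at hn
    have : NeZero n := ⟨h0⟩
    have : HasEnoughRootsOfUnity R n := ⟨hζ, rootsOfUnity.isCyclic R n⟩
    exact HasEnoughRootsOfUnity.of_dvd R hG

/-- The powers of `c` sum to zero, so `N` is the sum of the differences `1 - c ^ i`, each divisible
by `1 - c`. -/
theorem isUnit_one_sub_of_pow_eq_one {R : Type u} [CommRing R] [IsDomain R] {N : ℕ}
    (hN : IsUnit (N : R)) {c : R} (hc : c ^ N = 1) (h1 : c ≠ 1) : IsUnit (1 - c) := by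
  have h2 : ∑ i ∈ Finset.range N, c ^ i = 0 := by
    have := mul_geom_sum c N
    rw [hc, sub_self] at this
    exact (mul_eq_zero.1 this).resolve_left (sub_ne_zero.2 h1)
  have h3 : (N : R) = ∑ i ∈ Finset.range N, (1 - c ^ i) := by
    rw [Finset.sum_sub_distrib, h2]
    simp
  refine isUnit_of_dvd_unit ?_ hN
  rw [h3]
  exact Finset.dvd_sum fun i _ => by simpa using sub_dvd_pow_sub_pow 1 c i

/-- Distinct roots of unity of invertible order differ by a unit. Characters can therefore be
compared after reduction modulo a prime. -/
theorem units_eq_of_sub_mem {R : Type u} [CommRing R] [IsDomain R] {S : Type*} [CommRing S]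
    (f : R →+* S) {N : ℕ} (hN : IsUnit (N : R)) {a b : Rˣ} (ha : a ^ N = 1) (hb : b ^ N = 1)
    {I : Ideal S} (hI : I ≠ ⊤) (h : f a - f b ∈ I) : a = b := by
  by_contra hne
  apply hI
  have h1 : IsUnit (1 - ((b * a⁻¹ : Rˣ) : R)) := by
    refine isUnit_one_sub_of_pow_eq_one hN ?_ ?_
    · rw [← Units.val_pow_eq_pow_val, mul_pow, inv_pow, ha, hb]
      simp
    · rw [Ne, Units.val_eq_one, mul_inv_eq_one]
      exact fun e => hne e.symm
  have h2 : (a : R) - b = a * (1 - ((b * a⁻¹ : Rˣ) : R)) := by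
    rw [mul_sub, mul_one, ← Units.val_mul, mul_comm b, mul_inv_cancel_left]
  refine I.eq_top_of_isUnit_mem (x := f a - f b) h ?_
  rw [← map_sub, h2]
  exact (a.isUnit.mul h1).map f

section Eigen

variable {R : Type u} (A : Type u) {B : Type u} [CommRing R] [CommRing A] [CommRing B]
  [Algebra R A] [Algebra R B] [Algebra A B] [IsScalarTower R A B]
  {G : Type v} [CommGroup G] [MulSemiringAction G B] [SMulCommClass G A B] [SMulCommClass G R B]

/-- The elements of `B` on which `G` acts through the character `χ`. -/
def eigen (χ : G →* Rˣ) : Submodule A B where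
  carrier := {b | ∀ g : G, g • b = (χ g : R) • b}
  zero_mem' := fun g => by simp
  add_mem' := fun {b c} hb hc g => by rw [smul_add, hb g, hc g, smul_add]
  smul_mem' := fun a b hb g => by
    rw [smul_comm, hb g, Algebra.smul_def, Algebra.smul_def a, mul_smul_comm]

variable {A}

theorem mul_mem_eigen {χ ψ : G →* Rˣ} {b c : B} (hb : b ∈ eigen A χ) (hc : c ∈ eigen A ψ) :
    b * c ∈ eigen A (χ * ψ) := fun g => by
  rw [smul_mul', hb g, hc g, smul_mul_smul_comm, MonoidHom.mul_apply, Units.val_mul]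

theorem one_mem_eigen : (1 : B) ∈ eigen A (1 : G →* Rˣ) := fun g => by
  simp

theorem pow_mem_eigen {χ : G →* Rˣ} {b : B} (hb : b ∈ eigen A χ) (k : ℕ) :
    b ^ k ∈ eigen A (χ ^ k) := by
  induction k with
  | zero =>
    rw [pow_zero, pow_zero χ]
    exact one_mem_eigen
  | succ k ih =>
    rw [pow_succ, pow_succ χ]
    exact mul_mem_eigen ih hb

theorem char_pow_card [Finite G] (χ : G →* Rˣ) : χ ^ Nat.card G = 1 := by
  ext g
  simp [← map_pow]

theorem char_apply_pow_card [Finite G] (χ : G →* Rˣ) (g : G) : χ g ^ Nat.card G = 1 := by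
  simp [← map_pow]

theorem mem_eigen_one_iff [Algebra.IsInvariant A B G] {b : B} :
    b ∈ eigen A (1 : G →* Rˣ) ↔ b ∈ Set.range (algebraMap A B) := by
  constructor
  · intro h
    exact Algebra.IsInvariant.isInvariant (A := A) (G := G) b fun g => by simpa using h g
  · rintro ⟨a, rfl⟩ g
    simp

variable (A B) in
/-- The projection of `B` onto the eigenspace of the character `χ`. -/
noncomputable def eigenProj [Fintype G] [IsTameGroup R G] (χ : G →* Rˣ) : B →ₗ[A] B where
  toFun b := ((IsTameGroup.isUnit_card : IsUnit (Nat.card G : R)).unit⁻¹ : Rˣ) •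
    ∑ g : G, (χ g)⁻¹ • g • b
  map_add' b c := by simp only [smul_add, Finset.sum_add_distrib]
  map_smul' a b := by
    simp only [Units.smul_def, RingHom.id_apply]
    simp only [Algebra.smul_def a, smul_mul', smul_algebraMap, mul_smul_comm, Finset.mul_sum]

theorem eigenProj_apply [Fintype G] [IsTameGroup R G] (χ : G →* Rˣ) (b : B) :
    eigenProj A B χ b = ((IsTameGroup.isUnit_card : IsUnit (Nat.card G : R)).unit⁻¹ : Rˣ) •
      ∑ g : G, (χ g)⁻¹ • g • b := rfl

theorem eigenProj_mem [Fintype G] [IsTameGroup R G] (χ : G →* Rˣ) (b : B) :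
    eigenProj A B χ b ∈ eigen A χ := by
  intro h
  rw [eigenProj_apply, ← Units.smul_def]
  rw [smul_comm h, smul_comm (χ h)]
  congr 1
  rw [Finset.smul_sum, Finset.smul_sum]
  refine Fintype.sum_equiv (Equiv.mulLeft h) _ _ fun g => ?_
  rw [Equiv.coe_mulLeft, map_mul, mul_inv, mul_smul, mul_smul, smul_inv_smul, smul_comm h]

theorem eigenProj_of_mem [Fintype G] [IsTameGroup R G] {χ : G →* Rˣ} {b : B}
    (hb : b ∈ eigen A χ) : eigenProj A B χ b = b := by
  have h : ∀ g : G, (χ g)⁻¹ • g • b = b := fun g => by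
    rw [hb g, ← Units.smul_def, inv_smul_smul]
  rw [eigenProj_apply, Finset.sum_congr rfl fun g _ => h g, Finset.sum_const, Finset.card_univ,
    inv_smul_eq_iff, Units.smul_def, IsUnit.unit_spec, Nat.card_eq_fintype_card, Nat.cast_smul_eq_nsmul]

/-- Orthogonality: translating by a character that is nontrivial at `g` multiplies the sum by a
factor other than one. -/
theorem sum_char_apply [Finite G] [IsDomain R] [IsTameGroup R G] [Fintype (G →* Rˣ)] {g : G}
    (hg : g ≠ 1) : ∑ χ : G →* Rˣ, ((χ g)⁻¹ : Rˣ).1 = 0 := by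
  obtain ⟨ψ, hψ⟩ := CommGroup.exists_apply_ne_one_of_hasEnoughRootsOfUnity G R hg
  have h : (((ψ g)⁻¹ : Rˣ) : R) * ∑ χ : G →* Rˣ, ((χ g)⁻¹ : Rˣ).1 =
      ∑ χ : G →* Rˣ, ((χ g)⁻¹ : Rˣ).1 := by
    rw [Finset.mul_sum]
    refine Fintype.sum_equiv (Equiv.mulLeft ψ) _ _ fun χ => ?_
    simp [mul_comm]
  by_contra hne
  rw [mul_eq_right₀ hne, Units.val_eq_one, inv_eq_one] at h
  exact hψ h

theorem sum_eigenProj [Fintype G] [IsDomain R] [IsTameGroup R G] [Fintype (G →* Rˣ)] (b : B) :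
    ∑ χ : G →* Rˣ, eigenProj A B χ b = b := by
  classical
  simp only [eigenProj_apply]
  rw [← Finset.smul_sum, inv_smul_eq_iff, Finset.sum_comm]
  simp only [Units.smul_def]
  rw [Finset.sum_congr rfl fun g _ => (Finset.sum_smul (f := fun χ : G →* Rˣ => ((χ g)⁻¹ : Rˣ).1)
    (s := Finset.univ) (x := g • b)).symm, Finset.sum_eq_single 1]
  · have := CommGroup.card_monoidHom_of_hasEnoughRootsOfUnity G R
    rw [Nat.card_eq_fintype_card] at this
    simp [this]
  · intro g _ hg
    rw [sum_char_apply hg, zero_smul]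
  · simp

section Regular

variable [Finite G] [IsDomain A] [IsRegularRing A] [IsRegularRing B] [Module.Finite A B]
  [FaithfulSMul A B] [Algebra.IsInvariant A B G]

theorem isReduced_of_isRegularRing (S : Type u) [CommRing S] [IsRegularRing S] : IsReduced S :=
  isReduced_ofLocalizationMaximal S fun _ _ => inferInstance

variable (A B G) in
include G in
theorem smul_eq_zero_of_isRegularRing {a : A} {b : B} (h : a • b = 0) : a = 0 ∨ b = 0 := by
  have := flat_of_isRegularRing A B G
  have := Module.Flat.isTorsionFree (R := A) (M := B)
  exact smul_eq_zero.1 h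

theorem pow_card_mem_range {χ : G →* Rˣ} {b : B} (hb : b ∈ eigen A χ) :
    ∃ a : A, algebraMap A B a = b ^ Nat.card G :=
  mem_eigen_one_iff.1 (char_pow_card χ ▸ pow_mem_eigen hb (Nat.card G))

/-- Its power of exponent `|G|` is an element of `A`, nonzero because `B` is reduced, and `B` is
torsion-free over `A`. -/
theorem eigen_mem_nonZeroDivisors {χ : G →* Rˣ} {b : B} (hb : b ∈ eigen A χ) (h0 : b ≠ 0) :
    b ∈ nonZeroDivisors B := by
  have := isReduced_of_isRegularRing B
  obtain ⟨a, ha⟩ := pow_card_mem_range hb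
  have ha0 : a ≠ 0 := by
    rintro rfl
    rw [map_zero] at ha
    exact h0 ((pow_eq_zero_iff Nat.card_pos.ne').1 ha.symm)
  rw [mem_nonZeroDivisors_iff_right]
  intro x hx
  refine (smul_eq_zero_of_isRegularRing A B G (a := a) ?_).resolve_left ha0
  obtain ⟨k, hk⟩ := Nat.exists_eq_succ_of_ne_zero (Nat.card_pos (α := G)).ne'
  rw [Algebra.smul_def, ha, hk, pow_succ, mul_assoc, mul_comm b, hx, mul_zero]

/-- The eigenspace is a direct summand of the flat module `B`, hence locally free, and its rank is
at most one because two eigenfunctions for the same character have an invariant ratio. Generation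
near `p` is stated without localizing, with the denominator `r` outside `p`. -/
theorem exists_generator_eigen [IsDomain R] [IsTameGroup R G] (χ : G →* Rˣ) (p : Ideal A)
    [p.IsPrime] : ∃ s ∈ eigen A χ (B := B), ∀ b ∈ eigen A χ (B := B), ∃ r : A, r ∉ p ∧
      ∃ c : A, r • b = c • s := by
  classical
  cases nonempty_fintype G
  have := isReduced_of_isRegularRing B
  have hflat := flat_of_isRegularRing A B G
  let M := eigen A χ (B := B)
  have hM : Module.Flat A M := Module.Flat.of_retract M.subtype
    ((eigenProj A B χ).codRestrict M (eigenProj_mem χ)) (by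
      ext b
      simp [eigenProj_of_mem b.2])
  let L := Localization.AtPrime p
  let ML := LocalizedModule p.primeCompl M
  have hfree : Module.Free L ML := Module.free_of_flat_of_isLocalRing (R := L) (P := ML)
  let ι := Module.Free.ChooseBasisIndex L ML
  let β : Module.Basis ι L ML := Module.Free.chooseBasis L ML
  let f : M →ₗ[A] ML := LocalizedModule.mkLinearMap p.primeCompl M
  have hsurj : ∀ x : ML, ∃ u : M, ∃ r : p.primeCompl, r • x = f u := fun x => by
    obtain ⟨⟨u, r⟩, h⟩ := IsLocalizedModule.surj p.primeCompl f x
    exact ⟨u, r, h⟩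
  have hsub : Subsingleton ι := by
    refine ⟨fun i j => ?_⟩
    by_contra hij
    obtain ⟨u, r, hu⟩ := hsurj (β i)
    obtain ⟨v, r', hv⟩ := hsurj (β j)
    obtain ⟨k, hk⟩ := Nat.exists_eq_succ_of_ne_zero (Nat.card_pos (α := G)).ne'
    obtain ⟨c, hc⟩ := pow_card_mem_range v.2
    -- With `k = |G| - 1`, the product of `v ^ k` and `u` has trivial character, as does `v ^ |G|`.
    -- These are the coefficients of a linear relation over `A` between `u` and `v`.
    obtain ⟨d, hd⟩ : v.1 ^ k * u.1 ∈ Set.range (algebraMap A B) := by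
      rw [← mem_eigen_one_iff (R := R) (G := G), ← char_pow_card χ, hk, Nat.succ_eq_add_one,
        pow_succ χ]
      exact mul_mem_eigen (pow_mem_eigen v.2 k) u.2
    have h1 : d • v = c • u := by
      apply Subtype.ext
      change d • v.1 = c • u.1
      rw [Algebra.smul_def, Algebra.smul_def, hc, hd, hk, pow_succ]
      ring
    have h2 := congrArg f h1
    rw [map_smul, map_smul, ← hu, ← hv] at h2
    have h3 := congrArg (fun x => β.repr x i) h2
    have hsm : ∀ (a : A) (r : p.primeCompl) (l : ι),
        a • r • β l = (algebraMap A L a * algebraMap A L r.1) • β l := fun a r l => by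
      rw [mul_smul, algebraMap_smul, algebraMap_smul]
      rfl
    simp only [hsm, map_smul, Finsupp.smul_apply, Module.Basis.repr_self] at h3
    rw [Finsupp.single_eq_of_ne hij, Finsupp.single_eq_same] at h3
    simp only [smul_eq_mul, mul_zero, mul_one] at h3
    rw [← map_mul] at h3
    have h4 : c * r.1 = 0 := (IsLocalization.injective L p.primeCompl_le_nonZeroDivisors)
      (h3.symm.trans (map_zero _).symm)
    have h5 : c = 0 := (mul_eq_zero.1 h4).resolve_right fun h => r.2 (h ▸ p.zero_mem)
    rw [h5, map_zero] at hc
    have h6 : v = 0 := Subtype.ext ((pow_eq_zero_iff Nat.card_pos.ne').1 hc.symm)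
    rw [h6, map_zero] at hv
    have h7 := congrArg (fun x => β.repr x j) hv
    have h8 : r' • β j = algebraMap A L r'.1 • β j := by
      rw [algebraMap_smul]
      rfl
    simp only [h8, map_smul, Finsupp.smul_apply, Module.Basis.repr_self, map_zero,
      Finsupp.single_eq_same, Finsupp.zero_apply, smul_eq_mul, mul_one] at h7
    have h9 : r'.1 = 0 := (IsLocalization.injective L p.primeCompl_le_nonZeroDivisors)
      (h7.trans (map_zero _).symm)
    exact r'.2 (h9 ▸ p.zero_mem)
  -- An empty basis is still possible here; the generator is then zero.
  obtain ⟨x, hx⟩ : ∃ x : ML, ∀ y : ML, ∃ l : L, y = l • x := by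
    rcases isEmpty_or_nonempty ι with h | ⟨⟨i⟩⟩
    · have : Subsingleton ML := β.repr.toEquiv.subsingleton
      exact ⟨0, fun y => ⟨0, Subsingleton.elim _ _⟩⟩
    · refine ⟨β i, fun y => ⟨β.repr y i, ?_⟩⟩
      have : Unique ι := ⟨⟨i⟩, fun j => Subsingleton.elim _ _⟩
      conv_lhs => rw [← β.sum_repr y]
      rw [Fintype.sum_subsingleton _ i]
  obtain ⟨s, r₀, hs⟩ := hsurj x
  refine ⟨s.1, s.2, fun b hb => ?_⟩
  obtain ⟨l, hl⟩ := hx (f ⟨b, hb⟩)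
  obtain ⟨⟨a, t⟩, ht⟩ := IsLocalization.surj p.primeCompl l
  have e : f ((r₀.1 * t.1) • ⟨b, hb⟩) = f (a • s) := by
    rw [map_smul, map_smul, hl, ← hs, mul_smul]
    have e1 : r₀ • x = algebraMap A L r₀.1 • x := by
      rw [algebraMap_smul]; rfl
    rw [e1, ← algebraMap_smul L t.1, ← algebraMap_smul L r₀.1, ← algebraMap_smul L a, smul_smul,
      smul_smul, smul_smul, ← ht]
    congr 1
    ring
  obtain ⟨c, hc⟩ := (IsLocalizedModule.eq_iff_exists p.primeCompl f).1 e
  refine ⟨c.1 * (r₀.1 * t.1), (c * (r₀ * t)).2, c.1 * a, ?_⟩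
  have := congrArg Subtype.val hc
  rw [mul_smul, mul_smul c.1]
  exact this

end Regular

end Eigen

end TameCover

namespace TameCover
open IsLocalRing Pointwise

set_option linter.unusedSectionVars false
set_option linter.overlappingInstances false

/-! ### Orders in discrete valuation rings -/

section HasOrd

/-- In a discrete valuation ring: the valuation of `s` is `k`. -/
def HasOrd {S : Type*} [CommRing S] [IsLocalRing S] (s : S) (k : ℕ) : Prop :=
  Ideal.span {s} = maximalIdeal S ^ k

variable {S : Type*} [CommRing S] [IsLocalRing S] {s t : S} {k l : ℕ}

theorem HasOrd.mul (hs : HasOrd s k) (ht : HasOrd t l) : HasOrd (s * t) (k + l) := by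
  rw [HasOrd, ← Ideal.span_singleton_mul_span_singleton, hs, ht, pow_add]

theorem HasOrd.pow (hs : HasOrd s k) (m : ℕ) : HasOrd (s ^ m) (k * m) := by
  rw [HasOrd, ← Ideal.span_singleton_pow, hs, pow_mul]

theorem hasOrd_zero_iff : HasOrd s 0 ↔ IsUnit s := by
  rw [HasOrd, pow_zero, Ideal.one_eq_top, Ideal.span_singleton_eq_top]

theorem HasOrd.of_associated (hs : HasOrd s k) (h : Associated s t) : HasOrd t k := by
  rw [HasOrd, ← hs]
  exact le_antisymm (Ideal.span_singleton_le_span_singleton.2 h.dvd)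
    (Ideal.span_singleton_le_span_singleton.2 h.symm.dvd)

theorem HasOrd.map {T : Type*} [CommRing T] [IsLocalRing T] (e : S ≃+* T) (hs : HasOrd s k) :
    HasOrd (e s) k := by
  have h1 : (maximalIdeal S).map (e : S →+* T) = maximalIdeal T := by
    rw [Ideal.map_coe, ← Ideal.comap_symm]
    exact IsLocalRing.eq_maximalIdeal (Ideal.comap_isMaximal_of_equiv (e.symm))
  have h2 := congrArg (Ideal.map (e : S →+* T)) hs
  rw [Ideal.map_span, Ideal.map_pow, h1, Set.image_singleton] at h2
  exact h2

variable [IsDomain S] [IsDiscreteValuationRing S]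

theorem HasOrd.unique (hs : HasOrd s k) (ht : HasOrd s l) : k = l :=
  (Ideal.pow_right_strictAnti (maximalIdeal S) (IsDiscreteValuationRing.not_a_field S)
    (maximalIdeal.isMaximal S).ne_top).injective (hs.symm.trans ht)

theorem exists_hasOrd (hs : s ≠ 0) : ∃ k, HasOrd s k :=
  exists_maximalIdeal_pow_eq_of_principal S (IsPrincipalIdealRing.principal _) _
    (by rwa [Ne, Ideal.span_singleton_eq_bot])

theorem HasOrd.ne_zero (hs : HasOrd s k) : s ≠ 0 := by
  rintro rfl
  rw [HasOrd, Ideal.span_singleton_zero] at hs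
  exact pow_ne_zero _ (IsDiscreteValuationRing.not_a_field S) hs.symm

theorem HasOrd.dvd_iff (hs : HasOrd s k) (ht : HasOrd t l) : s ∣ t ↔ k ≤ l := by
  rw [← Ideal.span_singleton_le_span_singleton, hs, ht]
  exact (Ideal.pow_right_strictAnti (maximalIdeal S) (IsDiscreteValuationRing.not_a_field S)
    (maximalIdeal.isMaximal S).ne_top).le_iff_ge

theorem HasOrd.mem_pow_iff (hs : HasOrd s k) : s ∈ maximalIdeal S ^ l ↔ l ≤ k := by
  rw [← Ideal.span_singleton_le_iff_mem, hs]
  exact (Ideal.pow_right_strictAnti (maximalIdeal S) (IsDiscreteValuationRing.not_a_field S)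
    (maximalIdeal.isMaximal S).ne_top).le_iff_ge

end HasOrd

/-! ### Tame automorphisms of local rings -/

/-- By the twisted Leibniz rule, an endomorphism trivial on the residue field and on the cotangent
space is trivial on every graded piece. -/
theorem sub_mem_pow_succ {S : Type*} [CommRing S] [IsLocalRing S] (σ : S →+* S)
    (h1 : ∀ x, σ x - x ∈ maximalIdeal S)
    (h2 : ∀ x ∈ maximalIdeal S, σ x - x ∈ maximalIdeal S ^ 2) (k : ℕ) :
    ∀ x ∈ maximalIdeal S ^ k, σ x - x ∈ maximalIdeal S ^ (k + 1) := by
  induction k with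
  | zero => exact fun x _ => by simpa using h1 x
  | succ k ih =>
    intro x hx
    rw [pow_succ] at hx
    have hσ : ∀ y ∈ maximalIdeal S, σ y ∈ maximalIdeal S := fun y hy => by
      have := add_mem (h1 y) hy
      rwa [sub_add_cancel] at this
    induction hx using Submodule.mul_induction_on' with
    | mem_mul_mem x hx y hy =>
      have e : σ (x * y) - x * y = (σ x - x) * σ y + x * (σ y - y) := by
        rw [map_mul]; ring
      rw [e]
      refine add_mem ?_ ?_
      · rw [pow_succ]
        exact Ideal.mul_mem_mul (ih x hx) (hσ y hy)
      · rw [show k + 1 + 1 = k + 2 from rfl, pow_add]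
        exact Ideal.mul_mem_mul hx (h2 y hy)
    | add x _ y _ hx hy =>
      rw [map_add, add_sub_add_comm]
      exact add_mem hx hy

/-- No nontrivial automorphism of invertible finite order is unipotent for the adic filtration: the
deviation `σ x - x` is pushed one power deeper at each step, and Krull's intersection theorem ends
the argument. -/
theorem eq_self_of_sub_mem_sq {S : Type*} [CommRing S] [IsLocalRing S] [IsNoetherianRing S]
    (σ : S →+* S) {N : ℕ} (hN : IsUnit (N : S)) (hσ : ∀ x, σ^[N] x = x)
    (h1 : ∀ x, σ x - x ∈ maximalIdeal S)
    (h2 : ∀ x ∈ maximalIdeal S, σ x - x ∈ maximalIdeal S ^ 2) (x : S) : σ x = x := by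
  have key := sub_mem_pow_succ σ h1 h2
  have h3 : ∀ k, ∀ x, σ x - x ∈ maximalIdeal S ^ k := by
    intro k
    induction k with
    | zero => exact fun x => by simp
    | succ k ih =>
      intro x
      -- Modulo the next power, the deviation of the `j`-th iterate is `j` times that of `σ`. At `j
      -- = N` it vanishes, and `N` can be cancelled.
      have h4 : ∀ j : ℕ, σ^[j] x - x - j * (σ x - x) ∈ maximalIdeal S ^ (k + 1) := by
        intro j
        induction j with
        | zero => simp
        | succ j ihj =>
          have h5 := key (k + 1) _ ihj
          have h6 := Ideal.pow_le_pow_right (Nat.le_succ (k + 1)) h5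
          have h7 := Ideal.mul_mem_left _ (j : S) (key k _ (ih x))
          have e : σ^[j + 1] x - x - (j + 1 : ℕ) * (σ x - x) =
              (σ (σ^[j] x - x - j * (σ x - x)) - (σ^[j] x - x - j * (σ x - x))) +
              (σ^[j] x - x - j * (σ x - x)) + j * (σ (σ x - x) - (σ x - x)) := by
            rw [Function.iterate_succ_apply']
            simp only [map_sub, map_mul, map_natCast]
            push_cast
            ring
          rw [e]
          exact add_mem (add_mem h6 ihj) h7
      have h8 := h4 N
      rw [hσ, sub_self, zero_sub, Ideal.neg_mem_iff] at h8
      exact (Ideal.unit_mul_mem_iff_mem _ hN).1 h8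
  have h9 : σ x - x ∈ (⨅ i, maximalIdeal S ^ i : Ideal S) := by
    rw [Ideal.mem_iInf]
    exact fun i => h3 i x
  rw [Ideal.iInf_pow_eq_bot_of_isLocalRing _ (maximalIdeal.isMaximal S).ne_top] at h9
  exact sub_eq_zero.1 h9

/-! ### Inertia groups of prime ideals -/

section Inertia

variable {R A B : Type u} [CommRing R] [IsDomain R] [CommRing A] [CommRing B]
  [Algebra R A] [Algebra R B] [Algebra A B] [IsScalarTower R A B]
  {G : Type v} [CommGroup G] [Finite G] [IsTameGroup R G]
  [MulSemiringAction G B] [SMulCommClass G A B] [SMulCommClass G R B]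

theorem smul_eq_of_mem_inertia {q : Ideal B} {g : G} (hg : g ∈ q.inertia G) : g • q = q := by
  have h : ∀ g ∈ q.inertia G, g • q ≤ q := fun g hg x hx => by
    rw [Ideal.mem_pointwise_smul_iff_inv_smul_mem] at hx
    have := add_mem (hg (g⁻¹ • x)) hx
    rwa [sub_add_cancel, smul_inv_smul] at this
  refine le_antisymm (h g hg) ?_
  rw [Ideal.subset_pointwise_smul_iff]
  exact h _ (inv_mem hg)

theorem smul_mem_iff_of_mem_inertia {q : Ideal B} {g : G} (hg : g ∈ q.inertia G) {b : B} :
    g • b ∈ q ↔ b ∈ q := by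
  conv_lhs => rw [← smul_eq_of_mem_inertia hg]
  exact Ideal.smul_mem_pointwise_smul_iff

variable (R) in
include R in
/-- An element of the inertia group of `q` that acts trivially modulo the square of the maximal
ideal of the local ring at `q` acts trivially on that local ring. -/
theorem exists_mul_smul_sub_eq_zero [IsNoetherianRing B] (q : Ideal B) [q.IsPrime] {g : G}
    (hg : g ∈ q.inertia G)
    (h : ∀ b ∈ q, algebraMap B (Localization.AtPrime q) (g • b - b) ∈
      maximalIdeal (Localization.AtPrime q) ^ 2) (b : B) :
    ∃ u ∉ q, u * (g • b - b) = 0 := by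
  let S := Localization.AtPrime q
  have hc : q = q.comap (MulSemiringAction.toRingHom G B g) := by
    ext x
    rw [Ideal.mem_comap, MulSemiringAction.toRingHom_apply, smul_mem_iff_of_mem_inertia hg]
  let σ : S →+* S := Localization.localRingHom q q (MulSemiringAction.toRingHom G B g) hc
  have hσ : ∀ b : B, σ (algebraMap B S b) = algebraMap B S (g • b) :=
    Localization.localRingHom_to_map q q (MulSemiringAction.toRingHom G B g) hc
  have hmem : ∀ b : B, algebraMap B S b ∈ maximalIdeal S ↔ b ∈ q :=
    fun b => IsLocalization.AtPrime.to_map_mem_maximal_iff S q b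
  have hunit : ∀ u ∉ q, IsUnit (algebraMap B S u) := fun u hu =>
    IsLocalization.map_units S (⟨u, hu⟩ : q.primeCompl)
  have hsurj : ∀ x : S, ∃ b : B, ∃ u ∉ q, algebraMap B S u * x = algebraMap B S b := fun x => by
    obtain ⟨⟨b, u⟩, e⟩ := IsLocalization.surj q.primeCompl x
    exact ⟨b, u.1, u.2, by rw [mul_comm]; exact e⟩
  -- The quotient rule for `x = b / u`, which reduces membership statements about fractions to
  -- statements about elements of `B`.
  have hformula : ∀ (x : S) (b u : B), algebraMap B S u * x = algebraMap B S b →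
      algebraMap B S (g • u) * (σ x - x) =
        algebraMap B S (g • b - b) - algebraMap B S (g • u - u) * x := by
    intro x b u e
    have e' := congrArg σ e
    rw [map_mul, hσ, hσ] at e'
    rw [map_sub, map_sub, ← e', ← e]
    ring
  have hgu : ∀ u ∉ q, IsUnit (algebraMap B S (g • u)) := fun u hu =>
    hunit _ (by rwa [smul_mem_iff_of_mem_inertia hg])
  have hN : IsUnit ((Nat.card G : ℕ) : S) := by
    have := (IsTameGroup.isUnit_card : IsUnit (Nat.card G : R)).map (algebraMap R B)
    have := this.map (algebraMap B S)
    simpa using this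
  have := eq_self_of_sub_mem_sq σ hN (fun x => ?_) (fun x => ?_) (fun x hx => ?_)
    (algebraMap B S b)
  · rw [hσ] at this
    obtain ⟨u, hu⟩ := (IsLocalization.eq_iff_exists q.primeCompl S).1 this
    exact ⟨u.1, u.2, by rw [mul_sub, hu, sub_self]⟩
  · have hit : ∀ (k : ℕ) (b : B), σ^[k] (algebraMap B S b) = algebraMap B S (g ^ k • b) := by
      intro k b
      induction k with
      | zero => simp
      | succ k ih => rw [Function.iterate_succ_apply', ih, hσ, pow_succ', mul_smul]
    obtain ⟨b, u, hu, e⟩ := hsurj x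
    have e' := congrArg (σ^[Nat.card G]) e
    rw [iterate_map_mul, hit, hit, pow_card_eq_one', one_smul, one_smul, ← e] at e'
    exact (hunit u hu).mul_left_cancel e'
  · obtain ⟨b, u, hu, e⟩ := hsurj x
    rw [← Ideal.unit_mul_mem_iff_mem _ (hgu u hu), hformula x b u e]
    exact sub_mem ((hmem _).2 (hg b)) (Ideal.mul_mem_right _ _ ((hmem _).2 (hg u)))
  · obtain ⟨b, u, hu, e⟩ := hsurj x
    have hb : b ∈ q := (hmem b).1 (e ▸ Ideal.mul_mem_left _ _ hx)
    rw [← Ideal.unit_mul_mem_iff_mem _ (hgu u hu), hformula x b u e, pow_two]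
    rw [pow_two] at h
    exact sub_mem (h b hb) (Ideal.mul_mem_mul ((hmem _).2 (hg u)) hx)

/-- The action of `G` on `B` is generically free. -/
def GenericallyFree (B : Type u) [CommRing B] (G : Type v) [CommGroup G]
    [MulSemiringAction G B] : Prop :=
  ∀ η ∈ minimalPrimes B, η.inertia G = ⊥

variable (R) in
include R in
-- Triviality on the local ring at `q` passes to every minimal prime below `q`, because the
-- denominators avoid `q`. There the action is free.
theorem eq_one_of_mem_inertia [IsNoetherianRing B] (hfree : GenericallyFree B G) (q : Ideal B)
    [q.IsPrime] {g : G} (hg : g ∈ q.inertia G)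
    (h : ∀ b ∈ q, algebraMap B (Localization.AtPrime q) (g • b - b) ∈
      maximalIdeal (Localization.AtPrime q) ^ 2) : g = 1 := by
  obtain ⟨η, hη, hle⟩ := Ideal.exists_minimalPrimes_le (I := (⊥ : Ideal B)) (J := q) bot_le
  rw [← Subgroup.mem_bot, ← hfree η hη]
  intro b
  obtain ⟨u, hu, e⟩ := exists_mul_smul_sub_eq_zero R q hg h b
  have : η.IsPrime := hη.1.1
  exact (this.mem_or_mem (e ▸ η.zero_mem : u * (g • b - b) ∈ η)).resolve_left
    fun h => hu (hle h)

/-- If the whole eigenspace lay in `q`, the projection formula would be a linear relation between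
the multiplicative maps `b ↦ g • b` modulo `q`. Dedekind independence applies once equal maps are
grouped: the class of the identity is the inertia group, and its coefficient is the order of that
group, a unit. -/
theorem exists_eigen_notMem (χ : G →* Rˣ) (q : Ideal B) [q.IsPrime]
    (hχ : ∀ g ∈ q.inertia G, χ g = 1) : ∃ v ∈ eigen A χ (B := B), v ∉ q := by
  classical
  cases nonempty_fintype G
  by_contra! hcon
  let F : G → (B →* B ⧸ q) := fun g =>
    ((Ideal.Quotient.mk q).comp (MulSemiringAction.toRingHom G B g)).toMonoidHom
  have hF : ∀ g b, F g b = Ideal.Quotient.mk q (g • b) := fun _ _ => rfl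
  have hlin := linearIndependent_iff'.1 (linearIndependent_monoidHom B (B ⧸ q))
    (Finset.univ.image F)
    (fun f => ∑ g with F g = f, algebraMap R (B ⧸ q) ((χ g)⁻¹ : Rˣ)) (by
      funext b
      have h1 := hcon _ (eigenProj_mem (A := A) χ b)
      rw [eigenProj_apply, Units.smul_def, Algebra.smul_def,
        Ideal.unit_mul_mem_iff_mem _ ((Units.isUnit _).map _)] at h1
      rw [Finset.sum_apply]
      rw [← Ideal.Quotient.eq_zero_iff_mem, map_sum] at h1
      refine Eq.trans ?_ h1
      rw [← Finset.sum_fiberwise_of_maps_to (s := Finset.univ) (t := Finset.univ.image F) (g := F)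
        (fun g _ => Finset.mem_image_of_mem F (Finset.mem_univ g))]
      refine Finset.sum_congr rfl fun f _ => ?_
      rw [Pi.smul_apply, smul_eq_mul, Finset.sum_mul]
      refine Finset.sum_congr rfl fun g hg => ?_
      rw [← (Finset.mem_filter.1 hg).2, hF, Units.smul_def, Algebra.smul_def, map_mul]
      rfl)
    (F 1) (Finset.mem_image_of_mem F (Finset.mem_univ 1))
  have hfib : ∀ g, F g = F 1 ↔ g ∈ q.inertia G := by
    intro g
    rw [DFunLike.ext_iff]
    refine forall_congr' fun b => ?_
    rw [hF, hF, one_smul, Ideal.Quotient.eq]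
    rfl
  rw [Finset.sum_congr rfl (g := fun _ => (1 : B ⧸ q)) (fun g hg => by
    rw [hχ g ((hfib g).1 (Finset.mem_filter.1 hg).2)]; simp), Finset.sum_const] at hlin
  have hcard : (Finset.univ.filter fun g => F g = F 1).card = Nat.card (q.inertia G) := by
    rw [Nat.card_eq_fintype_card, Fintype.card_subtype]
    congr 1
    ext g
    simp [hfib g]
  rw [hcard, nsmul_one] at hlin
  have hunit : IsUnit ((Nat.card (q.inertia G) : ℕ) : B ⧸ q) := by
    have h1 := (IsTameGroup.isUnit_card : IsUnit (Nat.card G : R)).map (algebraMap R (B ⧸ q))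
    rw [map_natCast] at h1
    exact isUnit_of_dvd_unit (Nat.cast_dvd_cast (Subgroup.card_subgroup_dvd_card _)) h1
  exact hunit.ne_zero hlin

end Inertia

end TameCover

namespace TameCover
open IsLocalRing Pointwise

set_option linter.unusedSectionVars false
set_option linter.overlappingInstances false

/-! ### Orders at prime ideals of height one -/

section HasOrdAt

/-- The order of `b` at the prime ideal `P` is `k`. -/
def HasOrdAt {B : Type u} [CommRing B] (P : Ideal B) [P.IsPrime] (b : B) (k : ℕ) : Prop :=
  HasOrd (algebraMap B (Localization.AtPrime P) b) k

theorem hasOrd_algebraMap_iff {B : Type u} [CommRing B] (P : Ideal B) [P.IsPrime] (S : Type*)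
    [CommRing S] [IsLocalRing S] [Algebra B S] [IsLocalization.AtPrime S P] {b : B} {k : ℕ} :
    HasOrd (algebraMap B S b) k ↔ HasOrdAt P b k := by
  let e := IsLocalization.algEquiv P.primeCompl S (Localization.AtPrime P)
  constructor
  · intro h
    have := h.map e.toRingEquiv
    simpa [HasOrdAt, e] using this
  · intro h
    have := HasOrd.map e.symm.toRingEquiv h
    simpa [HasOrdAt, e] using this

theorem isDiscreteValuationRing_localization {B : Type u} [CommRing B] [IsRegularRing B]
    (P : Ideal B) [P.IsPrime] (hP : P.height = 1) :
    IsDiscreteValuationRing (Localization.AtPrime P) :=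
  isDiscreteValuationRing_of_dim_one (by
    rw [IsLocalization.AtPrime.ringKrullDim_eq_height P, hP]
    rfl)

variable {B : Type u} [CommRing B] {P : Ideal B} [P.IsPrime] {b c : B} {k l : ℕ}

theorem hasOrdAt_zero_iff : HasOrdAt P b 0 ↔ b ∉ P := by
  rw [HasOrdAt, hasOrd_zero_iff, IsLocalization.AtPrime.isUnit_to_map_iff _ P]
  rfl

theorem HasOrdAt.mul (hb : HasOrdAt P b k) (hc : HasOrdAt P c l) : HasOrdAt P (b * c) (k + l) := by
  rw [HasOrdAt, map_mul]
  exact HasOrd.mul hb hc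

theorem HasOrdAt.pow (hb : HasOrdAt P b k) (m : ℕ) : HasOrdAt P (b ^ m) (k * m) := by
  rw [HasOrdAt, map_pow]
  exact HasOrd.pow hb m

theorem HasOrdAt.mul_notMem (hb : HasOrdAt P b k) (hc : c ∉ P) : HasOrdAt P (c * b) k := by
  have := (hasOrdAt_zero_iff.2 hc).mul hb
  rwa [zero_add] at this

theorem HasOrdAt.units_smul {R : Type*} [CommRing R] [Algebra R B] (hb : HasOrdAt P b k) (r : Rˣ) :
    HasOrdAt P ((r : R) • b) k := by
  rw [Algebra.smul_def]
  refine hb.mul_notMem fun h => Ideal.IsPrime.ne_top' (Ideal.eq_top_of_isUnit_mem P h ?_)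
  exact r.isUnit.map _

theorem HasOrdAt.smul {G : Type v} [Group G] [MulSemiringAction G B] (hb : HasOrdAt P b k) (g : G) :
    letI : (g • P).IsPrime := Ideal.IsPrime.smul g
    HasOrdAt (g • P) (g • b) k := by
  let _ : (g • P).IsPrime := Ideal.IsPrime.smul g
  let e : B ≃+* B := MulSemiringAction.toRingEquiv G B g
  have H : P.primeCompl.map e.toMonoidHom = (g • P).primeCompl := by
    ext x
    constructor
    · rintro ⟨y, hy, rfl⟩ h
      exact hy (Ideal.smul_mem_pointwise_smul_iff.1 h)
    · intro hx
      exact ⟨g⁻¹ • x, fun h => hx (Ideal.mem_pointwise_smul_iff_inv_smul_mem.2 h),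
        smul_inv_smul g x⟩
  have := HasOrd.map (IsLocalization.ringEquivOfRingEquiv (Localization.AtPrime P)
    (Localization.AtPrime (g • P)) e H) hb
  rwa [IsLocalization.ringEquivOfRingEquiv_eq] at this

theorem exists_mul_eq_mul_of_dvd {S : Type*} [CommRing S] [Algebra B S]
    [IsLocalization.AtPrime S P] (h : algebraMap B S b ∣ algebraMap B S c) :
    ∃ u ∉ P, ∃ d, u * c = d * b := by
  obtain ⟨x, hx⟩ := h
  obtain ⟨⟨d, u⟩, e⟩ := IsLocalization.surj P.primeCompl x
  have e2 : algebraMap B S (u.1 * c) = algebraMap B S (d * b) := by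
    rw [map_mul, map_mul, hx, ← e]
    ring
  obtain ⟨w, hw⟩ := (IsLocalization.eq_iff_exists P.primeCompl S).1 e2
  exact ⟨w.1 * u.1, (w * u).2, w.1 * d, by rw [mul_assoc, hw, mul_assoc]⟩

section

variable [IsRegularRing B]

theorem HasOrdAt.unique (hP : P.height = 1) (hb : HasOrdAt P b k) (hc : HasOrdAt P b l) :
    k = l := by
  have := isDiscreteValuationRing_localization P hP
  exact HasOrd.unique hb hc

theorem exists_hasOrdAt (hP : P.height = 1) (hb : b ∈ nonZeroDivisors B) :
    ∃ k, HasOrdAt P b k := by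
  have := isDiscreteValuationRing_localization P hP
  refine exists_hasOrd fun h => ?_
  obtain ⟨u, hu⟩ := (IsLocalization.map_eq_zero_iff P.primeCompl _ _).1 h
  have := (mem_nonZeroDivisors_iff_right.1 hb) _ hu
  exact u.2 (this ▸ P.zero_mem)

theorem HasOrdAt.notMem_of_mul (hP : P.height = 1) (hb : HasOrdAt P b k) (h : c * b = 0) :
    c ∈ P := by
  have := isDiscreteValuationRing_localization P hP
  have h1 := congrArg (algebraMap B (Localization.AtPrime P)) h
  rw [map_mul, map_zero] at h1
  have h2 := (mul_eq_zero.1 h1).resolve_right (HasOrd.ne_zero hb)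
  by_contra hc
  exact (IsLocalization.map_units (Localization.AtPrime P) (⟨c, hc⟩ : P.primeCompl)).ne_zero h2

theorem HasOrdAt.exists_mul_eq (hP : P.height = 1) (hb : HasOrdAt P b k) (hc : HasOrdAt P c l)
    (hkl : k ≤ l) : ∃ u ∉ P, ∃ d, u * c = d * b := by
  have := isDiscreteValuationRing_localization P hP
  exact exists_mul_eq_mul_of_dvd ((HasOrd.dvd_iff hb hc).2 hkl)

theorem exists_hasOrdAt_one (hP : P.height = 1) : ∃ b, HasOrdAt P b 1 := by
  have := isDiscreteValuationRing_localization P hP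
  obtain ⟨x, hx⟩ := (IsPrincipalIdealRing.principal (maximalIdeal (Localization.AtPrime P))).1
  obtain ⟨⟨b, u⟩, e⟩ := IsLocalization.surj P.primeCompl x
  refine ⟨b, HasOrd.of_associated (s := x) ?_ ⟨(IsLocalization.map_units _ u).unit, e⟩⟩
  rw [HasOrd, pow_one]
  exact hx.symm

theorem eq_of_le_of_height_one {P' : Ideal B} [P'.IsPrime] (hP : P.height = 1)
    (hP' : P'.height = 1) (h : P ≤ P') : P = P' := by
  by_contra hne
  have := Ideal.height_add_one_le_of_lt_of_isPrime (lt_of_le_of_ne h hne)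
  rw [hP, hP'] at this
  norm_num at this

/-- Each such prime is minimal over `(b)`, and a Noetherian ring has finitely many minimal primes
over an ideal. -/
theorem finite_setOf_height_one_mem (hb : b ∈ nonZeroDivisors B) :
    {P : Ideal B | P.IsPrime ∧ P.height = 1 ∧ b ∈ P}.Finite := by
  refine (Ideal.finite_minimalPrimes_of_isNoetherianRing B (Ideal.span {b})).subset ?_
  rintro P ⟨hPp, hP, hb'⟩
  have : P.FiniteHeight := by
    infer_instance
  refine Ideal.mem_minimalPrimes_of_height_le (by simpa using hb') ?_
  rw [hP]
  exact Ideal.one_le_height_span_singleton_of_mem_nonZeroDivisors hb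

end

end HasOrdAt

end TameCover

namespace TameCover
open IsLocalRing Pointwise

set_option linter.unusedSectionVars false
set_option linter.overlappingInstances false

/-! ### Ramification in codimension one -/

section Ramification

variable {R A B : Type u} [CommRing R] [IsDomain R] [CommRing A] [CommRing B]
  [Algebra R A] [Algebra R B] [Algebra A B] [IsScalarTower R A B]
  {G : Type v} [CommGroup G] [Finite G] [IsTameGroup R G]
  [MulSemiringAction G B] [SMulCommClass G A B] [SMulCommClass G R B]

theorem algebraMap_units_mul_mem_iff (P : Ideal B) (r : Rˣ) {b : B} :
    algebraMap R B r * b ∈ P ↔ b ∈ P :=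
  Ideal.unit_mul_mem_iff_mem _ (r.isUnit.map _)

theorem char_eq_of_mul_mem {P : Ideal B} [P.IsPrime] {χ ψ : G →* Rˣ} {g : G} {k : ℕ} {b : B}
    (hb : b ∉ P) (h : (algebraMap R B (χ g) - algebraMap R B (ψ g ^ k : Rˣ)) * b ∈ P) :
    χ g = ψ g ^ k := by
  refine units_eq_of_sub_mem (algebraMap R B) (IsTameGroup.isUnit_card (R := R) (G := G))
    (char_apply_pow_card χ g) ?_ (Ideal.IsPrime.ne_top' (I := P))
    (((Ideal.IsPrime.mem_or_mem' h)).resolve_right hb)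
  rw [← pow_mul, mul_comm, pow_mul, char_apply_pow_card, one_pow]

theorem char_eq_one_of_notMem {P : Ideal B} [P.IsPrime] {χ : G →* Rˣ} {b : B}
    (hb : b ∈ eigen A χ) (hbP : b ∉ P) {g : G} (hg : g ∈ P.inertia G) : χ g = 1 := by
  have := char_eq_of_mul_mem (P := P) (χ := χ) (ψ := χ) (g := g) (k := 0) hbP (by
    have h := hg b
    rw [hb g, Algebra.smul_def] at h
    simpa [sub_mul] using h)
  simpa using this

theorem mem_of_char_ne_one {P : Ideal B} [P.IsPrime] {χ : G →* Rˣ} {b : B}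
    (hb : b ∈ eigen A χ) {g : G} (hg : g ∈ P.inertia G) (h : χ g ≠ 1) : b ∈ P :=
  by_contra fun hbP => h (char_eq_one_of_notMem hb hbP hg)

/-- Locally at `P`, the quotient of `b` by `t ^ k` is a unit, and inertia acts trivially on its
residue. Hence `b` and `t ^ k` have the same character on the inertia group: the order of an
eigenfunction is determined modulo the order of the inertia group. -/
theorem char_eq_pow_of_hasOrdAt [IsRegularRing B] {P : Ideal B} [P.IsPrime] (hP : P.height = 1)
    {χ φ : G →* Rˣ} {t b : B} (ht : t ∈ eigen A χ) (hb : b ∈ eigen A φ) (ht1 : HasOrdAt P t 1)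
    {k : ℕ} (hbk : HasOrdAt P b k) {g : G} (hg : g ∈ P.inertia G) : φ g = χ g ^ k := by
  have htk : HasOrdAt P (t ^ k) k := by simpa using ht1.pow k
  obtain ⟨u, hu, d, hud⟩ := htk.exists_mul_eq hP hbk le_rfl
  obtain ⟨u', hu', d', hud'⟩ := hbk.exists_mul_eq hP htk le_rfl
  have hd : d ∉ P := by
    intro hd
    have h1 : (u * u' - d * d') * b = 0 := by
      linear_combination u' * hud + d * hud'
    have h2 := hbk.notMem_of_mul hP h1
    have h3 := add_mem h2 (Ideal.mul_mem_right d' _ hd)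
    rw [sub_add_cancel] at h3
    exact (Ideal.IsPrime.mem_or_mem' h3).elim hu hu'
  have hgt : g • t ^ k = algebraMap R B (χ g ^ k : Rˣ) * t ^ k := by
    rw [smul_pow', ht g, Algebra.smul_def, mul_pow, Units.val_pow_eq_pow_val, map_pow]
  have e1 := congrArg (g • ·) hud
  simp only [smul_mul'] at e1
  rw [hb g, hgt, Algebra.smul_def] at e1
  have e2 : (algebraMap R B (φ g) * (g • u) * d - algebraMap R B (χ g ^ k : Rˣ) * u * (g • d)) *
      t ^ k = 0 := by
    linear_combination u * e1 - algebraMap R B (φ g) * (g • u) * hud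
  have e3 := htk.notMem_of_mul hP e2
  refine char_eq_of_mul_mem (P := P) (b := u * d)
    (fun h => (Ideal.IsPrime.mem_or_mem' h).elim hu hd) ?_
  have e4 : (algebraMap R B (φ g) - algebraMap R B (χ g ^ k : Rˣ)) * (u * d) =
      (algebraMap R B (φ g) * (g • u) * d - algebraMap R B (χ g ^ k : Rˣ) * u * (g • d)) -
      (g • u - u) * (algebraMap R B (φ g) * d) +
      (g • d - d) * (algebraMap R B (χ g ^ k : Rˣ) * u) := by ring
  rw [e4]
  exact add_mem (sub_mem e3 (Ideal.mul_mem_right _ _ (hg u))) (Ideal.mul_mem_right _ _ (hg d))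

variable (R) in
include R in
-- Every element of `P` is locally a multiple of the uniformizer `t`. If `g` fixes `t`, only the
-- cofactor moves, and it moves within the maximal ideal; so `g` is trivial modulo the square of
-- that ideal.
theorem eq_one_of_smul_eq_self [IsRegularRing B] (hfree : GenericallyFree B G)
    {P : Ideal B} [P.IsPrime] {t : B} (ht1 : HasOrdAt P t 1) {g : G} (hg : g ∈ P.inertia G)
    (h : g • t = t) : g = 1 := by
  let S := Localization.AtPrime P
  refine eq_one_of_mem_inertia R hfree P hg fun b hb => ?_
  have hmem : ∀ b : B, algebraMap B S b ∈ maximalIdeal S ↔ b ∈ P :=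
    fun b => IsLocalization.AtPrime.to_map_mem_maximal_iff S P b
  have hunit : ∀ u ∉ P, IsUnit (algebraMap B S u) := fun u hu =>
    IsLocalization.map_units S (⟨u, hu⟩ : P.primeCompl)
  have ht1' : Ideal.span {algebraMap B S t} = maximalIdeal S := by
    have : Ideal.span {algebraMap B S t} = maximalIdeal S ^ 1 := ht1
    rwa [pow_one] at this
  have hdvd : algebraMap B S t ∣ algebraMap B S b := by
    rw [← Ideal.mem_span_singleton, ht1', hmem]
    exact hb
  obtain ⟨u, hu, x, hux⟩ := exists_mul_eq_mul_of_dvd (P := P) hdvd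
  have e1 := congrArg (g • ·) hux
  simp only [smul_mul', h] at e1
  have e2 : (u * (g • u)) * (g • b - b) = t * (u * (g • x - x) - (g • u - u) * x) := by
    linear_combination u * e1 - (g • u) * hux
  have hgu : g • u ∉ P := by rwa [smul_mem_iff_of_mem_inertia hg]
  rw [← Ideal.unit_mul_mem_iff_mem _ (hunit (u * (g • u))
    (fun h => (Ideal.IsPrime.mem_or_mem' h).elim hu hgu)), ← map_mul, e2, map_mul, pow_two]
  refine Ideal.mul_mem_mul (ht1'.le (Ideal.mem_span_singleton_self _)) ((hmem _).2 ?_)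
  exact sub_mem (Ideal.mul_mem_left _ _ (hg x)) (Ideal.mul_mem_right _ _ (hg u))

/-- The character of a uniformizer is faithful on the inertia group and embeds it in the units of a
domain. The group is therefore cyclic, with exponent equal to its order. -/
theorem card_inertia_dvd_iff [IsRegularRing B] (hfree : GenericallyFree B G)
    {P : Ideal B} [P.IsPrime] {χ : G →* Rˣ} {t : B} (ht : t ∈ eigen A χ) (ht1 : HasOrdAt P t 1)
    (k : ℕ) : Nat.card (P.inertia G) ∣ k ↔ ∀ g ∈ P.inertia G, χ g ^ k = 1 := by
  have hinj : ∀ g ∈ P.inertia G, χ g = 1 → g = 1 := fun g hg h =>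
    eq_one_of_smul_eq_self R hfree ht1 hg (by rw [ht g, h]; simp)
  have hcyc : IsCyclic (P.inertia G) := isCyclic_of_injective_ringHom
    ((Units.coeHom R).comp (χ.comp (P.inertia G).subtype)) (by
      intro a b hab
      have h1 : χ a.1 = χ b.1 := Units.ext hab
      refine Subtype.ext (inv_mul_eq_one.1 (hinj _ (mul_mem (inv_mem a.2) b.2) ?_))
      rw [map_mul, map_inv, h1, inv_mul_cancel])
  constructor
  · rintro ⟨l, rfl⟩ g hg
    have : (⟨g, hg⟩ : P.inertia G) ^ Nat.card (P.inertia G) = 1 := pow_card_eq_one'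
    rw [pow_mul, ← map_pow, show g ^ Nat.card (P.inertia G) = 1 from congrArg Subtype.val this,
      map_one, one_pow]
  · intro h
    rw [← IsCyclic.exponent_eq_card]
    refine Monoid.exponent_dvd_of_forall_pow_eq_one fun g => Subtype.ext ?_
    exact hinj _ (pow_mem g.2 k) (by rw [Subgroup.coe_pow, map_pow, h _ g.2])

section Cover

variable [IsDomain A] [IsRegularRing A] [IsRegularRing B] [Module.Finite A B]
  [FaithfulSMul A B] [Algebra.IsInvariant A B G]

variable (R A) in
include R in
theorem exists_eigen_generating (hfree : GenericallyFree B G) {P q : Ideal B} [P.IsPrime]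
    [q.IsPrime] (hP : P.height = 1) (hPq : P ≤ q) {g : G} (hg : g ∈ P.inertia G) (h1 : g ≠ 1) :
    ∃ χ : G →* Rˣ, ∃ t ∈ eigen A χ (B := B), t ∈ P ∧ ∀ b ∈ P, ∃ u ∉ q, ∃ c, u * b = c * t := by
  classical
  cases nonempty_fintype G
  have : Fintype (G →* Rˣ) := Fintype.ofFinite _
  let S := Localization.AtPrime q
  have hmem : ∀ b : B, algebraMap B S b ∈ maximalIdeal S ↔ b ∈ q :=
    fun b => IsLocalization.AtPrime.to_map_mem_maximal_iff S q b
  choose s hs hgen using fun χ : G →* Rˣ =>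
    exists_generator_eigen (A := A) (B := B) χ (q.under A)
  -- Write `b` as the sum of its eigencomponents: only characters nontrivial at `g` contribute to `g
  -- • b - b`. If all their generators lay in the square of the maximal ideal at `q`, the element
  -- `g`, which is also inertial at `q`, would be trivial.
  obtain ⟨χ, hχg, hχ⟩ : ∃ χ : G →* Rˣ, χ g ≠ 1 ∧ algebraMap B S (s χ) ∉ maximalIdeal S ^ 2 := by
    by_contra! hcon
    refine h1 (eq_one_of_mem_inertia R hfree q (fun b => hPq (hg b)) fun b _ => ?_)
    rw [← sum_eigenProj (R := R) (A := A) (G := G) b, Finset.smul_sum, ← Finset.sum_sub_distrib,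
      map_sum]
    refine Ideal.sum_mem _ fun χ _ => ?_
    by_cases hχ : χ g = 1
    · rw [eigenProj_mem χ b g, hχ]
      simp
    · rw [eigenProj_mem χ b g, Algebra.smul_def, ← sub_one_mul, map_mul]
      refine Ideal.mul_mem_left _ _ ?_
      obtain ⟨r, hr, c, hrc⟩ := hgen χ _ (eigenProj_mem (A := A) χ b)
      rw [Algebra.smul_def, Algebra.smul_def] at hrc
      rw [← Ideal.unit_mul_mem_iff_mem _
        (IsLocalization.map_units S (⟨algebraMap A B r, hr⟩ : q.primeCompl)), ← map_mul, hrc,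
        map_mul]
      exact Ideal.mul_mem_left _ _ (hcon χ hχ)
  have htP : s χ ∈ P := mem_of_char_ne_one (hs χ) hg hχg
  refine ⟨χ, s χ, hs χ, htP, ?_⟩
  -- A regular parameter of the regular local ring at `q` generates a prime. Its contraction lies in
  -- `P` and has positive height, so it equals `P`.
  have hprime : (Ideal.span {algebraMap B S (s χ)}).IsPrime :=
    isPrime_span_singleton ((hmem _).2 (hPq htP)) hχ
  have hmem0 : ∀ b : B, algebraMap B S b ∈ Ideal.span {algebraMap B S (s χ)} →
      ∃ u ∉ q, ∃ c, u * b = c * s χ := fun b hb =>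
    exists_mul_eq_mul_of_dvd (P := q) (Ideal.mem_span_singleton.1 hb)
  let P₀ := (Ideal.span {algebraMap B S (s χ)}).comap (algebraMap B S)
  have hP₀ : P₀.IsPrime := Ideal.comap_isPrime _ _
  have hle : P₀ ≤ P := by
    intro b hb
    obtain ⟨u, hu, c, huc⟩ := hmem0 b hb
    exact (Ideal.IsPrime.mem_or_mem' (huc ▸ Ideal.mul_mem_left _ _ htP : u * b ∈ P)).resolve_left
      fun h => hu (hPq h)
  have hs0 : s χ ≠ 0 := fun h => hχ (by rw [h, map_zero]; exact Ideal.zero_mem _)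
  have hht := (Ideal.one_le_height_span_singleton_of_mem_nonZeroDivisors
    (eigen_mem_nonZeroDivisors (hs χ) hs0)).trans (Ideal.height_mono (J := P₀) (by
      rw [Ideal.span_le, Set.singleton_subset_iff]
      exact Ideal.mem_span_singleton_self _))
  have heq : P₀ = P := by
    by_contra hne
    have h2 := Ideal.height_add_one_le_of_lt_of_isPrime (lt_of_le_of_ne hle hne)
    rw [hP] at h2
    have h3 := (add_le_add_left hht 1).trans h2
    norm_num at h3
  intro b hb
  rw [← heq] at hb
  exact hmem0 b hb

variable (A G) in
include G in
theorem exists_le_under_eq (P : Ideal B) [P.IsPrime] (p : Ideal A) [p.IsPrime]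
    (h : P.under A ≤ p) : ∃ q : Ideal B, q.IsPrime ∧ P ≤ q ∧ q.under A = p := by
  have := Algebra.IsInvariant.isIntegral A B G
  obtain ⟨q, hPq, hq, hqp⟩ := Ideal.exists_ideal_over_prime_of_isIntegral p P h
  exact ⟨q, hq, hPq, hqp⟩

theorem eigen_smul_mem_iff {χ : G →* Rˣ} {t : B} (ht : t ∈ eigen A χ) (P : Ideal B) (g : G) :
    g • t ∈ P ↔ t ∈ P := by
  rw [ht g, Algebra.smul_def, algebraMap_units_mul_mem_iff]

theorem eigen_mem_smul_iff {χ : G →* Rˣ} {t : B} (ht : t ∈ eigen A χ) (P : Ideal B) (g : G) :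
    t ∈ g • P ↔ t ∈ P := by
  rw [Ideal.mem_pointwise_smul_iff_inv_smul_mem, eigen_smul_mem_iff ht]

theorem HasOrdAt.smul_eigen {χ : G →* Rˣ} {t : B} (ht : t ∈ eigen A χ) {P : Ideal B} [P.IsPrime]
    {k : ℕ} (h : HasOrdAt P t k) (g : G) :
    letI : (g • P).IsPrime := Ideal.IsPrime.smul g
    HasOrdAt (g • P) t k := by
  let _ : (g • P).IsPrime := Ideal.IsPrime.smul g
  have h2 := (h.smul g).units_smul (χ g)⁻¹
  rwa [ht g, ← Units.smul_def, ← Units.smul_def, inv_smul_smul] at h2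

theorem height_smul (P : Ideal B) (g : G) : (g • P).height = P.height := by
  rw [Ideal.pointwise_smul_eq_comap]
  exact RingEquiv.height_comap _ P

variable (R) in
include R in
/-- Near a prime `p`, a ramified prime divisor and its conjugates are the zeros of an
eigenfunction. -/
theorem exists_eigen_hasOrdAt_one (hfree : GenericallyFree B G) (p : Ideal A) [p.IsPrime]
    {P : Ideal B} [P.IsPrime] (hP : P.height = 1) (hPp : P.under A ≤ p) (hram : P.inertia G ≠ ⊥) :
    ∃ χ : G →* Rˣ, ∃ t ∈ eigen A χ (B := B), HasOrdAt P t 1 ∧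
      ∀ (P' : Ideal B) [P'.IsPrime], P'.height = 1 → P'.under A ≤ p → t ∈ P' →
        P'.under A = P.under A := by
  obtain ⟨g, hg, hg1⟩ := (Subgroup.bot_or_exists_ne_one (P.inertia G)).resolve_left hram
  obtain ⟨q, hq, hPq, hqp⟩ := exists_le_under_eq A G P p hPp
  obtain ⟨χ, t, ht, htP, hgen⟩ := exists_eigen_generating R A hfree hP hPq hg hg1
  refine ⟨χ, t, ht, ?_, ?_⟩
  · rw [HasOrdAt, HasOrd, pow_one]
    refine le_antisymm ?_ ?_
    · rw [Ideal.span_singleton_le_iff_mem,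
        IsLocalization.AtPrime.to_map_mem_maximal_iff (Localization.AtPrime P) P]
      exact htP
    · rw [← Localization.AtPrime.map_eq_maximalIdeal, Ideal.map_le_iff_le_comap]
      intro b hb
      obtain ⟨u, hu, c, huc⟩ := hgen b hb
      rw [Ideal.mem_comap, ← Ideal.unit_mul_mem_iff_mem _ (IsLocalization.map_units
        (Localization.AtPrime P) (⟨u, fun h => hu (hPq h)⟩ : P.primeCompl)), ← map_mul, huc, map_mul]
      exact Ideal.mul_mem_left _ _ (Ideal.mem_span_singleton_self _)
  · intro P' _ hP' hP'p htP'
    obtain ⟨q', hq', hPq', hqp'⟩ := exists_le_under_eq A G P' p hP'p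
    -- Conjugation brings `P'` below `q`, where `t` generates `P`; hence the conjugate contains `P`
    -- and equals it by height.
    obtain ⟨h, hh⟩ := Algebra.IsInvariant.exists_smul_of_under_eq A B G q' q
      (hqp'.trans hqp.symm)
    have hle : h • P' ≤ q := hh ▸ Ideal.pointwise_smul_le_pointwise_smul_iff.2 hPq'
    have : (h • P').IsPrime := Ideal.IsPrime.smul h
    have : P = h • P' := by
      refine eq_of_le_of_height_one hP ((height_smul P' h).trans hP') fun b hb => ?_
      obtain ⟨u, hu, c, huc⟩ := hgen b hb
      exact (Ideal.IsPrime.mem_or_mem' (huc ▸ Ideal.mul_mem_left _ _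
        ((eigen_mem_smul_iff ht P' h).2 htP') : u * b ∈ h • P')).resolve_left fun h => hu (hle h)
    rw [this, Ideal.under_smul]

/-- Some eigenfunction for `χ` avoids `P`, and it is a multiple of the generator up to a denominator
outside `P`. -/
theorem generator_notMem {χ : G →* Rˣ} {p : Ideal A} {s : B}
    (hgen : ∀ b ∈ eigen A χ (B := B), ∃ r : A, r ∉ p ∧ ∃ c : A, r • b = c • s)
    {P : Ideal B} [P.IsPrime] (hPp : P.under A ≤ p) (hχ : ∀ g ∈ P.inertia G, χ g = 1) : s ∉ P := by
  obtain ⟨v, hv, hvP⟩ := exists_eigen_notMem (A := A) χ P hχ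
  obtain ⟨r, hr, c, hrc⟩ := hgen v hv
  intro hs
  rw [Algebra.smul_def, Algebra.smul_def] at hrc
  exact (Ideal.IsPrime.mem_or_mem' (hrc ▸ Ideal.mul_mem_left _ _ hs :
    algebraMap A B r * v ∈ P)).elim (fun h => hr (hPp h)) hvP

variable (R) in
include R in
/-- Near a prime `p`, a ramified prime divisor is the pullback of a principal divisor, up to the
ramification index. -/
theorem exists_algebraMap_hasOrdAt (hfree : GenericallyFree B G) (p : Ideal A) [p.IsPrime]
    {P : Ideal B} [P.IsPrime] (hP : P.height = 1) (hPp : P.under A ≤ p) (hram : P.inertia G ≠ ⊥) :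
    ∃ a : A, HasOrdAt P (algebraMap A B a) (Nat.card (P.inertia G)) ∧
      ∀ (P' : Ideal B) [P'.IsPrime], P'.height = 1 → P'.under A ≤ p → algebraMap A B a ∈ P' →
        P'.under A = P.under A := by
  obtain ⟨χ, t, ht, ht1, htP⟩ := exists_eigen_hasOrdAt_one R hfree p hP hPp hram
  set e := Nat.card (P.inertia G) with he
  -- The generator for the inverse character makes `t ^ e * s` invariant. It contributes no zeros at
  -- `P`, since `χ ^ e` is trivial on inertia, nor at primes avoiding `t`, where `χ` itself is
  -- trivial on inertia.
  obtain ⟨s, hs, hgen⟩ := exists_generator_eigen (A := A) (B := B) (χ ^ e)⁻¹ p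
  obtain ⟨a, ha⟩ : t ^ e * s ∈ Set.range (algebraMap A B) := by
    rw [← mem_eigen_one_iff (R := R) (G := G), ← mul_inv_cancel (χ ^ e)]
    exact mul_mem_eigen (pow_mem_eigen ht e) hs
  refine ⟨a, ?_, ?_⟩
  · rw [ha, mul_comm]
    refine HasOrdAt.mul_notMem ?_ (generator_notMem hgen hPp fun g hg => ?_)
    · simpa using ht1.pow e
    · rw [MonoidHom.inv_apply, MonoidHom.pow_apply,
        (card_inertia_dvd_iff hfree ht ht1 e).1 he.symm.dvd g hg, inv_one]
  · intro P' _ hP' hP'p haP'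
    by_cases htP' : t ∈ P'
    · exact htP P' hP' hP'p htP'
    · rw [ha] at haP'
      refine absurd ((Ideal.IsPrime.mem_or_mem' haP').resolve_left fun h =>
        htP' (Ideal.IsPrime.mem_of_pow_mem ‹_› _ h)) (generator_notMem hgen hP'p fun g hg => ?_)
      rw [MonoidHom.inv_apply, MonoidHom.pow_apply, char_eq_one_of_notMem ht htP' hg, one_pow,
        inv_one]

end Cover

end Ramification

end TameCover

/-! ### Eigenfunctions with prescribed divisors -/

namespace TameCover
open IsLocalRing Pointwise

set_option linter.unusedSectionVars false
set_option linter.overlappingInstances false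

section Cover

variable {R A B : Type u} [CommRing R] [IsDomain R] [CommRing A] [CommRing B]
  [Algebra R A] [Algebra R B] [Algebra A B] [IsScalarTower R A B]
  {G : Type v} [CommGroup G] [Finite G] [IsTameGroup R G]
  [MulSemiringAction G B] [SMulCommClass G A B] [SMulCommClass G R B]
  [IsDomain A] [IsRegularRing A] [IsRegularRing B] [Module.Finite A B]
  [FaithfulSMul A B] [Algebra.IsInvariant A B G]

variable (A B G) in
include G in
theorem height_under_eq_of_isInvariant (P : Ideal B) [P.IsPrime] :
    (P.under A).height = P.height := by
  have := hasGoingDown_of_isInvariant A B G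
  have := Algebra.IsInvariant.isIntegral A B G
  exact height_under_eq A B P

variable (A B G) in
include G in
theorem algebraMap_mem_nonZeroDivisors {a : A} (ha : a ≠ 0) :
    algebraMap A B a ∈ nonZeroDivisors B := by
  rw [mem_nonZeroDivisors_iff_right]
  intro b hb
  rw [mul_comm, ← Algebra.smul_def] at hb
  exact (smul_eq_zero_of_isRegularRing A B G hb).resolve_left ha

theorem exists_eigen_ne_zero [Nontrivial B] (hfree : GenericallyFree B G) (χ : G →* Rˣ) :
    ∃ v ∈ eigen A χ (B := B), v ≠ 0 := by
  obtain ⟨η, hη⟩ := Ideal.nonempty_minimalPrimes (I := (⊥ : Ideal B)) bot_ne_top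
  have : η.IsPrime := hη.1.1
  obtain ⟨v, hv, hvη⟩ := exists_eigen_notMem (A := A) χ η (by
    rw [hfree η hη]
    intro g hg
    rw [Subgroup.mem_bot.1 hg, map_one])
  exact ⟨v, hv, fun h => hvη (h ▸ η.zero_mem)⟩

theorem HasOrdAt.ne_zero_of_height_one {S : Type*} [CommRing S] [IsRegularRing S] {P : Ideal S}
    [P.IsPrime] (hP : P.height = 1) {s : S} {k : ℕ} (h : HasOrdAt P s k) : s ≠ 0 := by
  rintro rfl
  exact (h.notMem_of_mul hP (c := 1) (mul_zero 1)) |> (Ideal.ne_top_iff_one _).1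
    Ideal.IsPrime.ne_top'

variable (A G) in
include G in
/-- The valuation at a prime divisor `P` restricts to a multiple of the valuation at its image. -/
theorem exists_ramificationIdx {P : Ideal B} [P.IsPrime] (hP : P.height = 1) :
    ∃ ε ≠ 0, ∃ x : A, HasOrdAt P (algebraMap A B x) ε ∧ ∀ (a : A) (k : ℕ),
      HasOrdAt P (algebraMap A B a) k → ∃ j, k = ε * j ∧ HasOrdAt (P.under A) a j := by
  have hp : (P.under A).height = 1 := (height_under_eq_of_isInvariant A B G P).trans hP
  obtain ⟨x, hx⟩ := exists_hasOrdAt_one (P := P.under A) hp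
  have hx0 := hx.ne_zero_of_height_one hp
  obtain ⟨ε, hε⟩ := exists_hasOrdAt hP (algebraMap_mem_nonZeroDivisors A B G hx0)
  refine ⟨ε, ?_, x, hε, ?_⟩
  · rintro rfl
    have h0 : x ∉ P.under A := fun h => hasOrdAt_zero_iff.1 hε h
    exact absurd ((hasOrdAt_zero_iff.2 h0).unique hp hx) zero_ne_one
  intro a k ha
  have ha0 : a ≠ 0 := by
    rintro rfl
    exact ha.ne_zero_of_height_one hP (map_zero _)
  obtain ⟨j, hj⟩ := exists_hasOrdAt hp (mem_nonZeroDivisors_of_ne_zero ha0)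
  refine ⟨j, ?_, hj⟩
  have hxj : HasOrdAt (P.under A) (x ^ j) j := by simpa using hx.pow j
  obtain ⟨u, hu, d, hud⟩ := hxj.exists_mul_eq hp hj le_rfl
  obtain ⟨u', hu', d', hud'⟩ := hj.exists_mul_eq hp hxj le_rfl
  have h1 := (ha.mul_notMem (c := algebraMap A B u) hu)
  rw [← map_mul, hud, map_mul, map_pow] at h1
  have hd : algebraMap A B d ∉ P := by
    intro hd
    have h3 : (u * u' - d * d') * a = 0 := by
      linear_combination u' * hud + d * hud'
    rw [mul_eq_zero, or_iff_left ha0, sub_eq_zero] at h3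
    have : u * u' ∈ P.under A := h3 ▸ Ideal.mul_mem_right d' _ hd
    exact (Ideal.IsPrime.mem_or_mem' this).elim hu hu'
  exact h1.unique hP ((hε.pow j).mul_notMem hd)

/-- The valuation at a ramified prime divisor `P` restricts to the `e`-fold multiple of the
valuation at its image, where `e` is the order of the inertia group. -/
theorem exists_hasOrdAt_under (hfree : GenericallyFree B G) {P : Ideal B} [P.IsPrime]
    (hP : P.height = 1) {χ : G →* Rˣ} {t : B} (ht : t ∈ eigen A χ) (ht1 : HasOrdAt P t 1) {a : A}
    {k : ℕ} (ha : HasOrdAt P (algebraMap A B a) k) :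
    ∃ j, k = Nat.card (P.inertia G) * j ∧ HasOrdAt (P.under A) a j := by
  set e := Nat.card (P.inertia G) with he
  obtain ⟨ε, -, x, hε, hmul⟩ := exists_ramificationIdx A G hP
  -- The uniformizer of the image has trivial character, so `χ ^ ε` is trivial on inertia.
  have hdvd : e ∣ ε := by
    rw [card_inertia_dvd_iff hfree ht ht1]
    intro g hg
    have hx1 : algebraMap A B x ∈ eigen A (1 : G →* Rˣ) := mem_eigen_one_iff.2 ⟨x, rfl⟩
    exact (char_eq_pow_of_hasOrdAt hP ht hx1 ht1 hε hg).symm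
  -- Conversely, correcting `t ^ e` by an eigenfunction not vanishing at `P` gives an element of `A`
  -- of order `e`, so `ε` divides `e`.
  obtain ⟨v, hv, hvP⟩ := exists_eigen_notMem (A := A) (χ ^ e)⁻¹ P fun g hg => by
    rw [MonoidHom.inv_apply, MonoidHom.pow_apply,
        (card_inertia_dvd_iff hfree ht ht1 e).1 he.symm.dvd g hg, inv_one]
  obtain ⟨c, hc⟩ : t ^ e * v ∈ Set.range (algebraMap A B) := by
    rw [← mem_eigen_one_iff (R := R) (G := G), ← mul_inv_cancel (χ ^ e)]
    exact mul_mem_eigen (pow_mem_eigen ht e) hv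
  have hce : HasOrdAt P (algebraMap A B c) e := by
    rw [hc, mul_comm]
    refine HasOrdAt.mul_notMem ?_ hvP
    simpa using ht1.pow e
  obtain ⟨j, hj, -⟩ := hmul c e hce
  have : ε = e := Nat.dvd_antisymm ⟨j, hj⟩ hdvd
  rw [← this]
  exact hmul a k ha

variable (G) in
include G in
/-- Divisibility in `A` can be tested at the prime divisors of `B`. -/
theorem dvd_of_forall_hasOrdAt {a b : A} (ha : a ≠ 0)
    (h : ∀ (P : Ideal B) [P.IsPrime], P.height = 1 → ∃ i j, i ≤ j ∧
      HasOrdAt P (algebraMap A B a) i ∧ (b = 0 ∨ HasOrdAt P (algebraMap A B b) j)) : a ∣ b := by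
  rcases eq_or_ne b 0 with rfl | hb
  · exact dvd_zero a
  refine dvd_of_forall_height_one (fun p _ => inferInstance) ha fun p _ hp => ?_
  have := Algebra.IsInvariant.isIntegral A B G
  obtain ⟨P, -, hP, hPp⟩ := Ideal.exists_ideal_over_prime_of_isIntegral p (⊥ : Ideal B)
    (by
      rw [← RingHom.ker_eq_comap_bot,
        (RingHom.injective_iff_ker_eq_bot _).1 (FaithfulSMul.algebraMap_injective A B)]
      exact bot_le)
  have hP1 : P.height = 1 := by
    rw [← height_under_eq_of_isInvariant A B G P, ← hp, ← hPp]
  obtain ⟨i, j, hij, hai, hbj⟩ := h P hP1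
  replace hbj := hbj.resolve_left hb
  have := isDiscreteValuationRing_localization p hp
  -- Should `b` divide `a` instead, a cofactor in `p` would have positive order at `P` and
  -- contradict the inequality of orders; otherwise the cofactor is a unit at `p`.
  refine (ValuationRing.dvd_total _ _).elim id fun hba => ?_
  obtain ⟨u, hu, d, hud⟩ := exists_mul_eq_mul_of_dvd (P := p) hba
  by_cases hd : d ∈ p
  · obtain ⟨k, hk⟩ := exists_hasOrdAt hP1 (algebraMap_mem_nonZeroDivisors A B G (a := d) (by
      rintro rfl
      rw [zero_mul, mul_eq_zero] at hud
      exact hud.elim (fun h => hu (h ▸ p.zero_mem)) ha))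
    have hk0 : k ≠ 0 := by
      rintro rfl
      exact hasOrdAt_zero_iff.1 hk (hPp.ge hd)
    have h1 := hai.mul_notMem (c := algebraMap A B u) (fun h => hu (hPp.le h))
    rw [← map_mul, hud, map_mul] at h1
    have := h1.unique hP1 (hk.mul hbj)
    omega
  · have h1 := congrArg (algebraMap A (Localization.AtPrime p)) hud
    rw [map_mul, map_mul] at h1
    have hdu := IsLocalization.map_units (Localization.AtPrime p) (⟨d, hd⟩ : p.primeCompl)
    rw [← hdu.dvd_mul_left, ← h1]
    exact dvd_mul_left _ _

variable (R A B G) in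
include R A in
/-- The ramified primes contain a common non-zero-divisor. -/
theorem exists_mem_of_ramified [Nontrivial B] (hfree : GenericallyFree B G) :
    ∃ Δ ∈ nonZeroDivisors B, ∀ (P : Ideal B) [P.IsPrime], P.inertia G ≠ ⊥ → Δ ∈ P := by
  classical
  have : Fintype (G →* Rˣ) := Fintype.ofFinite _
  choose s hs hs0 using fun χ : G →* Rˣ => exists_eigen_ne_zero (A := A) hfree χ
  -- A nontrivial inertia element is detected by some character, and every eigenfunction for that
  -- character vanishes at `P`.
  refine ⟨∏ χ, s χ, Submonoid.prod_mem _ fun χ _ => eigen_mem_nonZeroDivisors (hs χ) (hs0 χ),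
    fun P _ hP => ?_⟩
  obtain ⟨g, hg, hg1⟩ := (Subgroup.bot_or_exists_ne_one (P.inertia G)).resolve_left hP
  obtain ⟨χ, hχ⟩ := CommGroup.exists_apply_ne_one_of_hasEnoughRootsOfUnity G R hg1
  exact Ideal.IsPrime.prod_mem_iff.2 ⟨χ, Finset.mem_univ χ, mem_of_char_ne_one (hs χ) hg hχ⟩

/-- Near every prime of `A`, there is a rational eigenfunction of `B` with any given divisor that
is invariant, supported in the ramification, and compatible with the character. -/
theorem exists_eigen_forall_hasOrdAt [Nontrivial B] (hfree : GenericallyFree B G) (φ : G →* Rˣ)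
    (m : Ideal B → ℤ)
    (hm0 : ∀ (P : Ideal B) [P.IsPrime], P.height = 1 → P.inertia G = ⊥ → m P = 0)
    (hmG : ∀ (P : Ideal B) [P.IsPrime], P.height = 1 → ∀ g : G, m (g • P) = m P)
    (hmφ : ∀ (P : Ideal B) [P.IsPrime], P.height = 1 → ∀ (χ : G →* Rˣ), ∀ t ∈ eigen A χ (B := B),
      HasOrdAt P t 1 → ∀ g ∈ P.inertia G, φ g = χ g ^ m P)
    (p : Ideal A) [p.IsPrime] :
    ∃ r ∉ p, ∃ b ∈ eigen A φ (B := B), ∃ a : A, b ≠ 0 ∧ a ≠ 0 ∧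
      ∀ (P : Ideal B) [P.IsPrime], P.height = 1 → algebraMap A B r ∉ P →
        ∃ i j : ℕ, HasOrdAt P b i ∧ HasOrdAt P (algebraMap A B a) j ∧ (i : ℤ) - j = m P := by
  classical
  obtain ⟨Δ, hΔ, hΔP⟩ := exists_mem_of_ramified R A B G hfree
  obtain ⟨s, hs, hgen⟩ := exists_generator_eigen (A := A) (B := B) φ p
  have hs0 : s ≠ 0 := by
    obtain ⟨v, hv, hv0⟩ := exists_eigen_ne_zero (A := A) hfree φ
    obtain ⟨r, hr, c, hrc⟩ := hgen v hv
    rintro rfl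
    rw [smul_zero] at hrc
    exact (smul_eq_zero_of_isRegularRing A B G hrc).elim (fun h => hr (h ▸ p.zero_mem)) hv0
  let Y : Set (Ideal A) := {y | ∃ P : Ideal B, P.IsPrime ∧ P.height = 1 ∧ P.inertia G ≠ ⊥ ∧
    P.under A = y ∧ y ≤ p}
  have hYfin : Y.Finite := by
    refine ((finite_setOf_height_one_mem hΔ).image (fun P => P.under A)).subset ?_
    rintro y ⟨P, hP, hP1, hPr, hPy, -⟩
    exact ⟨P, ⟨hP, hP1, hΔP P hPr⟩, hPy⟩
  -- At each of the finitely many ramified primes of `A` below `p`, elements of `A` are found that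
  -- correct the order of `s` there and are units at the other primes below `p`.
  have hlocal : ∀ y ∈ Y, ∃ c d : A, c ≠ 0 ∧ d ≠ 0 ∧
      (∀ (P : Ideal B) [P.IsPrime], P.height = 1 → P.under A = y → ∃ i j k : ℕ,
        HasOrdAt P s i ∧ HasOrdAt P (algebraMap A B c) j ∧ HasOrdAt P (algebraMap A B d) k ∧
        (i : ℤ) + j - k = m P) ∧
      (∀ (P : Ideal B) [P.IsPrime], P.height = 1 → P.under A ≤ p → P.under A ≠ y →
        algebraMap A B c ∉ P ∧ algebraMap A B d ∉ P) := by
    rintro y ⟨P, hP, hP1, hPr, rfl, hyp⟩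
    obtain ⟨a, ha, haP⟩ := exists_algebraMap_hasOrdAt R hfree p hP1 hyp hPr
    obtain ⟨χ, t, ht, ht1, -⟩ := exists_eigen_hasOrdAt_one R hfree p hP1 hyp hPr
    obtain ⟨i, hi⟩ := exists_hasOrdAt hP1 (eigen_mem_nonZeroDivisors hs hs0)
    have ha0 : a ≠ 0 := by
      rintro rfl
      exact (ha.notMem_of_mul hP1 (c := 1) (by rw [map_zero, mul_zero])) |>
        (Ideal.ne_top_iff_one _).1 Ideal.IsPrime.ne_top'
    set e := Nat.card (P.inertia G) with he
    -- Both the prescribed order and the order of `s` express `φ` as a power of the character of a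
    -- uniformizer, so they agree modulo the order of inertia.
    obtain ⟨k, hk⟩ : (e : ℤ) ∣ m P - i := by
      rw [Int.natCast_dvd, card_inertia_dvd_iff hfree ht ht1]
      intro g hg
      have h1 := char_eq_pow_of_hasOrdAt hP1 ht hs ht1 hi hg
      rw [hmφ P hP1 χ t ht ht1 g hg] at h1
      have h2 : χ g ^ (m P - i) = 1 := by
        rw [zpow_sub, h1, zpow_natCast, mul_inv_cancel]
      rcases Int.natAbs_eq (m P - i) with h | h
      · rw [h, zpow_natCast] at h2
        exact h2
      · rw [h, zpow_neg, zpow_natCast, inv_eq_one] at h2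
        exact h2
    -- The exponent `k` may be negative; its positive part goes to the numerator and its negative
    -- part to the denominator.
    refine ⟨a ^ k.toNat, a ^ (-k).toNat, pow_ne_zero _ ha0, pow_ne_zero _ ha0, ?_, ?_⟩
    · intro P' _ hP'1 hP'y
      obtain ⟨g, rfl⟩ := Algebra.IsInvariant.exists_smul_of_under_eq A B G P P' hP'y.symm
      have hag : HasOrdAt (g • P) (algebraMap A B a) e := by
        have := ha.smul g
        rwa [smul_algebraMap] at this
      refine ⟨i, e * k.toNat, e * (-k).toNat, hi.smul_eigen hs g, ?_, ?_, ?_⟩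
      · rw [map_pow]
        exact hag.pow _
      · rw [map_pow]
        exact hag.pow _
      · rw [hmG P hP1 g]
        push_cast
        have := Int.toNat_sub_toNat_neg k
        linear_combination (e : ℤ) * this - hk
    · intro P' _ hP'1 hP'p hne
      have : algebraMap A B a ∉ P' := fun h => hne (haP P' hP'1 hP'p h)
      rw [map_pow, map_pow]
      exact ⟨fun h => this (Ideal.IsPrime.mem_of_pow_mem ‹_› _ h),
        fun h => this (Ideal.IsPrime.mem_of_pow_mem ‹_› _ h)⟩
  choose! c d hc0 hd0 hcd hcd' using hlocal
  let b : B := algebraMap A B (∏ y ∈ hYfin.toFinset, c y) * s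
  let a : A := ∏ y ∈ hYfin.toFinset, d y
  have hb : b ∈ eigen A φ := by
    have := (eigen A φ (B := B)).smul_mem (∏ y ∈ hYfin.toFinset, c y) hs
    rwa [Algebra.smul_def] at this
  have ha0 : a ≠ 0 := Finset.prod_ne_zero_iff.2 fun y hy => hd0 y (hYfin.mem_toFinset.1 hy)
  have hb0 : b ≠ 0 := fun h => (smul_eq_zero_of_isRegularRing A B G
    (show (∏ y ∈ hYfin.toFinset, c y) • s = 0 by rwa [Algebra.smul_def])).elim
    (Finset.prod_ne_zero_iff.2 fun y hy => hc0 y (hYfin.mem_toFinset.1 hy)) hs0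
  have hprod : ∀ (f : Ideal A → A) (P : Ideal B) [P.IsPrime] (T : Finset (Ideal A)),
      (∀ y ∈ T, algebraMap A B (f y) ∉ P) → algebraMap A B (∏ y ∈ T, f y) ∉ P := by
    intro f P _ T h hmem
    rw [map_prod, Ideal.IsPrime.prod_mem_iff] at hmem
    obtain ⟨y, hy, hyP⟩ := hmem
    exact h y hy hyP
  have hnear : ∀ (P : Ideal B) [P.IsPrime], P.height = 1 → P.under A ≤ p →
      ∃ i j : ℕ, HasOrdAt P b i ∧ HasOrdAt P (algebraMap A B a) j ∧ (i : ℤ) - j = m P := by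
    intro P _ hP1 hPp
    by_cases hPY : P.under A ∈ Y
    · obtain ⟨i, j, k, hi, hj, hk, e⟩ := hcd _ hPY P hP1 rfl
      have hmem := hYfin.mem_toFinset.2 hPY
      refine ⟨i + j, k, ?_, ?_, by push_cast; exact e⟩
      · change HasOrdAt P (algebraMap A B (∏ y ∈ hYfin.toFinset, c y) * s) _
        rw [add_comm, ← Finset.prod_erase_mul _ _ hmem, map_mul]
        refine HasOrdAt.mul (hj.mul_notMem (hprod c P _ fun y hy => ?_)) hi
        exact (hcd' y (hYfin.mem_toFinset.1 (Finset.mem_of_mem_erase hy)) P hP1 hPp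
          (Finset.ne_of_mem_erase hy).symm).1
      · change HasOrdAt P (algebraMap A B (∏ y ∈ hYfin.toFinset, d y)) _
        rw [← Finset.prod_erase_mul _ _ hmem, map_mul]
        refine hk.mul_notMem (hprod d P _ fun y hy => ?_)
        exact (hcd' y (hYfin.mem_toFinset.1 (Finset.mem_of_mem_erase hy)) P hP1 hPp
          (Finset.ne_of_mem_erase hy).symm).2
    · have hI : P.inertia G = ⊥ := by
        by_contra hI
        exact hPY ⟨P, inferInstance, hP1, hI, rfl, hPp⟩
      have hne : ∀ y ∈ hYfin.toFinset, P.under A ≠ y := fun y hy h =>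
        hPY (h ▸ hYfin.mem_toFinset.1 hy)
      refine ⟨0, 0, ?_, ?_, by rw [hm0 P hP1 hI]; rfl⟩
      · refine HasOrdAt.mul_notMem (hasOrdAt_zero_iff.2 ?_) (hprod c P _ fun y hy =>
          (hcd' y (hYfin.mem_toFinset.1 hy) P hP1 hPp (hne y hy)).1)
        refine generator_notMem hgen hPp fun g hg => ?_
        rw [hI, Subgroup.mem_bot] at hg
        rw [hg, map_one]
      · exact hasOrdAt_zero_iff.2 (hprod d P _ fun y hy =>
          (hcd' y (hYfin.mem_toFinset.1 hy) P hP1 hPp (hne y hy)).2)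
  have hbaΔ : b * algebraMap A B a * Δ ∈ nonZeroDivisors B :=
    mul_mem (mul_mem (eigen_mem_nonZeroDivisors hb hb0) (algebraMap_mem_nonZeroDivisors A B G ha0)) hΔ
  -- Away from `p` the divisor may be wrong, but only at finitely many prime divisors. The
  -- denominator `r` is chosen to vanish at all of them.
  have hfin : {P : Ideal B | P.IsPrime ∧ P.height = 1 ∧ b * algebraMap A B a * Δ ∈ P ∧
      ¬ P.under A ≤ p}.Finite :=
    (finite_setOf_height_one_mem hbaΔ).subset fun P h => ⟨h.1, h.2.1, h.2.2.1⟩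
  have hx : ∀ P : Ideal B, ¬ P.under A ≤ p → ∃ x ∈ P.under A, x ∉ p := fun P h =>
    SetLike.not_le_iff_exists.1 h
  choose! x hxP hxp using hx
  refine ⟨∏ P ∈ hfin.toFinset, x P, ?_, b, hb, a, hb0, ha0, fun P _ hP1 hrP => ?_⟩
  · intro h
    obtain ⟨P, hP, hPx⟩ := (Ideal.IsPrime.prod_mem_iff).1 h
    exact hxp P (hfin.mem_toFinset.1 hP).2.2.2 hPx
  · by_cases hPp : P.under A ≤ p
    · exact hnear P hP1 hPp
    · have hnot : b * algebraMap A B a * Δ ∉ P := by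
        intro h
        refine hrP ?_
        have hmem : P ∈ hfin.toFinset := hfin.mem_toFinset.2 ⟨inferInstance, hP1, h, hPp⟩
        rw [map_prod]
        exact Ideal.IsPrime.prod_mem_iff.2 ⟨P, hmem, hxP P hPp⟩
      have hI : P.inertia G = ⊥ := by
        by_contra hI
        exact hnot (Ideal.mul_mem_left _ _ (hΔP P hI))
      refine ⟨0, 0, hasOrdAt_zero_iff.2 fun h => hnot ?_, hasOrdAt_zero_iff.2 fun h => hnot ?_,
        by rw [hm0 P hP1 hI]; rfl⟩
      · exact Ideal.mul_mem_right _ _ (Ideal.mul_mem_right _ _ h)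
      · exact Ideal.mul_mem_right _ _ (Ideal.mul_mem_left _ _ h)

end Cover

end TameCover

/-! ### Tensor powers of locally principal modules -/

namespace TameCover
open IsLocalRing Pointwise

set_option linter.unusedSectionVars false
set_option linter.overlappingInstances false

theorem mem_of_forall_exists_notMem {A M : Type*} [CommRing A] [AddCommGroup M] [Module A M]
    (N : Submodule A M) (x : M) (h : ∀ p : Ideal A, p.IsMaximal → ∃ r ∉ p, r • x ∈ N) : x ∈ N := by
  let I : Ideal A := N.comap (LinearMap.toSpanSingleton A M x)
  have hI : ∀ r, r ∈ I ↔ r • x ∈ N := fun r => Iff.rfl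
  have htop : I = ⊤ := by
    by_contra hne
    obtain ⟨p, hp, hIp⟩ := Ideal.exists_le_maximal I hne
    obtain ⟨r, hr, hrx⟩ := h p hp
    exact hr (hIp ((hI r).2 hrx))
  have := (hI 1).1 (htop ▸ Submodule.mem_top)
  rwa [one_smul] at this

/-- If the submodules `M` and `N` are locally generated by `s` and `s ^ n`, with `s ^ n` locally
torsion-free, then multiplication identifies the `n`-th tensor power of `M` with `N`. -/
theorem exists_piTensorProduct_equiv {A K' K : Type*} [CommRing A] [CommRing K'] [CommRing K]
    [Algebra A K'] [Algebra A K] (ι : K' →ₐ[A] K) (hι : Function.Injective ι)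
    (M : Submodule A K) (N : Submodule A K') (n : ℕ)
    (h : ∀ p : Ideal A, p.IsMaximal → ∃ s ∈ M, ∃ σ ∈ N, s ^ n = ι σ ∧
      (∀ t ∈ M, ∃ r ∉ p, ∃ c : A, r • t = c • s) ∧ (∀ t ∈ N, ∃ r ∉ p, ∃ c : A, r • t = c • σ) ∧
      ∀ c : A, c • s ^ n = 0 → ∃ r ∉ p, r * c = 0) :
    ∃ e : (⨂[A] _ : Fin n, M) ≃ₗ[A] N,
      ∀ a : Fin n → M, ι (e (PiTensorProduct.tprod A a)).1 = ∏ i, (a i : K) := by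
  let μ : (⨂[A] _ : Fin n, M) →ₗ[A] K := PiTensorProduct.lift
    ((MultilinearMap.mkPiAlgebra A (Fin n) K).compLinearMap fun _ => M.subtype)
  have hμ : ∀ a : Fin n → M, μ (PiTensorProduct.tprod A a) = ∏ i, (a i : K) := fun a => by
    rw [PiTensorProduct.lift.tprod]
    rfl
  -- Near `p`, every tensor is a multiple of the pure power of the local generator `s`.
  have hloc : ∀ p : Ideal A, p.IsMaximal → ∀ s : M,
      (∀ t ∈ M, ∃ r ∉ p, ∃ c : A, r • t = c • s.1) → ∀ x : ⨂[A] _ : Fin n, M,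
      ∃ r ∉ p, ∃ c : A, r • x = c • PiTensorProduct.tprod A fun _ => s := by
    intro p hp s hs x
    have hp' := hp.isPrime
    induction x using PiTensorProduct.induction_on with
    | smul_tprod l a =>
      choose r hr c hrc using fun i => hs (a i).1 (a i).2
      refine ⟨∏ i, r i, fun h => ?_, l * ∏ i, c i, ?_⟩
      · obtain ⟨i, -, hi⟩ := Ideal.IsPrime.prod_mem_iff.1 h
        exact hr i hi
      · rw [smul_comm, ← MultilinearMap.map_smul_univ, mul_smul, ← MultilinearMap.map_smul_univ]
        congr 2
        funext i
        exact Subtype.ext (hrc i)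
    | add x y hx hy =>
      obtain ⟨r, hr, c, hrc⟩ := hx
      obtain ⟨r', hr', c', hrc'⟩ := hy
      refine ⟨r * r', fun h => (Ideal.IsPrime.mem_or_mem' h).elim hr hr', r' * c + r * c', ?_⟩
      rw [smul_add, mul_comm r, mul_smul, hrc, mul_comm r', mul_smul, hrc', add_smul, mul_smul,
        mul_smul]
  -- Equal images mean that two multiples of `s ^ n` agree; torsion-freeness of `s ^ n` near `p`
  -- then identifies the coefficients.
  have hinj : Function.Injective μ := by
    intro x y hxy
    let I : Ideal A := LinearMap.eqLocus (LinearMap.toSpanSingleton A _ x)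
      (LinearMap.toSpanSingleton A _ y)
    have hI : (1 : A) ∈ I := mem_of_forall_exists_notMem I 1 fun p hp => by
      have hp' := hp.isPrime
      obtain ⟨s, hs, σ, hσ, hsσ, hM, hN, htf⟩ := h p hp
      obtain ⟨r, hr, c, hrc⟩ := hloc p hp ⟨s, hs⟩ hM x
      obtain ⟨r', hr', c', hrc'⟩ := hloc p hp ⟨s, hs⟩ hM y
      have hμs : μ (PiTensorProduct.tprod A fun _ => ⟨s, hs⟩) = s ^ n := by
        rw [hμ, Finset.prod_const, Finset.card_univ, Fintype.card_fin]
      have h1 := congrArg μ hrc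
      have h2 := congrArg μ hrc'
      rw [map_smul, map_smul, hμs] at h1 h2
      obtain ⟨r'', hr'', h3⟩ := htf (r' * c - r * c') (by
        rw [sub_smul, mul_smul, mul_smul, ← h1, ← h2, hxy, smul_comm, sub_self])
      refine ⟨r'' * (r * r'), fun h => (Ideal.IsPrime.mem_or_mem' h).elim hr''
        fun h => (Ideal.IsPrime.mem_or_mem' h).elim hr hr', ?_⟩
      change (r'' * (r * r') * 1) • x = (r'' * (r * r') * 1) • y
      rw [mul_sub, sub_eq_zero] at h3
      rw [mul_one, mul_comm r, mul_smul, mul_smul, hrc, mul_comm r' r, mul_smul r'', mul_smul r,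
        hrc', smul_smul, smul_smul, smul_smul, smul_smul, mul_assoc, h3, mul_assoc]
    have h4 : (1 : A) • x = (1 : A) • y := hI
    rwa [one_smul, one_smul] at h4
  have hrange : LinearMap.range μ = N.map ι.toLinearMap := by
    apply le_antisymm
    · rintro _ ⟨x, rfl⟩
      refine mem_of_forall_exists_notMem _ _ fun p hp => ?_
      obtain ⟨s, hs, σ, hσ, hsσ, hM, hN, htf⟩ := h p hp
      obtain ⟨r, hr, c, hrc⟩ := hloc p hp ⟨s, hs⟩ hM x
      refine ⟨r, hr, ?_⟩
      rw [← map_smul, hrc, map_smul, hμ, Finset.prod_const, Finset.card_univ, Fintype.card_fin, hsσ]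
      exact Submodule.smul_mem _ _ ⟨σ, hσ, rfl⟩
    · rintro _ ⟨t, ht, rfl⟩
      refine mem_of_forall_exists_notMem _ _ fun p hp => ?_
      obtain ⟨s, hs, σ, hσ, hsσ, hM, hN, htf⟩ := h p hp
      obtain ⟨r, hr, c, hrc⟩ := hN t ht
      refine ⟨r, hr, c • PiTensorProduct.tprod A fun _ => ⟨s, hs⟩, ?_⟩
      rw [map_smul, hμ, Finset.prod_const, Finset.card_univ, Fintype.card_fin, ← map_smul, hrc,
        map_smul]
      exact congrArg (c • ·) hsσ
  let e₁ := LinearEquiv.ofInjective μ hinj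
  let e₂ := LinearEquiv.ofEq _ _ hrange
  let e₃ := Submodule.equivMapOfInjective ι.toLinearMap hι N
  refine ⟨(e₁.trans e₂).trans e₃.symm, fun a => ?_⟩
  have h1 : (e₃ (((e₁.trans e₂).trans e₃.symm) (PiTensorProduct.tprod A a))).1 =
      μ (PiTensorProduct.tprod A a) := by
    simp only [LinearEquiv.trans_apply, LinearEquiv.apply_symm_apply]
    rfl
  rw [← hμ, ← h1]
  rfl

end TameCover

namespace TameCover
open IsLocalRing Pointwise

set_option linter.unusedSectionVars false
set_option linter.overlappingInstances false

/-! ### Points of affine open subschemes -/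

section Points

variable {X : Scheme.{u}} {U : X.Opens}

/-- The prime ideal of the functions on `U` that vanish at the point `x`. -/
noncomputable def pointIdeal (U : X.Opens) (x : X) (hx : x ∈ U) : Ideal Γ(X, U) :=
  (maximalIdeal (X.presheaf.stalk x)).comap (X.presheaf.germ U x hx).hom

instance (x : X) (hx : x ∈ U) : (pointIdeal U x hx).IsPrime :=
  Ideal.comap_isPrime _ _

theorem mem_pointIdeal {x : X} {hx : x ∈ U} {b : Γ(X, U)} : b ∈ pointIdeal U x hx ↔
    (X.presheaf.germ U x hx).hom b ∈ maximalIdeal (X.presheaf.stalk x) := Iff.rfl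

theorem notMem_pointIdeal {x : X} {hx : x ∈ U} {b : Γ(X, U)} : b ∉ pointIdeal U x hx ↔
    IsUnit ((X.presheaf.germ U x hx).hom b) := by
  rw [mem_pointIdeal, mem_maximalIdeal, mem_nonunits_iff, not_not]

theorem pointIdeal_eq (hU : IsAffineOpen U) (x : X) (hx : x ∈ U) :
    pointIdeal U x hx = (hU.primeIdealOf ⟨x, hx⟩).asIdeal := by
  rw [hU.primeIdealOf_eq_map_closedPoint]
  rfl

theorem isLocalization_stalk (hU : IsAffineOpen U) (x : X) (hx : x ∈ U) :
    letI := X.presheaf.algebra_section_stalk ⟨x, hx⟩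
    IsLocalization.AtPrime (X.presheaf.stalk x) (pointIdeal U x hx) := by
  simp only [pointIdeal_eq hU]
  exact hU.isLocalization_stalk ⟨x, hx⟩

theorem exists_pointIdeal_eq (hU : IsAffineOpen U) (P : Ideal Γ(X, U)) [hP : P.IsPrime] :
    ∃ (x : X) (hx : x ∈ U), pointIdeal U x hx = P := by
  have h : hU.fromSpec ⟨P, hP⟩ ∈ U := by
    have := hU.range_fromSpec
    exact this.le ⟨_, rfl⟩
  refine ⟨hU.fromSpec ⟨P, hP⟩, h, ?_⟩
  rw [pointIdeal_eq hU]
  have h2 := hU.fromSpec_primeIdealOf ⟨_, h⟩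
  have := hU.fromSpec.isOpenEmbedding.injective h2
  rw [this]

theorem eq_of_pointIdeal_eq (hU : IsAffineOpen U) {x y : X} (hx : x ∈ U) (hy : y ∈ U)
    (h : pointIdeal U x hx = pointIdeal U y hy) : x = y := by
  rw [pointIdeal_eq hU, pointIdeal_eq hU] at h
  have := PrimeSpectrum.ext h
  have h1 := hU.fromSpec_primeIdealOf ⟨x, hx⟩
  have h2 := hU.fromSpec_primeIdealOf ⟨y, hy⟩
  rw [this] at h1
  exact h1.symm.trans h2

theorem specializes_of_pointIdeal_le (hU : IsAffineOpen U) {x y : X} (hx : x ∈ U) (hy : y ∈ U)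
    (h : pointIdeal U x hx ≤ pointIdeal U y hy) : x ⤳ y := by
  rw [pointIdeal_eq hU, pointIdeal_eq hU] at h
  have h0 : hU.primeIdealOf ⟨x, hx⟩ ⤳ hU.primeIdealOf ⟨y, hy⟩ :=
    (PrimeSpectrum.le_iff_specializes _ _).1 h
  have := h0.map hU.fromSpec.continuous
  have h1 := hU.fromSpec_primeIdealOf ⟨x, hx⟩
  have h2 := hU.fromSpec_primeIdealOf ⟨y, hy⟩
  rwa [h1, h2] at this

theorem pointIdeal_le_of_specializes {x y : X} (hx : x ∈ U) (hy : y ∈ U) (h : x ⤳ y) :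
    pointIdeal U x hx ≤ pointIdeal U y hy := by
  intro b hb
  by_contra hb'
  rw [notMem_pointIdeal] at hb'
  have := hb'.map (X.presheaf.stalkSpecializes h).hom
  rw [← CommRingCat.comp_apply, X.presheaf.germ_stalkSpecializes] at this
  exact notMem_pointIdeal.2 this hb

theorem height_pointIdeal (hU : IsAffineOpen U) (x : X) (hx : x ∈ U) :
    (pointIdeal U x hx).height = Order.coheight x := by
  let _ := X.presheaf.algebra_section_stalk ⟨x, hx⟩
  have := isLocalization_stalk hU x hx
  have h := IsLocalization.AtPrime.ringKrullDim_eq_height (pointIdeal U x hx)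
    (X.presheaf.stalk x)
  rw [ringKrullDim_stalk_eq_coheight] at h
  exact (WithBot.coe_injective h).symm

/-- Sobriety gives each irreducible closed set a generic point, so maximality among irreducible sets
can be tested on generizations. -/
theorem mem_genericPoints_iff {x : X} : x ∈ genericPoints X ↔ ∀ z : X, z ⤳ x → z = x := by
  constructor
  · intro hx z hz
    have h1 : closure {z} ⊆ closure {x} :=
      hx.2 isIrreducible_singleton.closure (closure_mono (Set.singleton_subset_iff.2
        (specializes_iff_mem_closure.1 hz)) |>.trans closure_closure.subset)
    exact (hz.antisymm (specializes_iff_mem_closure.2 (h1 (subset_closure rfl)))).eq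
  · intro h
    refine ⟨isIrreducible_singleton.closure, fun Z hZ hle => ?_⟩
    obtain ⟨z, hz⟩ := QuasiSober.sober hZ.closure isClosed_closure
    have hzx : z ⤳ x := hz.specializes (subset_closure (hle (subset_closure rfl)))
    have := h z hzx
    subst this
    exact subset_closure.trans hz.symm.subset

theorem mem_genericPoints_iff_coheight {x : X} : x ∈ genericPoints X ↔ Order.coheight x = 0 := by
  rw [mem_genericPoints_iff, Order.coheight_eq_zero]
  constructor
  · intro h z hz
    exact (h z hz).le
  · intro h z hz
    exact (Specializes.antisymm hz (h hz)).eq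

theorem mem_genericPoints_iff_mem_minimalPrimes (hU : IsAffineOpen U) {x : X} (hx : x ∈ U) :
    x ∈ genericPoints X ↔ pointIdeal U x hx ∈ minimalPrimes Γ(X, U) := by
  rw [mem_genericPoints_iff_coheight, ← height_pointIdeal hU x hx, Ideal.height_eq_zero_iff]

theorem hasOrd_germ_iff (hU : IsAffineOpen U) {x : X} (hx : x ∈ U) {b : Γ(X, U)} {k : ℕ} :
    HasOrd ((X.presheaf.germ U x hx).hom b) k ↔ HasOrdAt (pointIdeal U x hx) b k := by
  let _ := X.presheaf.algebra_section_stalk ⟨x, hx⟩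
  have := isLocalization_stalk hU x hx
  exact hasOrd_algebraMap_iff (pointIdeal U x hx) (X.presheaf.stalk x)

instance [IsRegularScheme X] (x : X) : IsRegularLocalRing (X.presheaf.stalk x) :=
  IsRegularScheme.regular_stalk x

theorem isRegularRing_of_isAffineOpen [IsRegularScheme X] (hU : IsAffineOpen U) :
    IsRegularRing Γ(X, U) := by
  have := IsRegularScheme.locallyNoetherian (X := X)
  have : IsNoetherianRing Γ(X, U) := IsLocallyNoetherian.component_noetherian ⟨U, hU⟩
  rw [isRegularRing_iff]
  intro P hP
  obtain ⟨x, hx, rfl⟩ := exists_pointIdeal_eq hU P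
  let _ := X.presheaf.algebra_section_stalk ⟨x, hx⟩
  have := isLocalization_stalk hU x hx
  exact IsRegularLocalRing.of_ringEquiv (IsLocalization.algEquiv (pointIdeal U x hx).primeCompl
    (X.presheaf.stalk x) (Localization.AtPrime (pointIdeal U x hx))).toRingEquiv

theorem isField_stalk_of_mem_genericPoints [IsRegularScheme X] {ξ : X} (h : ξ ∈ genericPoints X) :
    IsField (X.presheaf.stalk ξ) := by
  rw [mem_genericPoints_iff_coheight] at h
  have h1 := IsRegularLocalRing.spanFinrank_maximalIdeal (R := X.presheaf.stalk ξ)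
  rw [ringKrullDim_stalk_eq_coheight, h] at h1
  have h2 : (maximalIdeal (X.presheaf.stalk ξ)).spanFinrank = 0 := by exact_mod_cast h1
  rw [IsLocalRing.isField_iff_maximalIdeal_eq]
  exact (Submodule.spanFinrank_eq_zero_iff_eq_bot (IsNoetherian.noetherian _)).1 h2

theorem germ_eq_zero_of_mem [IsRegularScheme X] {ξ : X} (h : ξ ∈ genericPoints X) {hξ : ξ ∈ U}
    {b : Γ(X, U)} (hb : b ∈ pointIdeal U ξ hξ) : (X.presheaf.germ U ξ hξ).hom b = 0 := by
  have := (IsLocalRing.isField_iff_maximalIdeal_eq.1 (isField_stalk_of_mem_genericPoints h))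
  rw [mem_pointIdeal, this] at hb
  exact hb

/-- Generization is a localization, and the local ring at the special point is a domain because it
is regular. -/
theorem stalkSpecializes_injective [IsRegularScheme X] {x y : X} (h : x ⤳ y) :
    Function.Injective (X.presheaf.stalkSpecializes h).hom := by
  obtain ⟨_, ⟨U, hU, rfl⟩, hy, -⟩ := X.isBasis_affineOpens.exists_subset_of_mem_open
    (Set.mem_univ y) isOpen_univ
  have hx : x ∈ U := h.mem_open U.2 hy
  let _ := X.presheaf.algebra_section_stalk ⟨x, hx⟩
  let _ := X.presheaf.algebra_section_stalk ⟨y, hy⟩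
  have hlx := isLocalization_stalk hU x hx
  have hly := isLocalization_stalk hU y hy
  have hle := pointIdeal_le_of_specializes hx hy h
  have hcomp : ∀ b : Γ(X, U), (X.presheaf.stalkSpecializes h).hom
      ((X.presheaf.germ U y hy).hom b) = (X.presheaf.germ U x hx).hom b := fun b => by
    rw [← CommRingCat.comp_apply, X.presheaf.germ_stalkSpecializes]
  rw [injective_iff_map_eq_zero]
  intro z hz
  obtain ⟨⟨b, u⟩, e⟩ := IsLocalization.surj (pointIdeal U y hy).primeCompl z
  have e' : z * (X.presheaf.germ U y hy).hom u.1 = (X.presheaf.germ U y hy).hom b := e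
  have h1 := congrArg (X.presheaf.stalkSpecializes h).hom e'
  rw [map_mul, hz, zero_mul, hcomp] at h1
  obtain ⟨w, hw⟩ := (IsLocalization.map_eq_zero_iff (pointIdeal U x hx).primeCompl
    (X.presheaf.stalk x) b).1 h1.symm
  have h2 := congrArg (X.presheaf.germ U y hy).hom hw
  rw [map_mul, map_zero] at h2
  have hu : IsUnit ((X.presheaf.germ U y hy).hom u.1) := notMem_pointIdeal.1 u.2
  rcases mul_eq_zero.1 h2 with h3 | h3
  · have h4 := congrArg (X.presheaf.stalkSpecializes h).hom h3
    rw [hcomp, map_zero] at h4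
    exact absurd h4 (notMem_pointIdeal.1 w.2).ne_zero
  · rw [h3] at e'
    exact (mul_eq_zero.1 e').resolve_right hu.ne_zero

theorem isDiscreteValuationRing_stalk [IsRegularScheme X] {x : X} (hx : Order.coheight x = 1) :
    IsDiscreteValuationRing (X.presheaf.stalk x) :=
  isDiscreteValuationRing_of_dim_one (by
    rw [ringKrullDim_stalk_eq_coheight, hx]
    rfl)

/-- For a fraction `s = b / a`, the condition can be tested on one power of a uniformizer. The
positive and negative parts of `d` enter through different ideals, of which at most one is proper.
-/
theorem ordGE_iff [IsRegularScheme X] {ξ x : X} (h : ξ ⤳ x) (hx : Order.coheight x = 1) (d : ℤ)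
    {s : X.presheaf.stalk ξ} {a b : X.presheaf.stalk x} {i j : ℕ} (ha : HasOrd a i)
    (hb : HasOrd b j)
    (e : (X.presheaf.stalkSpecializes h).hom a * s = (X.presheaf.stalkSpecializes h).hom b) :
    OrdGE h d s ↔ (i : ℤ) ≤ j + d := by
  have := isDiscreteValuationRing_stalk hx
  have hinj := stalkSpecializes_injective h
  have ha0 : (X.presheaf.stalkSpecializes h).hom a ≠ 0 := fun h0 =>
    ha.ne_zero (hinj (h0.trans (map_zero _).symm))
  constructor
  · intro hs
    obtain ⟨t, ht⟩ := IsDiscreteValuationRing.exists_irreducible (X.presheaf.stalk x)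
    have ht1 : HasOrd t 1 := by
      rw [HasOrd, pow_one]
      exact ht.maximalIdeal_eq.symm
    have htd : HasOrd (t ^ d.toNat) d.toNat := by simpa using ht1.pow d.toNat
    obtain ⟨c, hc, hcs⟩ := hs (t ^ d.toNat) (htd.mem_pow_iff.2 le_rfl)
    have e2 : a * c = b * t ^ d.toNat := by
      apply hinj
      rw [map_mul, map_mul, ← hcs, ← e]
      ring
    have hbt := hb.mul htd
    have hc0 : c ≠ 0 := by
      rintro rfl
      rw [mul_zero] at e2
      exact hbt.ne_zero e2.symm
    obtain ⟨l, hl⟩ := exists_hasOrd hc0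
    have h1 := hl.mem_pow_iff.1 hc
    have h2 := (ha.mul hl).unique (e2 ▸ hbt)
    omega
  · intro hij a' ha'
    rcases eq_or_ne a' 0 with rfl | ha'0
    · exact ⟨0, Ideal.zero_mem _, by rw [map_zero, zero_mul]⟩
    obtain ⟨l, hl⟩ := exists_hasOrd ha'0
    have h1 := hl.mem_pow_iff.1 ha'
    obtain ⟨b', hb'⟩ := (ha.dvd_iff (hb.mul hl)).2 (by omega)
    have hb'0 : b' ≠ 0 := by
      rintro rfl
      rw [mul_zero] at hb'
      exact (hb.mul hl).ne_zero hb'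
    obtain ⟨l', hl'⟩ := exists_hasOrd hb'0
    have h2 := (ha.mul hl').unique (hb' ▸ hb.mul hl)
    refine ⟨b', hl'.mem_pow_iff.2 (by omega), ?_⟩
    apply mul_left_cancel₀ ha0
    rw [← map_mul, ← hb', map_mul, ← e]
    ring

end Points

end TameCover

namespace TameCover
open IsLocalRing Pointwise

set_option linter.unusedSectionVars false
set_option linter.overlappingInstances false

/-! ### The ring extension attached to an affine open subscheme of the base of a cover -/

section CoverRing

variable {X Y : Scheme.{u}} {π : X ⟶ Y} {G : Type v} [CommGroup G]

theorem pullbackFun_one (ρ : G →* Aut (Over.mk π)) (V : Y.Opens) (b : Γ(X, π ⁻¹ᵁ V)) :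
    pullbackFun ρ 1 V b = b := by
  simp only [pullbackFun, act_one]
  have : (𝟙 X : X ⟶ X).appLE (π ⁻¹ᵁ V) (π ⁻¹ᵁ V) le_rfl = 𝟙 _ := by
    simp only [Scheme.Hom.appLE, Scheme.Hom.id_app]
    exact (Category.id_comp _).trans (X.presheaf.map_id _)
  rw [this]
  rfl

theorem pullbackFun_mul (ρ : G →* Aut (Over.mk π)) (g h : G) (V : Y.Opens)
    (b : Γ(X, π ⁻¹ᵁ V)) : pullbackFun ρ (g * h) V b = pullbackFun ρ h V (pullbackFun ρ g V b) := by
  simp only [pullbackFun, act_mul]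
  rw [← CommRingCat.comp_apply, Scheme.Hom.appLE_comp_appLE]

theorem germ_pullbackFun (ρ : G →* Aut (Over.mk π)) (g : G) (V : Y.Opens) (x : X)
    (hx : x ∈ π ⁻¹ᵁ V) (hgx : act ρ g x ∈ π ⁻¹ᵁ V) (b : Γ(X, π ⁻¹ᵁ V)) :
    (X.presheaf.germ (π ⁻¹ᵁ V) x hx).hom (pullbackFun ρ g V b) =
      ((act ρ g).stalkMap x).hom ((X.presheaf.germ (π ⁻¹ᵁ V) (act ρ g x) hgx).hom b) := by
  rw [Scheme.Hom.germ_stalkMap_apply (act ρ g) (π ⁻¹ᵁ V) x hgx b]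
  simp only [pullbackFun, Scheme.Hom.appLE]
  rw [CommRingCat.comp_apply, ← CommRingCat.comp_apply, X.presheaf.germ_res]

theorem act_mem_preimage (ρ : G →* Aut (Over.mk π)) (g : G) {V : Y.Opens} {x : X}
    (hx : x ∈ π ⁻¹ᵁ V) : act ρ g x ∈ π ⁻¹ᵁ V := by
  change π (act ρ g x) ∈ V
  rwa [← Scheme.Hom.comp_apply, act_comp]

theorem pullbackFun_app (ρ : G →* Aut (Over.mk π)) (g : G) (V : Y.Opens) (a : Γ(Y, V)) :
    pullbackFun ρ g V ((π.app V).hom a) = (π.app V).hom a := by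
  apply TopCat.Presheaf.section_ext X.sheaf
  intro x hx
  refine (germ_pullbackFun ρ g V x hx (act_mem_preimage ρ g hx) _).trans ?_
  refine (Scheme.Hom.germ_stalkMap_apply (act ρ g) (π ⁻¹ᵁ V) x (act_mem_preimage ρ g hx)
    ((π.app V).hom a)).trans ?_
  have := germ_app_congr (act_comp ρ g) V x (by rw [act_comp]; exact hx) hx a
  rw [Scheme.Hom.comp_app] at this
  exact this

variable {R : Type u} [CommRing R]

/-- The functions on `V`, as an algebra over `R`. -/
def BaseRing (_f : Y ⟶ Spec (CommRingCat.of R)) (V : Y.Opens) : Type u := Γ(Y, V)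

/-- The functions on `π⁻¹V`, as an algebra with an action of `G`. -/
def CoverRing (_f : Y ⟶ Spec (CommRingCat.of R)) (_ρ : G →* Aut (Over.mk π)) (V : Y.Opens) :
    Type u := Γ(X, π ⁻¹ᵁ V)

variable (f : Y ⟶ Spec (CommRingCat.of R)) (ρ : G →* Aut (Over.mk π)) (V : Y.Opens)

noncomputable instance : CommRing (BaseRing f V) := inferInstanceAs (CommRing Γ(Y, V))

noncomputable instance : CommRing (CoverRing f ρ V) := inferInstanceAs (CommRing Γ(X, π ⁻¹ᵁ V))

noncomputable instance : Algebra R (BaseRing f V) := (scalar f V).toAlgebra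

noncomputable instance : Algebra (BaseRing f V) (CoverRing f ρ V) := (π.app V).hom.toAlgebra

noncomputable instance : Algebra R (CoverRing f ρ V) :=
  ((π.app V).hom.comp (scalar f V)).toAlgebra

instance : IsScalarTower R (BaseRing f V) (CoverRing f ρ V) := IsScalarTower.of_algebraMap_eq' rfl

noncomputable instance : MulSemiringAction G (CoverRing f ρ V) where
  smul g b := pullbackFun ρ g V b
  one_smul b := pullbackFun_one ρ V b
  -- Pullback of functions is a right action; commutativity of `G` makes it a left action.
  mul_smul g h b := by
    exact (congrArg (fun k => pullbackFun ρ k V b) (mul_comm g h)).trans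
      (pullbackFun_mul ρ h g V b)
  smul_zero g := map_zero (pullbackFun ρ g V)
  smul_add g := map_add (pullbackFun ρ g V)
  smul_one g := map_one (pullbackFun ρ g V)
  smul_mul g := map_mul (pullbackFun ρ g V)

instance : SMulCommClass G (BaseRing f V) (CoverRing f ρ V) where
  smul_comm g a b := by
    rw [Algebra.smul_def, Algebra.smul_def, smul_mul']
    congr 1
    exact pullbackFun_app ρ g V a

instance : SMulCommClass G R (CoverRing f ρ V) where
  smul_comm g r b := by
    rw [← algebraMap_smul (BaseRing f V) r b, smul_comm, algebraMap_smul]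

variable {f ρ V}

theorem isInvariant_coverRing (h : IsGCover ρ) :
    Algebra.IsInvariant (BaseRing f V) (CoverRing f ρ V) G where
  isInvariant b hb := h.invariant V b hb

theorem faithfulSMul_coverRing (h : IsGCover ρ) :
    FaithfulSMul (BaseRing f V) (CoverRing f ρ V) :=
  (faithfulSMul_iff_algebraMap_injective _ _).2 (h.injective V)

theorem finite_coverRing (h : IsGCover ρ) (hV : IsAffineOpen V) :
    Module.Finite (BaseRing f V) (CoverRing f ρ V) := by
  have := h.finite
  exact IsFinite.finite_app π V hV

theorem isAffineOpen_preimage (h : IsGCover ρ) (hV : IsAffineOpen V) : IsAffineOpen (π ⁻¹ᵁ V) := by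
  have := h.finite
  exact hV.preimage π

/-- The prime ideal of `CoverRing f ρ V` attached to a point of `π⁻¹V`. -/
noncomputable def coverIdeal (f : Y ⟶ Spec (CommRingCat.of R)) (ρ : G →* Aut (Over.mk π))
    (V : Y.Opens) (x : X) (hx : x ∈ π ⁻¹ᵁ V) : Ideal (CoverRing f ρ V) :=
  pointIdeal (π ⁻¹ᵁ V) x hx

/-- The prime ideal of `BaseRing f V` attached to a point of `V`. -/
noncomputable def baseIdeal (f : Y ⟶ Spec (CommRingCat.of R)) (V : Y.Opens) (y : Y) (hy : y ∈ V) :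
    Ideal (BaseRing f V) :=
  pointIdeal V y hy

instance (x : X) (hx : x ∈ π ⁻¹ᵁ V) : (coverIdeal f ρ V x hx).IsPrime :=
  inferInstanceAs (pointIdeal (π ⁻¹ᵁ V) x hx).IsPrime

instance (y : Y) (hy : y ∈ V) : (baseIdeal f V y hy).IsPrime :=
  inferInstanceAs (pointIdeal V y hy).IsPrime

/-- The germ at `x` of an element of `CoverRing f ρ V`. -/
noncomputable def coverGerm (f : Y ⟶ Spec (CommRingCat.of R)) (ρ : G →* Aut (Over.mk π))
    (V : Y.Opens) (x : X) (hx : x ∈ π ⁻¹ᵁ V) : CoverRing f ρ V →+* X.presheaf.stalk x :=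
  (X.presheaf.germ (π ⁻¹ᵁ V) x hx).hom

/-- The germ at `y` of an element of `BaseRing f V`. -/
noncomputable def baseGerm (f : Y ⟶ Spec (CommRingCat.of R)) (V : Y.Opens) (y : Y) (hy : y ∈ V) :
    BaseRing f V →+* Y.presheaf.stalk y :=
  (Y.presheaf.germ V y hy).hom

theorem coverGerm_smul (g : G) {x : X} (hx : x ∈ π ⁻¹ᵁ V) (b : CoverRing f ρ V) :
    coverGerm f ρ V x hx (g • b) =
      ((act ρ g).stalkMap x).hom (coverGerm f ρ V (act ρ g x) (act_mem_preimage ρ g hx) b) :=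
  germ_pullbackFun ρ g V x hx (act_mem_preimage ρ g hx) b

theorem coverGerm_algebraMap {x : X} (hx : x ∈ π ⁻¹ᵁ V) (hy : π x ∈ V) (a : BaseRing f V) :
    coverGerm f ρ V x hx (algebraMap (BaseRing f V) (CoverRing f ρ V) a) =
      (π.stalkMap x).hom (baseGerm f V (π x) hy a) :=
  (Scheme.Hom.germ_stalkMap_apply π V x hx a).symm

theorem notMem_coverIdeal {x : X} {hx : x ∈ π ⁻¹ᵁ V} {b : CoverRing f ρ V} :
    b ∉ coverIdeal f ρ V x hx ↔ IsUnit (coverGerm f ρ V x hx b) :=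
  notMem_pointIdeal

theorem notMem_baseIdeal {y : Y} {hy : y ∈ V} {a : BaseRing f V} :
    a ∉ baseIdeal f V y hy ↔ IsUnit (baseGerm f V y hy a) :=
  notMem_pointIdeal

theorem coverIdeal_act (g : G) {x : X} (hx : x ∈ π ⁻¹ᵁ V) :
    coverIdeal f ρ V (act ρ g x) (act_mem_preimage ρ g hx) = g⁻¹ • coverIdeal f ρ V x hx := by
  ext b
  rw [Ideal.mem_inv_pointwise_smul_iff, ← not_iff_not, notMem_coverIdeal, notMem_coverIdeal,
    coverGerm_smul]
  exact (isUnit_map_iff ((act ρ g).stalkMap x).hom _).symm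

theorem under_coverIdeal {x : X} (hx : x ∈ π ⁻¹ᵁ V) (hy : π x ∈ V) :
    (coverIdeal f ρ V x hx).under (BaseRing f V) = baseIdeal f V (π x) hy := by
  ext a
  rw [Ideal.under_def, Ideal.mem_comap, ← not_iff_not, notMem_coverIdeal, notMem_baseIdeal,
    coverGerm_algebraMap hx hy, isUnit_map_iff]

/-- The canonical morphism from the residue field factors through the affine preimage, so fixing it
means fixing the ring map to the residue field. -/
theorem inertia_eq (hV : IsAffineOpen (π ⁻¹ᵁ V)) {x : X} (hx : x ∈ π ⁻¹ᵁ V) :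
    inertia ρ x = (coverIdeal f ρ V x hx).inertia G := by
  ext g
  change X.fromSpecResidueField x ≫ act ρ g = X.fromSpecResidueField x ↔
    ∀ b : Γ(X, π ⁻¹ᵁ V), pullbackFun ρ g V b - b ∈ pointIdeal (π ⁻¹ᵁ V) x hx
  have h1 : X.fromSpecResidueField x =
      Spec.map (X.presheaf.germ (π ⁻¹ᵁ V) x hx ≫ X.residue x) ≫ hV.fromSpec := by
    rw [Scheme.fromSpecResidueField, ← hV.fromSpecStalk_eq_fromSpecStalk hx,
      IsAffineOpen.fromSpecStalk, Spec.map_comp, Category.assoc]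
  have h2 := hV.SpecMap_appLE_fromSpec (act ρ g) hV
    (by rw [← Scheme.Hom.comp_preimage, act_comp])
  rw [h1, Category.assoc, ← h2, ← Category.assoc, cancel_mono, ← Spec.map_comp, Spec.map_inj]
  constructor
  · intro h b
    have := congrArg (fun k => k.hom b) h
    rw [mem_pointIdeal, map_sub]
    exact (Ideal.Quotient.eq).1 this
  · intro h
    ext b
    have := h b
    rw [mem_pointIdeal, map_sub] at this
    exact (Ideal.Quotient.eq).2 this

theorem inertiaAct_coverGerm {x : X} (hx : x ∈ π ⁻¹ᵁ V) (g : inertia ρ x) (b : CoverRing f ρ V) :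
    inertiaAct ρ x g (coverGerm f ρ V x hx b) = coverGerm f ρ V x hx (g.1 • b) := by
  rw [coverGerm_smul, inertiaAct, CommRingCat.hom_comp, RingHom.comp_apply]
  congr 1
  exact congrArg (fun k => k.hom b) (X.presheaf.germ_stalkSpecializes (U := π ⁻¹ᵁ V) hx
    (specializes_of_eq (act_apply_of_mem_inertia ρ g.2)))

/-- An inertia element `g` sends `(g, x)` and `(1, x)` to the same point of the fibre product. The
torsor map is injective over `U`, and the copies of `X` in the source are disjoint. -/
theorem inertia_eq_bot_of_isTorsorOver [Finite G] {U : Y.Opens} (h : IsTorsorOver ρ U) {x : X}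
    (hx : π x ∈ U) : inertia ρ x = ⊥ := by
  rw [Subgroup.eq_bot_iff_forall]
  intro g hg
  have hg' : X.fromSpecResidueField x ≫ act ρ g = X.fromSpecResidueField x := hg
  let T := torsorMap ρ
  let W := (pullback.fst π π ≫ π) ⁻¹ᵁ U
  have hiso : IsIso (T ∣_ W) := h.isIso
  have hT : ∀ k : G, Sigma.ι (fun _ : G => X) k ≫ T =
      pullback.lift (𝟙 X) (act ρ k) (by rw [Category.id_comp, act_comp]) := fun k => by
    simp only [T, torsorMap, Sigma.ι_desc]
  have h1 : X.fromSpecResidueField x ≫ Sigma.ι (fun _ : G => X) g ≫ T =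
      X.fromSpecResidueField x ≫ Sigma.ι (fun _ : G => X) 1 ≫ T := by
    rw [hT, hT]
    apply pullback.hom_ext
    · rw [Category.assoc, Category.assoc, pullback.lift_fst, pullback.lift_fst]
    · rw [Category.assoc, Category.assoc, pullback.lift_snd, pullback.lift_snd, hg', act_one,
        Category.comp_id]
  let z : Spec (X.residueField x) := IsLocalRing.closedPoint (X.residueField x)
  have hz : X.fromSpecResidueField x z = x :=
    Scheme.fromSpecResidueField_apply x z
  have h2 := congrArg (fun k : Spec (X.residueField x) ⟶ _ => k z) h1
  simp only [Scheme.Hom.comp_apply, hz] at h2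
  have hmem : ∀ k : G, Sigma.ι (fun _ : G => X) k x ∈ T ⁻¹ᵁ W := fun k => by
    change π (pullback.fst π π (T (Sigma.ι (fun _ : G => X) k x))) ∈ U
    have := congrArg (fun l => l x) (congrArg (fun l => l ≫ pullback.fst π π) (hT k))
    simp only [pullback.lift_fst, Scheme.Hom.comp_apply] at this
    rw [this]
    exact hx
  have hinj : Function.Injective (T ∣_ W) := (T ∣_ W).isOpenEmbedding.injective
  have h3 : (⟨_, hmem g⟩ : T ⁻¹ᵁ W) = ⟨_, hmem 1⟩ := by
    apply hinj
    apply Subtype.ext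
    exact (morphismRestrict_base_coe T W ⟨_, hmem g⟩).trans
      (h2.trans (morphismRestrict_base_coe T W ⟨_, hmem 1⟩).symm)
  have h4 := congrArg Subtype.val h3
  exact congrArg Sigma.fst ((sigmaι_eq_iff (fun _ : G => X) g 1 x x).1 h4)

end CoverRing

end TameCover

/-! ### Local generators of eigenspaces with prescribed poles -/

namespace TameCover
open IsLocalRing Pointwise

set_option linter.unusedSectionVars false
set_option linter.overlappingInstances false

section Cover

variable {R A B : Type u} [CommRing R] [IsDomain R] [CommRing A] [CommRing B]
  [Algebra R A] [Algebra R B] [Algebra A B] [IsScalarTower R A B]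
  {G : Type v} [CommGroup G] [Finite G] [IsTameGroup R G]
  [MulSemiringAction G B] [SMulCommClass G A B] [SMulCommClass G R B]
  [IsDomain A] [IsRegularRing A] [IsRegularRing B] [Module.Finite A B]
  [FaithfulSMul A B] [Algebra.IsInvariant A B G]

/-- `m P` is the least integer `≥ -d P` that is congruent to the orders at `P` of the rational
functions on which `G` acts through `φ`. -/
structure IsLeastEigenOrder (A : Type u) {B : Type u} [CommRing A] [CommRing B] [Algebra R A]
    [Algebra R B] [Algebra A B] [IsScalarTower R A B] [MulSemiringAction G B] [SMulCommClass G A B]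
    [SMulCommClass G R B] (φ : G →* Rˣ) (d m : Ideal B → ℤ) : Prop where
  zero : ∀ (P : Ideal B) [P.IsPrime], P.height = 1 → P.inertia G = ⊥ → m P = 0
  smul : ∀ (P : Ideal B) [P.IsPrime], P.height = 1 → ∀ g : G, m (g • P) = m P
  char : ∀ (P : Ideal B) [P.IsPrime], P.height = 1 → ∀ (χ : G →* Rˣ), ∀ t ∈ eigen A χ (B := B),
    HasOrdAt P t 1 → ∀ g ∈ P.inertia G, φ g = χ g ^ m P
  le : ∀ (P : Ideal B) [P.IsPrime], P.height = 1 → -d P ≤ m P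
  min : ∀ (P : Ideal B) [P.IsPrime], P.height = 1 → ∀ k : ℤ, -d P ≤ k →
    (∀ (χ : G →* Rˣ), ∀ t ∈ eigen A χ (B := B), HasOrdAt P t 1 →
      ∀ g ∈ P.inertia G, φ g = χ g ^ k) → m P ≤ k

/-- The denominator is invariant, so its order contributes the trivial character; the order of the
quotient is then an admissible exponent. -/
theorem IsLeastEigenOrder.le_of_hasOrdAt {φ : G →* Rˣ} {d m : Ideal B → ℤ}
    (hm : IsLeastEigenOrder A φ d m) {P : Ideal B} [P.IsPrime] (hP : P.height = 1) {b : B}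
    (hb : b ∈ eigen A φ) {a : A} {i j : ℕ} (hi : HasOrdAt P b i)
    (hj : HasOrdAt P (algebraMap A B a) j) (hd : -d P ≤ (i : ℤ) - j) : m P ≤ (i : ℤ) - j := by
  refine hm.min P hP _ hd fun χ t ht ht1 g hg => ?_
  have h1 := char_eq_pow_of_hasOrdAt hP ht hb ht1 hi hg
  have h2 := char_eq_pow_of_hasOrdAt hP ht
    ((mem_eigen_one_iff (R := R) (G := G)).2 ⟨a, rfl⟩) ht1 hj hg
  rw [MonoidHom.one_apply] at h2
  rw [zpow_sub, zpow_natCast, zpow_natCast, ← h1, ← h2, inv_one, mul_one]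

/-- Only finitely many prime divisors contain `c`, so one bound serves all of them. It is used to
choose the power of a denominator that clears every unwanted pole. -/
theorem exists_forall_le_ord_add {a b c : B} (ha : a ∈ nonZeroDivisors B)
    (hb : b ∈ nonZeroDivisors B) (hc : c ∈ nonZeroDivisors B) (w : Ideal B → ℤ) :
    ∃ N : ℕ, ∀ (P : Ideal B) [P.IsPrime], P.height = 1 → c ∈ P → ∀ i j : ℕ, HasOrdAt P b i →
      HasOrdAt P a j → w P ≤ (i : ℤ) - j + N := by
  have h : ∀ P : Ideal B, ∃ N : ℕ, ∀ [P.IsPrime], P.height = 1 → ∀ i j : ℕ, HasOrdAt P b i →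
      HasOrdAt P a j → w P ≤ (i : ℤ) - j + N := by
    intro P
    by_cases hP : P.IsPrime ∧ P.height = 1
    · obtain ⟨hP, hP1⟩ := hP
      obtain ⟨i, hi⟩ := exists_hasOrdAt hP1 hb
      obtain ⟨j, hj⟩ := exists_hasOrdAt hP1 ha
      refine ⟨(w P - ((i : ℤ) - j)).toNat, fun _ i' j' hi' hj' => ?_⟩
      rw [← hi.unique hP1 hi', ← hj.unique hP1 hj']
      omega
    · exact ⟨0, fun h => absurd ⟨inferInstance, h⟩ hP⟩
  choose N hN using h
  obtain ⟨M, hM⟩ := ((finite_setOf_height_one_mem hc).image N).bddAbove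
  refine ⟨M, fun P hP hP1 hcP i j hi hj => ?_⟩
  have h1 := hN P hP1 i j hi hj
  have h2 : N P ≤ M := hM ⟨P, ⟨hP, hP1, hcP⟩, rfl⟩
  omega

/-- The fraction `β₀ / α₀` has the minimal admissible orders near `p`, and its `n`-th power is `γ₀ /
α₀ ^ n` over `A`. Comparing any other admissible fraction with it gives an invariant fraction with
no poles in codimension one near `p`, and so a coefficient in `A` after multiplication by a power of
`r`. The relation on `E` transfers orders between the two rings, and everything is stated with
cleared denominators. -/
theorem exists_local_generator [Nontrivial B] (hfree : GenericallyFree B G) (φ : G →* Rˣ) {n : ℕ}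
    (hn0 : n ≠ 0) (hn : ∀ g : G, g ^ n = 1) {d m : Ideal B → ℤ} (hm : IsLeastEigenOrder A φ d m)
    {E : Ideal A → ℤ} (hE : ∀ (P : Ideal B) [P.IsPrime], P.height = 1 →
      (Nat.card (P.inertia G) : ℤ) * E (P.under A) = -(n * m P))
    (p : Ideal A) [p.IsPrime] :
    ∃ β₀ ∈ eigen A φ (B := B), ∃ γ₀ α₀ : A, γ₀ ≠ 0 ∧ α₀ ≠ 0 ∧ algebraMap A B γ₀ = β₀ ^ n ∧
      (∀ (P : Ideal B) [P.IsPrime], P.height = 1 → ∃ i j : ℕ, HasOrdAt P β₀ i ∧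
        HasOrdAt P (algebraMap A B α₀) j ∧ -d P ≤ (i : ℤ) - j) ∧
      (∀ (q : Ideal A) [q.IsPrime], q.height = 1 → ∃ i j : ℕ, HasOrdAt q γ₀ i ∧
        HasOrdAt q (α₀ ^ n) j ∧ -E q ≤ (i : ℤ) - j) ∧
      (∀ β ∈ eigen A φ (B := B), ∀ α : A, α ≠ 0 →
        (∀ (P : Ideal B) [P.IsPrime], P.height = 1 → ∃ i j : ℕ, HasOrdAt P β i ∧
          HasOrdAt P (algebraMap A B α) j ∧ -d P ≤ (i : ℤ) - j) →
        ∃ r ∉ p, ∃ c : A, algebraMap A B (r * α₀) * β = algebraMap A B (c * α) * β₀) ∧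
      (∀ γ α : A, α ≠ 0 → (∀ (q : Ideal A) [q.IsPrime], q.height = 1 → ∃ i j : ℕ,
          HasOrdAt q γ i ∧ HasOrdAt q α j ∧ -E q ≤ (i : ℤ) - j) →
        ∃ r ∉ p, ∃ c : A, r * α₀ ^ n * γ = c * α * γ₀) := by
  obtain ⟨r, hr, b, hb, α₀, hb0, hα₀, hba⟩ :=
    exists_eigen_forall_hasOrdAt hfree φ m hm.zero hm.smul hm.char p
  have hr0 : r ≠ 0 := fun h => hr (h ▸ p.zero_mem)
  have hnzd : ∀ {a : A}, a ≠ 0 → algebraMap A B a ∈ nonZeroDivisors B :=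
    fun h => algebraMap_mem_nonZeroDivisors A B G h
  have hinj := FaithfulSMul.algebraMap_injective A B
  have hbn := eigen_mem_nonZeroDivisors hb hb0
  -- Orders are exact only at divisors not containing `r`. The factor `r ^ k` raises them to at
  -- least the required value at the remaining ones.
  obtain ⟨k, hk⟩ := exists_forall_le_ord_add (hnzd hα₀) hbn (hnzd hr0) m
  set β₀ : B := algebraMap A B (r ^ k) * b with hβ₀
  have hβ₀n : β₀ ∈ nonZeroDivisors B := mul_mem (hnzd (pow_ne_zero _ hr0)) hbn
  have hβ₀φ : β₀ ∈ eigen A φ := by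
    rw [hβ₀, ← Algebra.smul_def]
    exact Submodule.smul_mem _ _ hb
  have hφn : φ ^ n = 1 := by
    ext g
    rw [MonoidHom.pow_apply, ← map_pow, hn, map_one, MonoidHom.one_apply]
  obtain ⟨γ₀, hγ₀⟩ : β₀ ^ n ∈ Set.range (algebraMap A B) := by
    rw [← mem_eigen_one_iff (R := R) (G := G), ← hφn]
    exact pow_mem_eigen hβ₀φ n
  have hγ₀0 : γ₀ ≠ 0 := by
    rintro rfl
    rw [map_zero] at hγ₀
    exact zero_notMem_nonZeroDivisors (hγ₀ ▸ pow_mem hβ₀n n)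
  have hle : ∀ (P : Ideal B) [P.IsPrime], P.height = 1 → ∃ i j : ℕ, HasOrdAt P β₀ i ∧
      HasOrdAt P (algebraMap A B α₀) j ∧ m P ≤ (i : ℤ) - j ∧
      (algebraMap A B r ∉ P → (i : ℤ) - j = m P) := by
    intro P _ hP
    by_cases hrP : algebraMap A B r ∈ P
    · obtain ⟨i, hi⟩ := exists_hasOrdAt hP hbn
      obtain ⟨j, hj⟩ := exists_hasOrdAt hP (hnzd hα₀)
      obtain ⟨l, hl⟩ := exists_hasOrdAt hP (hnzd hr0)
      have hl0 : l ≠ 0 := by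
        rintro rfl
        exact hasOrdAt_zero_iff.1 hl hrP
      refine ⟨l * k + i, j, ?_, hj, ?_, fun h => absurd hrP h⟩
      · rw [hβ₀, map_pow]
        exact (hl.pow k).mul hi
      · have h1 := hk P hP hrP i j hi hj
        have h2 : k ≤ l * k := Nat.le_mul_of_pos_left k (Nat.pos_of_ne_zero hl0)
        omega
    · obtain ⟨i, j, hi, hj, e⟩ := hba P hP hrP
      refine ⟨i, j, hi.mul_notMem ?_, hj, e.ge, fun _ => e⟩
      rw [map_pow]
      exact fun h => hrP (Ideal.IsPrime.mem_of_pow_mem ‹_› _ h)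
  -- For ramified `P` the index is the order of inertia. For trivial inertia the index need not be
  -- identified, as both sides of the relation vanish.
  have hunder : ∀ (P : Ideal B) [P.IsPrime], P.height = 1 → ∃ ε : ℕ, ε ≠ 0 ∧
      (ε : ℤ) * E (P.under A) = -(n * m P) ∧ ∀ (a : A) (k : ℕ), HasOrdAt P (algebraMap A B a) k →
        ∃ j, k = ε * j ∧ HasOrdAt (P.under A) a j := by
    intro P _ hP
    by_cases hI : P.inertia G = ⊥
    · obtain ⟨ε, hε, -, -, h⟩ := exists_ramificationIdx A G hP
      refine ⟨ε, hε, ?_, h⟩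
      have := hE P hP
      rw [hm.zero P hP hI, hI, Subgroup.card_bot, Nat.cast_one, one_mul] at this
      rw [hm.zero P hP hI, this]
      ring
    · obtain ⟨χ, t, ht, ht1, -⟩ := exists_eigen_hasOrdAt_one R hfree (P.under A) hP le_rfl hI
      exact ⟨Nat.card (P.inertia G), Nat.card_pos.ne', hE P hP,
        fun a k ha => exists_hasOrdAt_under hfree hP ht ht1 ha⟩
  refine ⟨β₀, hβ₀φ, γ₀, α₀, hγ₀0, hα₀, hγ₀, ?_, ?_, ?_, ?_⟩
  · intro P _ hP
    obtain ⟨i, j, hi, hj, h, -⟩ := hle P hP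
    exact ⟨i, j, hi, hj, (hm.le P hP).trans h⟩
  · intro q _ hq
    have := Algebra.IsInvariant.isIntegral A B G
    obtain ⟨P, -, hP, rfl⟩ := Ideal.exists_ideal_over_prime_of_isIntegral q (⊥ : Ideal B)
      (by
        rw [← RingHom.ker_eq_comap_bot, (RingHom.injective_iff_ker_eq_bot _).1 hinj]
        exact bot_le)
    have hP1 : P.height = 1 := (height_under_eq_of_isInvariant A B G P).symm.trans hq
    obtain ⟨i, j, hi, hj, h, -⟩ := hle P hP1
    obtain ⟨ε, hε, hεE, hε'⟩ := hunder P hP1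
    have hi' := hi.pow n
    have hj' := hj.pow n
    rw [← hγ₀] at hi'
    rw [← map_pow] at hj'
    obtain ⟨i₁, hi₁, hi₂⟩ := hε' _ _ hi'
    obtain ⟨j₁, hj₁, hj₂⟩ := hε' _ _ hj'
    refine ⟨i₁, j₁, hi₂, hj₂, ?_⟩
    have hε0 : (0 : ℤ) < ε := by exact_mod_cast Nat.pos_of_ne_zero hε
    refine le_of_mul_le_mul_left ?_ hε0
    have h1 : (i : ℤ) * n = ε * i₁ := by exact_mod_cast hi₁
    have h2 : (j : ℤ) * n = ε * j₁ := by exact_mod_cast hj₁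
    have h3 := mul_le_mul_of_nonneg_left h (Nat.cast_nonneg (α := ℤ) n)
    linarith
  · intro β hβ α hα hord
    rcases eq_or_ne β 0 with rfl | hβ0
    · exact ⟨r, hr, 0, by simp⟩
    have hβn := eigen_mem_nonZeroDivisors hβ hβ0
    obtain ⟨N, hN⟩ := exists_forall_le_ord_add (mul_mem (hnzd hα) hβ₀n)
      (mul_mem hβn (hnzd hα₀)) (hnzd hr0) 0
    -- Multiplying numerator and denominator of `β / β₀` by `β₀ ^ (n - 1)` makes both invariant,
    -- since `φ ^ n = 1`. The test of divisibility then takes place in `A`.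
    obtain ⟨γ', hγ'⟩ : β * β₀ ^ (n - 1) ∈ Set.range (algebraMap A B) := by
      rw [← mem_eigen_one_iff (R := R) (G := G), ← hφn, ← mul_pow_sub_one hn0 φ]
      exact mul_mem_eigen hβ (pow_mem_eigen hβ₀φ (n - 1))
    obtain ⟨c, hc⟩ : γ₀ * α ∣ r ^ N * (γ' * α₀) := by
      refine dvd_of_forall_hasOrdAt (B := B) G (mul_ne_zero hγ₀0 hα) fun P _ hP => ?_
      obtain ⟨i₀, j₀, hi₀, hj₀, h₀, h₀'⟩ := hle P hP
      obtain ⟨i, j, hi, hj, h⟩ := hord P hP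
      obtain ⟨l, hl⟩ := exists_hasOrdAt hP (hnzd hr0)
      have h1 := hm.le_of_hasOrdAt hP hβ hi hj h
      refine ⟨i₀ * n + j, l * N + (i + i₀ * (n - 1) + j₀), ?_, ?_, Or.inr ?_⟩
      · have h2 : i₀ * n = i₀ * (n - 1) + i₀ := by
          rw [← Nat.mul_succ]
          congr 1
          omega
        by_cases hrP : algebraMap A B r ∈ P
        · have h3 := hN P hP hrP (i + j₀) (j + i₀) (hi.mul hj₀) (hj.mul hi₀)
          have h4 : N ≤ l * N := Nat.le_mul_of_pos_left N (Nat.pos_of_ne_zero fun h =>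
            hasOrdAt_zero_iff.1 (h ▸ hl) hrP)
          simp only [Pi.zero_apply] at h3
          omega
        · have := h₀' hrP
          omega
      · rw [map_mul, hγ₀]
        exact (hi₀.pow n).mul hj
      · rw [map_mul, map_mul, map_pow, hγ']
        exact (hl.pow N).mul ((hi.mul (hi₀.pow (n - 1))).mul hj₀)
    refine ⟨r ^ N, fun h => hr (Ideal.IsPrime.mem_of_pow_mem ‹_› _ h), c, ?_⟩
    have h1 := congrArg (algebraMap A B) hc
    have h2 : β₀ ^ n = β₀ ^ (n - 1) * β₀ := (pow_sub_one_mul hn0 β₀).symm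
    simp only [map_mul, hγ', hγ₀, h2] at h1
    refine (mul_cancel_left_mem_nonZeroDivisors (pow_mem hβ₀n (n - 1))).1 ?_
    rw [map_mul, map_mul]
    linear_combination h1
  · intro γ α hα hord
    rcases eq_or_ne γ 0 with rfl | hγ0
    · exact ⟨r, hr, 0, by simp⟩
    obtain ⟨N, hN⟩ := exists_forall_le_ord_add (mul_mem (hnzd hγ₀0) (hnzd hα))
      (mul_mem (hnzd hγ0) (pow_mem (hnzd hα₀) n)) (hnzd hr0) 0
    obtain ⟨c, hc⟩ : γ₀ * α ∣ r ^ N * (γ * α₀ ^ n) := by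
      refine dvd_of_forall_hasOrdAt (B := B) G (mul_ne_zero hγ₀0 hα) fun P _ hP => ?_
      obtain ⟨i₀, j₀, hi₀, hj₀, h₀, h₀'⟩ := hle P hP
      obtain ⟨ε, hε, hεE, hε'⟩ := hunder P hP
      have hq := (height_under_eq_of_isInvariant A B G P).trans hP
      obtain ⟨i₁, j₁, hi₁, hj₁, h⟩ := hord (P.under A) hq
      obtain ⟨i, hi⟩ := exists_hasOrdAt hP (hnzd hγ0)
      obtain ⟨j, hj⟩ := exists_hasOrdAt hP (hnzd hα)
      obtain ⟨i₂, rfl, hi₂⟩ := hε' γ i hi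
      obtain ⟨j₂, rfl, hj₂⟩ := hε' α j hj
      obtain rfl := hi₁.unique hq hi₂
      obtain rfl := hj₁.unique hq hj₂
      obtain ⟨l, hl⟩ := exists_hasOrdAt hP (hnzd hr0)
      have hi₀' := hi₀.pow n
      rw [← hγ₀] at hi₀'
      refine ⟨i₀ * n + ε * j₁, l * N + (ε * i₁ + j₀ * n), ?_, ?_, Or.inr ?_⟩
      · by_cases hrP : algebraMap A B r ∈ P
        · have h3 := hN P hP hrP _ _ (hi.mul (hj₀.pow n)) (hi₀'.mul hj)
          have h4 : N ≤ l * N := Nat.le_mul_of_pos_left N (Nat.pos_of_ne_zero fun h =>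
            hasOrdAt_zero_iff.1 (h ▸ hl) hrP)
          simp only [Pi.zero_apply] at h3
          omega
        · have h5 := h₀' hrP
          have h6 := mul_le_mul_of_nonneg_left h (Nat.cast_nonneg (α := ℤ) ε)
          have h7 : (n : ℤ) * m P = i₀ * n - j₀ * n := by rw [← h5]; ring
          zify
          nlinarith
      · rw [map_mul]
        exact hi₀'.mul hj
      · rw [map_mul, map_mul, map_pow, map_pow]
        exact (hl.pow N).mul (hi.mul (hj₀.pow n))
    refine ⟨r ^ N, fun h => hr (Ideal.IsPrime.mem_of_pow_mem ‹_› _ h), c, ?_⟩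
    linear_combination hc

end Cover

end TameCover

namespace TameCover
open IsLocalRing Pointwise

set_option linter.unusedSectionVars false
set_option linter.overlappingInstances false

/-! ### Irreducible components of regular affine schemes -/

theorem exists_isIdempotentElem_isPrime {A : Type u} [CommRing A] [IsRegularRing A] (p : Ideal A)
    [p.IsPrime] : ∃ e : A, IsIdempotentElem e ∧ e ∉ p ∧ (Ideal.span {1 - e}).IsPrime := by
  have := isReduced_of_isRegularRing A
  obtain ⟨η, hη, hηp⟩ := Ideal.exists_minimalPrimes_le (I := (⊥ : Ideal A)) (J := p) bot_le
  have hηP : η.IsPrime := hη.1.1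
  have hidem : IsIdempotentElem η := by
    -- Locally at `q` the ring is a domain, so a minimal prime becomes either zero or the unit
    -- ideal, and in both cases it is idempotent.
    refine le_antisymm Ideal.mul_le_left fun x hx => ?_
    refine mem_of_forall_exists_notMem _ x fun q hq => ?_
    have hqP := hq.isPrime
    by_cases hηq : η ≤ q
    · obtain ⟨u, hu, huk⟩ : ∃ u ∉ η, u * x = 0 := by
        have h1 : algebraMap A (Localization.AtPrime η) x ∈
            (Ideal.map (algebraMap A (Localization.AtPrime η)) ⊥).radical := by
          rw [IsLocalization.AtPrime.radical_map_of_mem_minimalPrimes _ η _ hη]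
          exact Ideal.mem_map_of_mem _ hx
        rw [Ideal.map_bot] at h1
        obtain ⟨k, hk⟩ := h1
        rw [Ideal.mem_bot, ← map_pow] at hk
        obtain ⟨u, hu⟩ := (IsLocalization.map_eq_zero_iff η.primeCompl _ _).1
          hk
        refine ⟨u.1, u.2, eq_zero_of_pow_eq_zero (n := k + 1) ?_⟩
        rw [mul_pow, pow_succ, pow_succ]
        linear_combination (u.1 ^ k * x) * hu
      have h1 := congrArg (algebraMap A (Localization.AtPrime q)) huk
      rw [map_mul, map_zero, mul_eq_zero] at h1
      rcases h1 with h1 | h1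
      · obtain ⟨r, hr⟩ := (IsLocalization.map_eq_zero_iff q.primeCompl _ _).1 h1
        exact absurd ((Ideal.IsPrime.mem_or_mem' (I := η) (hr ▸ η.zero_mem)).resolve_left
          fun h => r.2 (hηq h)) hu
      · obtain ⟨r, hr⟩ := (IsLocalization.map_eq_zero_iff q.primeCompl _ _).1 h1
        exact ⟨r.1, r.2, by rw [smul_eq_mul, hr]; exact Ideal.zero_mem _⟩
    · obtain ⟨r, hr, hrq⟩ := SetLike.not_le_iff_exists.1 hηq
      exact ⟨r, hrq, Ideal.mul_mem_mul hr hx⟩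
  obtain ⟨e, he, hηe⟩ := (Ideal.isIdempotentElem_iff_of_fg η (IsNoetherian.noetherian η)).1 hidem
  refine ⟨1 - e, he.one_sub, fun h => ?_, ?_⟩
  · have h1 : e ∈ p := hηp (hηe ▸ Ideal.mem_span_singleton_self e)
    exact (Ideal.ne_top_iff_one p).1 Ideal.IsPrime.ne_top' (by simpa using p.add_mem h h1)
  · rw [sub_sub_cancel, ← Ideal.submodule_span_eq, ← hηe]
    exact hηP

theorem surjective_of_isIdempotentElem {A S : Type*} [CommRing A] [CommRing S] [Algebra A S] {e : A}
    (he : IsIdempotentElem e) [IsLocalization.Away e S] :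
    Function.Surjective (algebraMap A S) := by
  intro z
  have h1 : algebraMap A S e = 1 := by
    have h2 := IsLocalization.Away.algebraMap_isUnit (S := S) e
    refine h2.mul_left_cancel ?_
    rw [← map_mul, he, mul_one]
  obtain ⟨k, a, h⟩ := IsLocalization.Away.surj e z
  exact ⟨a, by rw [← h, h1, one_pow, mul_one]⟩

theorem isDomain_away_of_isIdempotentElem {A S : Type*} [CommRing A] [CommRing S] [Algebra A S]
    {e : A} (he : IsIdempotentElem e) [IsLocalization.Away e S] (h : (Ideal.span {1 - e}).IsPrime) :
    IsDomain S := by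
  have h1 : ∀ a, algebraMap A S a = 0 ↔ a ∈ Ideal.span {1 - e} := by
    intro a
    rw [Ideal.mem_span_singleton]
    constructor
    · intro ha
      obtain ⟨⟨_, k, rfl⟩, hk⟩ := (IsLocalization.map_eq_zero_iff (.powers e) S a).1 ha
      replace hk : e ^ k * a = 0 := hk
      have h2 : e * a = 0 := by
        rcases Nat.eq_zero_or_pos k with rfl | hk0
        · simp only [pow_zero, one_mul] at hk
          rw [hk, mul_zero]
        · rwa [he.pow_eq hk0.ne'] at hk
      exact ⟨a, by linear_combination h2⟩
    · rintro ⟨c, rfl⟩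
      refine (IsLocalization.map_eq_zero_iff (.powers e) S _).2 ⟨⟨e, 1, pow_one e⟩, ?_⟩
      have : e * e = e := he
      linear_combination -c * this
  have hs := surjective_of_isIdempotentElem (S := S) he
  have : Nontrivial S := by
    rw [← not_subsingleton_iff_nontrivial]
    intro hsub
    exact h.ne_top ((Ideal.eq_top_iff_one _).2 ((h1 1).1 (Subsingleton.elim _ _)))
  have : NoZeroDivisors S := ⟨fun {x y} hxy => by
    obtain ⟨a, rfl⟩ := hs x
    obtain ⟨b, rfl⟩ := hs y
    rw [← map_mul, h1] at hxy
    rw [h1, h1]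
    exact h.mem_or_mem hxy⟩
  exact NoZeroDivisors.to_isDomain S

/-- `V` is an affine open subscheme with an integral coordinate ring. -/
class IsIntegralAffine {Y : Scheme.{u}} (V : Y.Opens) : Prop where
  isAffineOpen : IsAffineOpen V
  isDomain : IsDomain Γ(Y, V)

theorem exists_isIntegralAffine_basicOpen {Y : Scheme.{u}} [IsRegularScheme Y] {V : Y.Opens}
    (hV : IsAffineOpen V) (p : Ideal Γ(Y, V)) [p.IsPrime] :
    ∃ e : Γ(Y, V), IsIdempotentElem e ∧ e ∉ p ∧ IsIntegralAffine (Y.basicOpen e) := by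
  have := isRegularRing_of_isAffineOpen hV
  obtain ⟨e, he, hep, hprime⟩ := exists_isIdempotentElem_isPrime p
  have := hV.isLocalization_basicOpen e
  exact ⟨e, he, hep, hV.basicOpen e, isDomain_away_of_isIdempotentElem he hprime⟩

theorem exists_isIntegralAffine {Y : Scheme.{u}} [IsRegularScheme Y] (y : Y) :
    ∃ W : Y.Opens, y ∈ W ∧ IsIntegralAffine W := by
  obtain ⟨_, ⟨V, hV, rfl⟩, hy, -⟩ := Y.isBasis_affineOpens.exists_subset_of_mem_open
    (Set.mem_univ y) isOpen_univ
  obtain ⟨e, -, he, h⟩ := exists_isIntegralAffine_basicOpen hV (pointIdeal V y hy)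
  exact ⟨_, (Y.mem_basicOpen e y hy).2 (notMem_pointIdeal.1 he), h⟩

theorem germ_eq_zero_of_isIdempotentElem {Y : Scheme.{u}} {V : Y.Opens} {e : Γ(Y, V)}
    (he : IsIdempotentElem e) {y : Y} (hy : y ∈ V) (h : y ∉ Y.basicOpen e) :
    (Y.presheaf.germ V y hy).hom e = 0 := by
  rw [Y.mem_basicOpen e y hy] at h
  have h1 : (Y.presheaf.germ V y hy).hom e * (1 - (Y.presheaf.germ V y hy).hom e) = 0 := by
    rw [mul_sub, mul_one, ← map_mul, he, sub_self]
  have h2 : IsUnit (1 - (Y.presheaf.germ V y hy).hom e) :=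
    IsLocalRing.isUnit_one_sub_self_of_mem_nonunits _ h
  exact (h2.mul_left_eq_zero).1 h1

/-- The germ of an idempotent is zero or one, and zero persists under generization. The basic open
set is thus stable under specialization in `V`, which permits extension by zero. -/
theorem notMem_basicOpen_of_specializes {Y : Scheme.{u}} {V : Y.Opens} {e : Γ(Y, V)}
    (he : IsIdempotentElem e) {ξ y : Y} (hξy : ξ ⤳ y) (hy : y ∈ V) (h : y ∉ Y.basicOpen e) :
    ξ ∉ Y.basicOpen e := by
  have hξ : ξ ∈ V := hξy.mem_open V.2 hy
  have h1 : (Y.presheaf.stalkSpecializes hξy).hom ((Y.presheaf.germ V y hy).hom e) =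
      (Y.presheaf.germ V ξ hξ).hom e := by
    rw [← CommRingCat.comp_apply, Y.presheaf.germ_stalkSpecializes]
  rw [germ_eq_zero_of_isIdempotentElem he hy h, map_zero] at h1
  rw [Y.mem_basicOpen e ξ hξ]
  intro h2
  have h3 : IsUnit ((Y.presheaf.germ V ξ hξ).hom e) := h2
  rw [← h1] at h3
  exact not_isUnit_zero h3

section Integral

variable {Y : Scheme.{u}} [IsRegularScheme Y] {V : Y.Opens} [hV : IsIntegralAffine V]

theorem pointIdeal_eq_bot_of_mem_genericPoints {y : Y} (hy : y ∈ V) (h : y ∈ genericPoints Y) :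
    pointIdeal V y hy = ⊥ := by
  have := hV.isDomain
  rw [mem_genericPoints_iff_mem_minimalPrimes hV.isAffineOpen hy] at h
  simpa [IsDomain.minimalPrimes_eq_singleton_bot] using h

theorem specializes_of_mem_genericPoints {y z : Y} (hy : y ∈ V) (hz : z ∈ V)
    (h : y ∈ genericPoints Y) : y ⤳ z := by
  refine specializes_of_pointIdeal_le hV.isAffineOpen hy hz ?_
  rw [pointIdeal_eq_bot_of_mem_genericPoints hy h]
  exact bot_le

end Integral

/-- In an integral neighbourhood a generic point specializes to every point, in particular to one in
`U`, and open sets are stable under generization. -/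
theorem mem_of_mem_genericPoints_of_dense {Y : Scheme.{u}} [IsRegularScheme Y] {U : Y.Opens}
    (hU : Dense (U : Set Y)) {y : Y} (h : y ∈ genericPoints Y) : y ∈ U := by
  obtain ⟨W, hy, hW⟩ := exists_isIntegralAffine y
  obtain ⟨z, hzW, hzU⟩ := hU.inter_open_nonempty W W.2 ⟨y, hy⟩
  exact (specializes_of_mem_genericPoints hy hzW h).mem_open U.2 hzU

end TameCover

/-! ### Points, fibres and inertia of a generic torsor cover -/

namespace TameCover
open IsLocalRing Pointwise

set_option linter.unusedSectionVars false
set_option linter.overlappingInstances false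

section Cover

variable {X Y : Scheme.{u}} {π : X ⟶ Y} {G : Type v} [CommGroup G] [Finite G]

/-- `π` is a `G`-cover that is a `G`-torsor over a dense open subscheme. -/
class IsGenericTorsorCover (ρ : G →* Aut (Over.mk π)) : Prop where
  isGCover : IsGCover ρ
  exists_isTorsorOver : ∃ U : Y.Opens, Dense (U : Set Y) ∧ IsTorsorOver ρ U

variable {R : Type u} [CommRing R] [IsDomain R] [IsTameGroup R G]
  [IsRegularScheme X] [IsRegularScheme Y]
  {f : Y ⟶ Spec (CommRingCat.of R)} {ρ : G →* Aut (Over.mk π)} [hρ : IsGenericTorsorCover ρ]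
  {V : Y.Opens} [hV : IsIntegralAffine V]

instance : IsDomain (BaseRing f V) := hV.isDomain

instance : IsRegularRing (BaseRing f V) := isRegularRing_of_isAffineOpen hV.isAffineOpen

instance : IsRegularRing (CoverRing f ρ V) :=
  isRegularRing_of_isAffineOpen (isAffineOpen_preimage hρ.isGCover hV.isAffineOpen)

instance : Module.Finite (BaseRing f V) (CoverRing f ρ V) :=
  finite_coverRing hρ.isGCover hV.isAffineOpen

instance : FaithfulSMul (BaseRing f V) (CoverRing f ρ V) := faithfulSMul_coverRing hρ.isGCover

instance : Algebra.IsInvariant (BaseRing f V) (CoverRing f ρ V) G :=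
  isInvariant_coverRing hρ.isGCover

instance : Nontrivial (CoverRing f ρ V) :=
  (FaithfulSMul.algebraMap_injective (BaseRing f V) (CoverRing f ρ V)).nontrivial

variable (f ρ V) in
include hρ hV in
theorem isAffineOpen_cover : IsAffineOpen (π ⁻¹ᵁ V) :=
  isAffineOpen_preimage hρ.isGCover hV.isAffineOpen

variable (f ρ) in
theorem height_coverIdeal {x : X} (hx : x ∈ π ⁻¹ᵁ V) :
    (coverIdeal f ρ V x hx).height = Order.coheight x :=
  height_pointIdeal (isAffineOpen_cover ρ V) x hx

variable (f) in
theorem height_baseIdeal {y : Y} (hy : y ∈ V) : (baseIdeal f V y hy).height = Order.coheight y :=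
  height_pointIdeal hV.isAffineOpen y hy

theorem hasOrd_coverGerm_iff {x : X} {hx : x ∈ π ⁻¹ᵁ V} {b : CoverRing f ρ V} {k : ℕ} :
    HasOrd (coverGerm f ρ V x hx b) k ↔ HasOrdAt (coverIdeal f ρ V x hx) b k :=
  hasOrd_germ_iff (isAffineOpen_cover ρ V) hx

theorem hasOrd_baseGerm_iff {y : Y} {hy : y ∈ V} {a : BaseRing f V} {k : ℕ} :
    HasOrd (baseGerm f V y hy a) k ↔ HasOrdAt (baseIdeal f V y hy) a k :=
  hasOrd_germ_iff hV.isAffineOpen hy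

theorem exists_coverIdeal_eq (P : Ideal (CoverRing f ρ V)) [hP : P.IsPrime] :
    ∃ (x : X) (hx : x ∈ π ⁻¹ᵁ V), coverIdeal f ρ V x hx = P :=
  @exists_pointIdeal_eq _ _ (isAffineOpen_cover ρ V) P hP

theorem exists_baseIdeal_eq (p : Ideal (BaseRing f V)) [hp : p.IsPrime] :
    ∃ (y : Y) (hy : y ∈ V), baseIdeal f V y hy = p :=
  @exists_pointIdeal_eq _ _ hV.isAffineOpen p hp

theorem inertia_eq_inertia_coverIdeal {x : X} (hx : x ∈ π ⁻¹ᵁ V) :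
    inertia ρ x = (coverIdeal f ρ V x hx).inertia G :=
  inertia_eq (isAffineOpen_cover ρ V) hx

theorem coheight_apply (f : Y ⟶ Spec (CommRingCat.of R)) (ρ : G →* Aut (Over.mk π))
    [hρ : IsGenericTorsorCover ρ] (x : X) :
    Order.coheight (π x) = Order.coheight x := by
  obtain ⟨W, hy, hW⟩ := exists_isIntegralAffine (π x)
  have hx : x ∈ π ⁻¹ᵁ W := hy
  rw [← height_coverIdeal f ρ hx, ← height_baseIdeal f hy, ← under_coverIdeal (ρ := ρ) hx hy]
  exact height_under_eq_of_isInvariant (BaseRing f W) (CoverRing f ρ W) G _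

theorem exists_apply_eq (f : Y ⟶ Spec (CommRingCat.of R)) (ρ : G →* Aut (Over.mk π))
    [hρ : IsGenericTorsorCover ρ] (y : Y) : ∃ x : X, π x = y := by
  obtain ⟨W, hy, hW⟩ := exists_isIntegralAffine y
  have := Algebra.IsInvariant.isIntegral (BaseRing f W) (CoverRing f ρ W) G
  obtain ⟨P, -, hP, hPp⟩ := Ideal.exists_ideal_over_prime_of_isIntegral (baseIdeal f W y hy)
    (⊥ : Ideal (CoverRing f ρ W))
    (by
      rw [← RingHom.ker_eq_comap_bot, (RingHom.injective_iff_ker_eq_bot _).1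
        (FaithfulSMul.algebraMap_injective (BaseRing f W) (CoverRing f ρ W))]
      exact bot_le)
  obtain ⟨x, hx, rfl⟩ := exists_coverIdeal_eq P
  have hx' : π x ∈ W := hx
  refine ⟨x, eq_of_pointIdeal_eq hW.isAffineOpen hx' hy ?_⟩
  exact (under_coverIdeal (f := f) (ρ := ρ) hx hx').symm.trans hPp

theorem exists_act_eq (f : Y ⟶ Spec (CommRingCat.of R)) (ρ : G →* Aut (Over.mk π))
    [hρ : IsGenericTorsorCover ρ] {x x' : X} (h : π x = π x') : ∃ g : G, act ρ g x = x' := by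
  obtain ⟨W, hy, hW⟩ := exists_isIntegralAffine (π x)
  have hx : x ∈ π ⁻¹ᵁ W := hy
  have hy' : π x' ∈ W := h ▸ hy
  have hx' : x' ∈ π ⁻¹ᵁ W := hy'
  obtain ⟨g, hg⟩ := Algebra.IsInvariant.exists_smul_of_under_eq (BaseRing f W) (CoverRing f ρ W) G
    (coverIdeal f ρ W x hx) (coverIdeal f ρ W x' hx') (by
      rw [under_coverIdeal hx hy, under_coverIdeal hx' hy']
      congr 1)
  refine ⟨g⁻¹, eq_of_pointIdeal_eq (isAffineOpen_cover ρ W) (act_mem_preimage ρ _ hx) hx' ?_⟩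
  have := coverIdeal_act (f := f) (ρ := ρ) g⁻¹ hx
  rw [inv_inv, ← hg] at this
  exact this

theorem apply_act (ρ : G →* Aut (Over.mk π)) (g : G) (x : X) : π (act ρ g x) = π x := by
  rw [← Scheme.Hom.comp_apply, act_comp]

theorem apply_mem_genericPoints (f : Y ⟶ Spec (CommRingCat.of R)) (ρ : G →* Aut (Over.mk π))
    [hρ : IsGenericTorsorCover ρ] {ξ : X} :
    π ξ ∈ genericPoints Y ↔ ξ ∈ genericPoints X := by
  rw [mem_genericPoints_iff_coheight, mem_genericPoints_iff_coheight, coheight_apply f ρ]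

theorem genericallyFree_coverRing : GenericallyFree (CoverRing f ρ V) G := by
  intro η hη
  have hηp : η.IsPrime := hη.1.1
  obtain ⟨ξ, hξ, rfl⟩ := exists_coverIdeal_eq η
  rw [← inertia_eq_inertia_coverIdeal]
  obtain ⟨U, hU, hT⟩ := hρ.exists_isTorsorOver
  refine inertia_eq_bot_of_isTorsorOver hT (mem_of_mem_genericPoints_of_dense hU ?_)
  rw [apply_mem_genericPoints f ρ,
    mem_genericPoints_iff_mem_minimalPrimes (isAffineOpen_cover ρ V) hξ]
  exact hη

/-- Inertia groups in an orbit are conjugate, hence equal because `G` is commutative. -/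
theorem inertia_act (f : Y ⟶ Spec (CommRingCat.of R)) (g : G) (x : X) :
    inertia ρ (act ρ g x) = inertia ρ x := by
  obtain ⟨W, hy, hW⟩ := exists_isIntegralAffine (π x)
  have hx : x ∈ π ⁻¹ᵁ W := hy
  rw [inertia_eq_inertia_coverIdeal (f := f) hx,
    inertia_eq_inertia_coverIdeal (f := f) (act_mem_preimage ρ g hx), coverIdeal_act]
  ext h
  change (∀ b, h • b - b ∈ g⁻¹ • coverIdeal f ρ W x hx) ↔ ∀ b, h • b - b ∈ coverIdeal f ρ W x hx
  simp only [Ideal.mem_inv_pointwise_smul_iff, smul_sub, smul_comm g h]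
  constructor
  · intro H b
    simpa using H (g⁻¹ • b)
  · exact fun H b => H _

end Cover

end TameCover

/-! ### Cotangent characters and least orders -/

namespace TameCover
open IsLocalRing Pointwise

set_option linter.unusedSectionVars false
set_option linter.overlappingInstances false

section Characters

variable {X Y : Scheme.{u}} {π : X ⟶ Y} {G : Type v} [CommGroup G] [Finite G]
  {R : Type u} [CommRing R] [IsDomain R] [IsTameGroup R G]
  [IsRegularScheme X] [IsRegularScheme Y]
  {f : Y ⟶ Spec (CommRingCat.of R)} {ρ : G →* Aut (Over.mk π)} [hρ : IsGenericTorsorCover ρ]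
  {V : Y.Opens} [hV : IsIntegralAffine V]

theorem scalarStalk_eq_coverGerm {x : X} (hx : x ∈ π ⁻¹ᵁ V) (r : R) :
    scalarStalk (π ≫ f) x r = coverGerm f ρ V x hx (algebraMap R (CoverRing f ρ V) r) := by
  have h1 : f.appLE ⊤ V le_top ≫ π.app V = (π ≫ f).appLE ⊤ (π ⁻¹ᵁ V) le_top := by
    rw [Scheme.Hom.app_eq_appLE]
    exact Scheme.Hom.appLE_comp_appLE π f ⊤ V (π ⁻¹ᵁ V) _ _
  have h2 : (π ≫ f).appLE ⊤ ⊤ le_top ≫ X.presheaf.germ ⊤ x trivial =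
      (π ≫ f).appLE ⊤ (π ⁻¹ᵁ V) le_top ≫ X.presheaf.germ (π ⁻¹ᵁ V) x hx := by
    rw [← Scheme.Hom.appLE_map (π ≫ f) (le_top : (⊤ : X.Opens) ≤ _)
      (homOfLE (le_top : π ⁻¹ᵁ V ≤ ⊤)).op, Category.assoc, X.presheaf.germ_res]
  rw [← h1] at h2
  exact congrArg (fun k => k.hom ((Scheme.ΓSpecIso (CommRingCat.of R)).inv.hom r)) h2

theorem inertiaAct_sub_mem {x : X} (hx : x ∈ π ⁻¹ᵁ V) (g : inertia ρ x)
    (z : X.presheaf.stalk x) (f : Y ⟶ Spec (CommRingCat.of R)) :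
    inertiaAct ρ x g z - z ∈ maximalIdeal (X.presheaf.stalk x) := by
  let _ := X.presheaf.algebra_section_stalk ⟨x, hx⟩
  have := isLocalization_stalk (isAffineOpen_cover ρ V) x hx
  have key : ∀ b : CoverRing f ρ V, inertiaAct ρ x g (coverGerm f ρ V x hx b) -
      coverGerm f ρ V x hx b ∈ maximalIdeal (X.presheaf.stalk x) := fun b => by
    rw [inertiaAct_coverGerm, ← map_sub]
    exact (inertia_eq_inertia_coverIdeal (f := f) hx).le g.2 b
  have h : (residue (X.presheaf.stalk x)).comp (inertiaAct ρ x g) =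
      residue (X.presheaf.stalk x) :=
    IsLocalization.ringHom_ext (pointIdeal (π ⁻¹ᵁ V) x hx).primeCompl
      (RingHom.ext fun b => (Ideal.Quotient.eq).2 (key b))
  exact (Ideal.Quotient.eq).1 (congrArg (fun k => k z) h)

/-- A local uniformizer that is an eigenfunction spans the cotangent space, and inertia moves its
coefficient only within the maximal ideal. -/
theorem isCotangentCharacter_of_eigen {x : X} {hx : x ∈ π ⁻¹ᵁ V} {χ : G →* Rˣ}
    {t : CoverRing f ρ V} (ht : t ∈ eigen (BaseRing f V) χ)
    (ht1 : HasOrdAt (coverIdeal f ρ V x hx) t 1) :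
    IsCotangentCharacter f ρ x (χ.comp (inertia ρ x).subtype) := by
  intro g z hz
  have h1 := hasOrd_coverGerm_iff.2 ht1
  rw [HasOrd, pow_one] at h1
  rw [← h1] at hz
  obtain ⟨u, rfl⟩ := Ideal.mem_span_singleton'.1 hz
  have h2 : inertiaAct ρ x g (coverGerm f ρ V x hx t) =
      scalarStalk (π ≫ f) x (χ g) * coverGerm f ρ V x hx t := by
    rw [inertiaAct_coverGerm, ht g.1, Algebra.smul_def, map_mul, scalarStalk_eq_coverGerm (ρ := ρ) hx]
  have h3 := inertiaAct_sub_mem hx g u f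
  have h4 : coverGerm f ρ V x hx t ∈ maximalIdeal (X.presheaf.stalk x) :=
    h1 ▸ Ideal.mem_span_singleton_self _
  rw [map_mul, h2, pow_two]
  have h5 := Ideal.mul_mem_mul h3 (Ideal.mul_mem_left _ (scalarStalk (π ≫ f) x (χ g)) h4)
  have h6 : ∀ a b c d : X.presheaf.stalk x, a * (b * c) - b * (d * c) = (a - d) * (b * c) :=
    fun a b c d => by ring
  exact (h6 _ _ _ _).symm ▸ h5

/-- The chosen character and `χ` agree on a uniformizer modulo the square of the maximal ideal,
hence modulo the maximal ideal as scalars. Roots of unity of invertible order are separated by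
reduction, so the choice is irrelevant. -/
theorem cotangentCharacter_eq {x : X} (hc : Order.coheight x = 1) {hx : x ∈ π ⁻¹ᵁ V} {χ : G →* Rˣ}
    {t : CoverRing f ρ V} (ht : t ∈ eigen (BaseRing f V) χ)
    (ht1 : HasOrdAt (coverIdeal f ρ V x hx) t 1) (g : inertia ρ x) :
    cotangentCharacter f ρ x g = χ g := by
  have h1 := isCotangentCharacter_of_eigen ht ht1
  have hex : ∃ ψ, IsCotangentCharacter f ρ x ψ := ⟨_, h1⟩
  have h2 : IsCotangentCharacter f ρ x (cotangentCharacter f ρ x) := by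
    rw [cotangentCharacter, dif_pos hex]
    exact hex.choose_spec
  have := isDiscreteValuationRing_stalk hc
  have h3 := hasOrd_coverGerm_iff.2 ht1
  have h4 : coverGerm f ρ V x hx t ∈ maximalIdeal (X.presheaf.stalk x) := by
    have h := h3
    rw [HasOrd, pow_one] at h
    exact h ▸ Ideal.mem_span_singleton_self _
  have h5 := Ideal.sub_mem _ (h1 g _ h4) (h2 g _ h4)
  refine units_eq_of_sub_mem (scalarStalk (π ≫ f) x) (N := Nat.card G)
    (IsTameGroup.isUnit_card (R := R) (G := G)) ?_ (char_apply_pow_card χ g.1)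
    (I := maximalIdeal (X.presheaf.stalk x)) (Ideal.IsPrime.ne_top') ?_
  · rw [← map_pow, ← map_one (cotangentCharacter f ρ x)]
    congr 1
    exact Subtype.ext (pow_card_eq_one' (G := G) (x := g.1))
  · have h6 : (scalarStalk (π ≫ f) x (cotangentCharacter f ρ x g) -
        scalarStalk (π ≫ f) x (χ g)) * coverGerm f ρ V x hx t ∈
        maximalIdeal (X.presheaf.stalk x) ^ 2 := by
      have h7 : ∀ a b c d : X.presheaf.stalk x, (d - b) * c = a - b * c - (a - d * c) :=
        fun a b c d => by ring
      rw [h7 (inertiaAct ρ x g (coverGerm f ρ V x hx t))]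
      exact h5
    by_contra hu
    have h8 : HasOrd (scalarStalk (π ≫ f) x (cotangentCharacter f ρ x g) -
        scalarStalk (π ≫ f) x (χ g)) 0 := hasOrd_zero_iff.2 (by
      rw [mem_maximalIdeal, mem_nonunits_iff, not_not] at hu
      exact hu)
    have := ((h8.mul h3).mem_pow_iff).1 h6
    omega

theorem charExponent_spec {x : X} (hc : Order.coheight x = 1) {hx : x ∈ π ⁻¹ᵁ V} {χ : G →* Rˣ}
    {t : CoverRing f ρ V} (ht : t ∈ eigen (BaseRing f V) χ)
    (ht1 : HasOrdAt (coverIdeal f ρ V x hx) t 1) (φ : G →* Rˣ) {g : G} (hg : g ∈ inertia ρ x) :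
    φ g = χ g ^ charExponent f ρ φ x := by
  have hP : (coverIdeal f ρ V x hx).height = 1 := (height_coverIdeal f ρ hx).trans hc
  -- The infimum is over a nonempty set: the order of any nonzero eigenfunction for `φ` is an
  -- admissible exponent. Otherwise the default value zero would be returned.
  have hne : {m : ℕ | ∀ g : inertia ρ x, φ g = cotangentCharacter f ρ x g ^ m}.Nonempty := by
    obtain ⟨b, hb, hb0⟩ := exists_eigen_ne_zero (A := BaseRing f V)
      (genericallyFree_coverRing (f := f) (ρ := ρ) (V := V)) φ
    obtain ⟨k, hk⟩ := exists_hasOrdAt hP (eigen_mem_nonZeroDivisors hb hb0)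
    refine ⟨k, fun g => ?_⟩
    rw [cotangentCharacter_eq hc ht ht1]
    refine char_eq_pow_of_hasOrdAt hP ht hb ht1 hk ?_
    rw [← inertia_eq_inertia_coverIdeal]
    exact g.2
  have := Nat.sInf_mem hne ⟨g, hg⟩
  rw [cotangentCharacter_eq hc ht ht1] at this
  exact this

theorem charExponent_of_inertia_eq_bot {x : X} (hI : inertia ρ x = ⊥) (φ : G →* Rˣ) :
    charExponent f ρ φ x = 0 := by
  refine Nat.sInf_eq_zero.2 (Or.inl fun g => ?_)
  have : g.1 = 1 := by
    rw [← Subgroup.mem_bot, ← hI]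
    exact g.2
  rw [pow_zero, this, map_one]

/-- The least integer `≥ -D x` that is congruent to `n(φ, x)` modulo `e_x`. -/
noncomputable def leastOrder (f : Y ⟶ Spec (CommRingCat.of R)) (ρ : G →* Aut (Over.mk π))
    (D : X → ℤ) (φ : G →* Rˣ) (x : X) : ℤ :=
  ((charExponent f ρ φ x : ℤ) + D x) % (Nat.card (inertia ρ x) : ℤ) - D x

/-- The fractional part of `a / e` is the remainder of `a` divided by `e`, so the two terms combine
into one fraction. -/
theorem resolventCoeff_eq (D : X → ℤ) (φ : G →* Rˣ) (x : X) : resolventCoeff f ρ D φ x =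
    -(leastOrder f ρ D φ x : ℚ) / (Nat.card (inertia ρ x) : ℚ) := by
  have h := Int.fract_div_intCast_eq_div_intCast_mod (k := ℚ)
    (m := (charExponent f ρ φ x : ℤ) + D x) (n := Nat.card (inertia ρ x))
  push_cast at h
  rw [resolventCoeff, h, leastOrder]
  push_cast
  ring

theorem leastOrder_of_inertia_eq_bot {D : X → ℤ} (hD : ∀ x : X, inertia ρ x = ⊥ → D x = 0) {x : X}
    (hI : inertia ρ x = ⊥) (φ : G →* Rˣ) : leastOrder f ρ D φ x = 0 := by
  rw [leastOrder, charExponent_of_inertia_eq_bot hI, hI, Subgroup.card_bot, hD x hI]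
  simp

theorem exists_eigen_coverIdeal {x : X} (hc : Order.coheight x = 1) (hx : x ∈ π ⁻¹ᵁ V)
    (hI : inertia ρ x ≠ ⊥) : ∃ χ : G →* Rˣ, ∃ t ∈ eigen (BaseRing f V) χ,
      HasOrdAt (coverIdeal f ρ V x hx) t 1 := by
  have hP : (coverIdeal f ρ V x hx).height = 1 := (height_coverIdeal f ρ hx).trans hc
  rw [inertia_eq_inertia_coverIdeal (f := f) hx] at hI
  obtain ⟨χ, t, ht, ht1, -⟩ := exists_eigen_hasOrdAt_one R
    (genericallyFree_coverRing (f := f) (ρ := ρ) (V := V))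
    ((coverIdeal f ρ V x hx).under (BaseRing f V)) hP le_rfl hI
  exact ⟨χ, t, ht, ht1⟩

theorem card_inertia_dvd_iff_zpow {x : X} {hx : x ∈ π ⁻¹ᵁ V}
    {χ : G →* Rˣ} {t : CoverRing f ρ V} (ht : t ∈ eigen (BaseRing f V) χ)
    (ht1 : HasOrdAt (coverIdeal f ρ V x hx) t 1) (k : ℤ) :
    (Nat.card (inertia ρ x) : ℤ) ∣ k ↔ ∀ g ∈ inertia ρ x, χ g ^ k = 1 := by
  rw [Int.natCast_dvd, inertia_eq_inertia_coverIdeal (f := f) hx,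
    card_inertia_dvd_iff (genericallyFree_coverRing (f := f) (ρ := ρ) (V := V)) ht ht1]
  refine forall₂_congr fun g _ => ?_
  rcases Int.natAbs_eq k with h | h
  · conv_rhs => rw [h, zpow_natCast]
  · conv_rhs => rw [h, zpow_neg, zpow_natCast, inv_eq_one]

/-- A faithful character of inertia has values killed by `n`. This divisibility makes the
coefficients of the divisor integral. -/
theorem card_inertia_dvd_of_pow_eq_one (f : Y ⟶ Spec (CommRingCat.of R)) {n : ℕ}
    (hn : ∀ g : G, g ^ n = 1) {x : X} (hc : Order.coheight x = 1) :
    (Nat.card (inertia ρ x) : ℤ) ∣ n := by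
  by_cases hI : inertia ρ x = ⊥
  · rw [hI, Subgroup.card_bot]
    exact one_dvd _
  obtain ⟨W, hy, hW⟩ := exists_isIntegralAffine (π x)
  obtain ⟨χ, t, ht, ht1⟩ := exists_eigen_coverIdeal (f := f) hc (show x ∈ π ⁻¹ᵁ W from hy) hI
  rw [card_inertia_dvd_iff_zpow ht ht1]
  intro g _
  rw [zpow_natCast, ← map_pow, hn, map_one]

/-- Taking a remainder changes the exponent only by a multiple of the inertia order, so the
exponents realizing `φ` form exactly this residue class. -/
theorem leastOrder_spec {x : X} (hc : Order.coheight x = 1) {hx : x ∈ π ⁻¹ᵁ V} {χ : G →* Rˣ}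
    {t : CoverRing f ρ V} (ht : t ∈ eigen (BaseRing f V) χ)
    (ht1 : HasOrdAt (coverIdeal f ρ V x hx) t 1) (D : X → ℤ) (φ : G →* Rˣ) (k : ℤ) :
    (Nat.card (inertia ρ x) : ℤ) ∣ k - leastOrder f ρ D φ x ↔
      ∀ g ∈ inertia ρ x, φ g = χ g ^ k := by
  have h1 : (Nat.card (inertia ρ x) : ℤ) ∣ k - leastOrder f ρ D φ x ↔
      (Nat.card (inertia ρ x) : ℤ) ∣ k - charExponent f ρ φ x := by
    rw [← dvd_add_right (show (Nat.card (inertia ρ x) : ℤ) ∣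
      leastOrder f ρ D φ x - charExponent f ρ φ x from ?_)]
    · rw [add_comm, sub_add_sub_cancel]
    · rw [leastOrder, Int.emod_def]
      exact ⟨-(((charExponent f ρ φ x : ℤ) + D x) / (Nat.card (inertia ρ x) : ℤ)), by ring⟩
  rw [h1, card_inertia_dvd_iff_zpow ht ht1]
  refine forall₂_congr fun g hg => ?_
  rw [charExponent_spec hc ht ht1 φ hg, zpow_sub, mul_inv_eq_one, zpow_natCast, eq_comm]

theorem leastOrder_act (f : Y ⟶ Spec (CommRingCat.of R)) {D : X → ℤ}
    (hD : ∀ x : X, inertia ρ x = ⊥ → D x = 0)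
    (hDG : ∀ (g : G) (x : X), D (act ρ g x) = D x) (φ : G →* Rˣ) (g : G) {x : X}
    (hc : Order.coheight x = 1) : leastOrder f ρ D φ (act ρ g x) = leastOrder f ρ D φ x := by
  by_cases hI : inertia ρ x = ⊥
  · rw [leastOrder_of_inertia_eq_bot hD hI, leastOrder_of_inertia_eq_bot hD]
    rw [inertia_act f, hI]
  obtain ⟨W, hy, hW⟩ := exists_isIntegralAffine (π x)
  have hx : x ∈ π ⁻¹ᵁ W := hy
  obtain ⟨χ, t, ht, ht1⟩ := exists_eigen_coverIdeal (f := f) hc hx hI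
  have hc' : Order.coheight (act ρ g x) = 1 := by
    rw [← coheight_apply f ρ, apply_act, coheight_apply f ρ, hc]
  -- The same eigenfunction is a uniformizer at the translated point, so the two least orders lie in
  -- one residue class; they also lie in the same interval of length `e`.
  have ht1' : HasOrdAt (coverIdeal f ρ W (act ρ g x) (act_mem_preimage ρ g hx)) t 1 := by
    have key : ∀ (P Q : Ideal (CoverRing f ρ W)) [P.IsPrime] [Q.IsPrime], P = Q →
        HasOrdAt P t 1 → HasOrdAt Q t 1 := by
      rintro P _ _ _ rfl h
      exact h
    have := Ideal.IsPrime.smul (I := coverIdeal f ρ W x hx) g⁻¹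
    exact key _ _ (coverIdeal_act g hx).symm (ht1.smul_eigen ht g⁻¹)
  have h1 := (leastOrder_spec hc ht ht1 D φ _).2
    (((leastOrder_spec hc' ht ht1' D φ (leastOrder f ρ D φ (act ρ g x))).1 (by simp)) |>
      fun h k hk => h k ((inertia_act (ρ := ρ) f g x).symm ▸ hk))
  have hI' : inertia ρ (act ρ g x) = inertia ρ x := inertia_act f g x
  simp only [leastOrder, hI', hDG] at h1 ⊢
  rw [sub_left_inj]
  rw [sub_sub_sub_cancel_right] at h1
  have h2 := Int.emod_eq_emod_iff_emod_sub_eq_zero.2 (Int.emod_eq_zero_of_dvd h1)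
  rwa [Int.emod_emod, Int.emod_emod] at h2

end Characters

end TameCover

namespace TameCover
open IsLocalRing Pointwise

set_option linter.unusedSectionVars false
set_option linter.overlappingInstances false

/-! ### The divisor of a resolvent sheaf -/

section Divisor

variable {X Y : Scheme.{u}} {π : X ⟶ Y} {G : Type v} [CommGroup G] [Finite G]
  {R : Type u} [CommRing R] [IsDomain R] [IsTameGroup R G]
  [IsRegularScheme X] [IsRegularScheme Y]
  {f : Y ⟶ Spec (CommRingCat.of R)} {ρ : G →* Aut (Over.mk π)} [hρ : IsGenericTorsorCover ρ]
  {V : Y.Opens} [hV : IsIntegralAffine V]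

open Classical in
/-- A function on the points of `π⁻¹V`, as a function on the prime ideals of `CoverRing f ρ V`. -/
noncomputable def coverFun (f : Y ⟶ Spec (CommRingCat.of R)) (ρ : G →* Aut (Over.mk π))
    (V : Y.Opens) (F : X → ℤ) (P : Ideal (CoverRing f ρ V)) : ℤ :=
  if h : ∃ x, ∃ hx : x ∈ π ⁻¹ᵁ V, coverIdeal f ρ V x hx = P then F h.choose else 0

open Classical in
/-- A function on the points of `V`, as a function on the prime ideals of `BaseRing f V`. -/
noncomputable def baseFun (f : Y ⟶ Spec (CommRingCat.of R)) (V : Y.Opens) (F : Y → ℤ)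
    (p : Ideal (BaseRing f V)) : ℤ :=
  if h : ∃ y, ∃ hy : y ∈ V, baseIdeal f V y hy = p then F h.choose else 0

theorem coverFun_coverIdeal (F : X → ℤ) {x : X} (hx : x ∈ π ⁻¹ᵁ V) :
    coverFun f ρ V F (coverIdeal f ρ V x hx) = F x := by
  have h : ∃ x', ∃ hx' : x' ∈ π ⁻¹ᵁ V, coverIdeal f ρ V x' hx' = coverIdeal f ρ V x hx :=
    ⟨x, hx, rfl⟩
  rw [coverFun, dif_pos h]
  congr 1
  obtain ⟨hx', h'⟩ := h.choose_spec
  exact eq_of_pointIdeal_eq (isAffineOpen_cover ρ V) hx' hx h'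

theorem baseFun_baseIdeal (F : Y → ℤ) {y : Y} (hy : y ∈ V) :
    baseFun f V F (baseIdeal f V y hy) = F y := by
  have h : ∃ y', ∃ hy' : y' ∈ V, baseIdeal f V y' hy' = baseIdeal f V y hy :=
    ⟨y, hy, rfl⟩
  rw [baseFun, dif_pos h]
  congr 1
  obtain ⟨hy', h'⟩ := h.choose_spec
  exact eq_of_pointIdeal_eq hV.isAffineOpen hy' hy h'

theorem isLeastEigenOrder_leastOrder {D : X → ℤ} (hD : ∀ x : X, inertia ρ x = ⊥ → D x = 0)
    (hDG : ∀ (g : G) (x : X), D (act ρ g x) = D x) (φ : G →* Rˣ) :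
    IsLeastEigenOrder (BaseRing f V) φ (coverFun f ρ V D)
      (coverFun f ρ V (leastOrder f ρ D φ)) where
  zero P _ hP hI := by
    obtain ⟨x, hx, rfl⟩ := exists_coverIdeal_eq P
    rw [coverFun_coverIdeal, leastOrder_of_inertia_eq_bot hD]
    rw [inertia_eq_inertia_coverIdeal (f := f) hx, hI]
  smul P _ hP g := by
    obtain ⟨x, hx, rfl⟩ := exists_coverIdeal_eq P
    have h := coverIdeal_act (f := f) (ρ := ρ) g⁻¹ hx
    rw [inv_inv] at h
    rw [← h, coverFun_coverIdeal, coverFun_coverIdeal, leastOrder_act f hD hDG]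
    rw [← height_coverIdeal f ρ hx, hP]
  char P _ hP χ t ht ht1 g hg := by
    obtain ⟨x, hx, rfl⟩ := exists_coverIdeal_eq P
    rw [coverFun_coverIdeal]
    refine (leastOrder_spec ((height_coverIdeal f ρ hx).symm.trans hP) ht ht1 D φ _).1
      (by rw [sub_self]; exact dvd_zero _) g ?_
    rwa [inertia_eq_inertia_coverIdeal (f := f) hx]
  le P _ hP := by
    obtain ⟨x, hx, rfl⟩ := exists_coverIdeal_eq P
    rw [coverFun_coverIdeal, coverFun_coverIdeal, leastOrder]
    have he : (Nat.card (inertia ρ x) : ℤ) ≠ 0 := by exact_mod_cast Nat.card_pos.ne'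
    have := Int.emod_nonneg ((charExponent f ρ φ x : ℤ) + D x) he
    omega
  min P _ hP k hk h := by
    obtain ⟨x, hx, rfl⟩ := exists_coverIdeal_eq P
    rw [coverFun_coverIdeal] at hk ⊢
    have hc := (height_coverIdeal f ρ hx).symm.trans hP
    by_cases hI : inertia ρ x = ⊥
    · rw [leastOrder_of_inertia_eq_bot hD hI]
      rwa [hD x hI, neg_zero] at hk
    obtain ⟨χ, t, ht, ht1⟩ := exists_eigen_coverIdeal (f := f) hc hx hI
    have h1 := (leastOrder_spec hc ht ht1 D φ k).2 (by
      rw [inertia_eq_inertia_coverIdeal (f := f) hx]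
      exact h χ t ht ht1)
    rw [leastOrder] at h1 ⊢
    have he : (0 : ℤ) < Nat.card (inertia ρ x) := by exact_mod_cast Nat.card_pos
    have h2 := Int.emod_lt_of_pos ((charExponent f ρ φ x : ℤ) + D x) he
    -- A smaller member of the residue class differs by at least `e` and would therefore lie below
    -- `-D x`.
    by_contra hlt
    obtain ⟨l, hl⟩ := h1
    have h3 : l < 0 := by
      by_contra hl0
      have := mul_nonneg he.le (not_lt.1 hl0)
      omega
    nlinarith

open Classical in
/-- The coefficient of `∑ n f(φ, y) y` at `y`. -/
noncomputable def resolventDivisorCoeff (f : Y ⟶ Spec (CommRingCat.of R))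
    (ρ : G →* Aut (Over.mk π)) [IsGenericTorsorCover ρ] (D : X → ℤ) (φ : G →* Rˣ) (n : ℕ) (y : Y) :
    ℤ :=
  if Order.coheight y = 1 then
    -((n : ℤ) / (Nat.card (inertia ρ (exists_apply_eq f ρ y).choose) : ℤ) *
      leastOrder f ρ D φ (exists_apply_eq f ρ y).choose) else 0

/-- Any point over `π x` is a translate of `x`, so the chosen representative does not matter; the
integer division is exact because the inertia order divides `n`. -/
theorem card_inertia_mul_resolventDivisorCoeff {n : ℕ} (hn : ∀ g : G, g ^ n = 1) {D : X → ℤ}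
    (hD : ∀ x : X, inertia ρ x = ⊥ → D x = 0)
    (hDG : ∀ (g : G) (x : X), D (act ρ g x) = D x) (φ : G →* Rˣ) {x : X}
    (hc : Order.coheight x = 1) :
    (Nat.card (inertia ρ x) : ℤ) * resolventDivisorCoeff f ρ D φ n (π x) =
      -(n * leastOrder f ρ D φ x) := by
  have hx' := (exists_apply_eq f ρ (π x)).choose_spec
  obtain ⟨g, hg⟩ := exists_act_eq f ρ hx'.symm
  rw [resolventDivisorCoeff, if_pos ((coheight_apply f ρ x).trans hc), ← hg,
    leastOrder_act f hD hDG φ g hc]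
  have hI' : inertia ρ (act ρ g x) = inertia ρ x := inertia_act f g x
  rw [hI', mul_neg, ← mul_assoc, Int.mul_ediv_cancel' (card_inertia_dvd_of_pow_eq_one f hn hc)]

theorem resolventDivisorCoeff_eq_zero {n : ℕ} (hn : ∀ g : G, g ^ n = 1) {D : X → ℤ}
    (hD : ∀ x : X, inertia ρ x = ⊥ → D x = 0)
    (hDG : ∀ (g : G) (x : X), D (act ρ g x) = D x) (φ : G →* Rˣ) {x : X}
    (hI : inertia ρ x = ⊥) : resolventDivisorCoeff f ρ D φ n (π x) = 0 := by
  by_cases hc : Order.coheight x = 1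
  · have := card_inertia_mul_resolventDivisorCoeff (f := f) hn hD hDG φ hc
    rwa [leastOrder_of_inertia_eq_bot hD hI, mul_zero, neg_zero, hI, Subgroup.card_bot,
      Nat.cast_one, one_mul] at this
  · rw [resolventDivisorCoeff, if_neg]
    rwa [coheight_apply f ρ]

variable (f ρ) in
/-- The divisor `∑ n f(φ, y) y`. -/
noncomputable def resolventDivisor {n : ℕ} (hn : ∀ g : G, g ^ n = 1) {D : X → ℤ}
    (hD : ∀ x : X, inertia ρ x = ⊥ → D x = 0)
    (hDG : ∀ (g : G) (x : X), D (act ρ g x) = D x) (φ : G →* Rˣ) : AlgebraicCycle Y ℤ where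
  toFun := resolventDivisorCoeff f ρ D φ n
  supportWithinDomain' := Set.subset_univ _
  supportLocallyFiniteWithinDomain' y _ := by
    obtain ⟨W, hy, hW⟩ := exists_isIntegralAffine y
    refine ⟨W, W.2.mem_nhds hy, ?_⟩
    -- Local finiteness of the support: a nonzero coefficient forces ramification, and ramified
    -- divisors are among the finitely many that contain `Δ`.
    obtain ⟨Δ, hΔ, hΔP⟩ := exists_mem_of_ramified R (BaseRing f W) (CoverRing f ρ W) G
      genericallyFree_coverRing
    have hpt : ∀ P : Ideal (CoverRing f ρ W), ∃ x : X, P.IsPrime →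
        ∃ hx : x ∈ π ⁻¹ᵁ W, coverIdeal f ρ W x hx = P := fun P => by
      by_cases hP : P.IsPrime
      · obtain ⟨x, hx⟩ := exists_coverIdeal_eq P
        exact ⟨x, fun _ => hx⟩
      · exact ⟨(exists_apply_eq f ρ y).choose, fun h => absurd h hP⟩
    choose pt hpt using hpt
    refine ((finite_setOf_height_one_mem hΔ).image fun P => π (pt P)).subset ?_
    rintro z ⟨hzW, hz⟩
    obtain ⟨x, rfl⟩ := exists_apply_eq f ρ z
    have hx : x ∈ π ⁻¹ᵁ W := hzW
    have hc : Order.coheight x = 1 := by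
      by_contra hc
      refine hz ?_
      rw [resolventDivisorCoeff, if_neg]
      rwa [coheight_apply f ρ]
    refine ⟨coverIdeal f ρ W x hx, ⟨inferInstance, (height_coverIdeal f ρ hx).trans hc, ?_⟩, ?_⟩
    · refine hΔP _ fun h => hz (resolventDivisorCoeff_eq_zero hn hD hDG φ ?_)
      rwa [inertia_eq_inertia_coverIdeal (f := f) hx]
    · obtain ⟨hx', h⟩ := hpt (coverIdeal f ρ W x hx) inferInstance
      exact congrArg π (eq_of_pointIdeal_eq (isAffineOpen_cover ρ W) hx' hx h)

end Divisor

/-! ### Rational functions as fractions -/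

theorem finite_genericPoints {X : Scheme.{u}} [IsRegularScheme X] {U : X.Opens}
    (hU : IsAffineOpen U) : Finite {ξ : X // ξ ∈ U ∧ ξ ∈ genericPoints X} := by
  have := isRegularRing_of_isAffineOpen hU
  have := (minimalPrimes.finite_of_isNoetherianRing Γ(X, U)).to_subtype
  exact Finite.of_injective (β := minimalPrimes Γ(X, U))
    (fun ξ => ⟨pointIdeal U ξ.1 ξ.2.1,
      (mem_genericPoints_iff_mem_minimalPrimes hU ξ.2.1).1 ξ.2.2⟩)
    fun ξ η h => Subtype.ext (eq_of_pointIdeal_eq hU ξ.2.1 η.2.1 (congrArg Subtype.val h))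

/-- Choose for each generic point a function nonzero there and zero at all the others. These
functions glue the local fractions into a single one with a denominator that vanishes at no generic
point. -/
theorem exists_common_denominator {X : Scheme.{u}} [IsRegularScheme X] {U : X.Opens}
    (hU : IsAffineOpen U) (t : Mero X U) : ∃ d b : Γ(X, U),
      ∀ ξ : {ξ : X // ξ ∈ U ∧ ξ ∈ genericPoints X}, d ∉ pointIdeal U ξ.1 ξ.2.1 ∧
        (X.presheaf.germ U ξ.1 ξ.2.1).hom d * t ξ = (X.presheaf.germ U ξ.1 ξ.2.1).hom b := by
  classical
  have := finite_genericPoints hU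
  cases nonempty_fintype {ξ : X // ξ ∈ U ∧ ξ ∈ genericPoints X}
  have h1 : ∀ ξ : {ξ : X // ξ ∈ U ∧ ξ ∈ genericPoints X}, ∃ d b : Γ(X, U),
      d ∉ pointIdeal U ξ.1 ξ.2.1 ∧
        (X.presheaf.germ U ξ.1 ξ.2.1).hom d * t ξ = (X.presheaf.germ U ξ.1 ξ.2.1).hom b := by
    intro ξ
    let _ := X.presheaf.algebra_section_stalk ⟨ξ.1, ξ.2.1⟩
    have := isLocalization_stalk hU ξ.1 ξ.2.1
    obtain ⟨⟨b, d⟩, e⟩ := IsLocalization.surj (pointIdeal U ξ.1 ξ.2.1).primeCompl (t ξ)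
    exact ⟨d.1, b, d.2, (mul_comm _ _).trans e⟩
  choose d b hd hdb using h1
  have h2 : ∀ ξ η : {ξ : X // ξ ∈ U ∧ ξ ∈ genericPoints X}, ∃ w : Γ(X, U),
      w ∉ pointIdeal U ξ.1 ξ.2.1 ∧ (ξ ≠ η → w ∈ pointIdeal U η.1 η.2.1) := by
    intro ξ η
    by_cases h : pointIdeal U η.1 η.2.1 ≤ pointIdeal U ξ.1 ξ.2.1
    · have h3 := mem_genericPoints_iff.1 ξ.2.2 _ (specializes_of_pointIdeal_le hU η.2.1 ξ.2.1 h)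
      exact ⟨1, (Ideal.ne_top_iff_one _).1 Ideal.IsPrime.ne_top',
        fun hne => absurd (Subtype.ext h3.symm) hne⟩
    · obtain ⟨w, hw, hw'⟩ := SetLike.not_le_iff_exists.1 h
      exact ⟨w, hw', fun _ => hw⟩
  choose w hw hw' using h2
  have hv : ∀ ξ, ∏ η, w ξ η ∉ pointIdeal U ξ.1 ξ.2.1 := fun ξ h => by
    obtain ⟨η, -, hη⟩ := Ideal.IsPrime.prod_mem_iff.1 h
    exact hw ξ η hη
  have hv0 : ∀ ξ η, η ≠ ξ → (X.presheaf.germ U ξ.1 ξ.2.1).hom (∏ ζ, w η ζ) = 0 := fun ξ η h =>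
    germ_eq_zero_of_mem ξ.2.2
      (Ideal.IsPrime.prod_mem_iff.2 ⟨ξ, Finset.mem_univ _, hw' η ξ h⟩)
  have hsum : ∀ (c : {ξ : X // ξ ∈ U ∧ ξ ∈ genericPoints X} → Γ(X, U)) ξ,
      (X.presheaf.germ U ξ.1 ξ.2.1).hom (∑ η, (∏ ζ, w η ζ) * c η) =
        (X.presheaf.germ U ξ.1 ξ.2.1).hom ((∏ ζ, w ξ ζ) * c ξ) := fun c ξ => by
    rw [map_sum, Finset.sum_eq_single ξ]
    · intro η _ h
      rw [map_mul, hv0 ξ η h, zero_mul]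
    · exact fun h => absurd (Finset.mem_univ _) h
  refine ⟨∑ ξ, (∏ ζ, w ξ ζ) * d ξ, ∑ ξ, (∏ ζ, w ξ ζ) * b ξ, fun ξ => ⟨?_, ?_⟩⟩
  · rw [notMem_pointIdeal, hsum, ← notMem_pointIdeal]
    exact fun h => (Ideal.IsPrime.mem_or_mem' h).elim (hv ξ) (hd ξ)
  · rw [hsum, hsum, map_mul, map_mul, mul_assoc, hdb]

end TameCover

namespace TameCover
open IsLocalRing Pointwise

set_option linter.unusedSectionVars false
set_option linter.overlappingInstances false

/-! ### Local generators of resolvent sheaves -/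

theorem exists_mem_genericPoints_specializes {X : Scheme.{u}} {U : X.Opens} (hU : IsAffineOpen U)
    {x : X} (hx : x ∈ U) :
    ∃ ξ : {ξ : X // ξ ∈ U ∧ ξ ∈ genericPoints X}, ξ.1 ⤳ x := by
  obtain ⟨η, hη, hηx⟩ := Ideal.exists_minimalPrimes_le (I := (⊥ : Ideal Γ(X, U)))
    (J := pointIdeal U x hx) bot_le
  have hηp : η.IsPrime := hη.1.1
  obtain ⟨ξ, hξ, rfl⟩ := exists_pointIdeal_eq hU η
  exact ⟨⟨ξ, hξ, (mem_genericPoints_iff_mem_minimalPrimes hU hξ).2 hη⟩,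
    specializes_of_pointIdeal_le hU hξ hx hηx⟩

theorem toMero_injective {X : Scheme.{u}} [IsRegularScheme X] {U : X.Opens} (hU : IsAffineOpen U) :
    Function.Injective (toMero X U) := by
  have := isRegularRing_of_isAffineOpen hU
  have := isReduced_of_isRegularRing Γ(X, U)
  rw [injective_iff_map_eq_zero]
  intro b hb
  have h : b ∈ nilradical Γ(X, U) := by
    rw [nilradical, ← Ideal.sInf_minimalPrimes, Ideal.mem_sInf]
    intro η hη
    have hηp : Ideal.IsPrime η := hη.1.1
    obtain ⟨ξ, hξ, rfl⟩ := exists_pointIdeal_eq hU η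
    have h1 : (X.presheaf.germ U ξ hξ).hom b = 0 := congrFun hb
      (⟨ξ, hξ, (mem_genericPoints_iff_mem_minimalPrimes hU hξ).2 hη⟩ :
        {ξ : X // ξ ∈ U ∧ ξ ∈ genericPoints X})
    rw [mem_pointIdeal, h1]
    exact Ideal.zero_mem _
  rwa [nilradical_eq_zero] at h

section Local

variable {X Y : Scheme.{u}} {π : X ⟶ Y} {G : Type v} [CommGroup G] [Finite G]
  {R : Type u} [CommRing R] [IsDomain R] [IsTameGroup R G]
  [IsRegularScheme X] [IsRegularScheme Y]
  {f : Y ⟶ Spec (CommRingCat.of R)} {ρ : G →* Aut (Over.mk π)} [hρ : IsGenericTorsorCover ρ]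
  {V : Y.Opens} [hV : IsIntegralAffine V]

variable (f ρ) in
/-- The pullback of meromorphic functions along `π`. -/
noncomputable def meroPullback (V : Y.Opens) : Mero Y V →ₐ[Γ(Y, V)] MeroPush π V where
  toFun t := fun ξ => (π.stalkMap ξ.1).hom
    (t ⟨π ξ.1, ξ.2.1, (apply_mem_genericPoints f ρ).2 ξ.2.2⟩)
  map_one' := funext fun _ => map_one _
  map_mul' _ _ := funext fun _ => map_mul _ _ _
  map_zero' := funext fun _ => map_zero _
  map_add' _ _ := funext fun _ => map_add _ _ _
  commutes' a := funext fun ξ => Scheme.Hom.germ_stalkMap_apply π V ξ.1 ξ.2.1 a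

theorem isPullback_iff {V : Y.Opens} {t : Mero Y V} {s : MeroPush π V} :
    IsPullback π V t s ↔ meroPullback f ρ V t = s :=
  ⟨fun h => funext fun ξ => (h ξ).choose_spec.symm, fun h ξ =>
    ⟨(apply_mem_genericPoints f ρ).2 ξ.2.2, congrFun h.symm ξ⟩⟩

variable (f ρ) in
theorem meroPullback_injective (V : Y.Opens) : Function.Injective (meroPullback f ρ V) := by
  intro s t h
  funext η
  obtain ⟨η, hη, hη'⟩ := η
  obtain ⟨ξ, rfl⟩ := exists_apply_eq f ρ η
  have hinj : Function.Injective (π.stalkMap ξ).hom := by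
    rw [injective_iff_map_eq_zero]
    intro z hz
    by_contra hz0
    obtain ⟨w, hw⟩ := (isField_stalk_of_mem_genericPoints hη').mul_inv_cancel hz0
    have h1 := congrArg (π.stalkMap ξ).hom hw
    rw [map_mul, hz, zero_mul, map_one] at h1
    exact zero_ne_one h1
  exact hinj (congrFun h ⟨ξ, hη, (apply_mem_genericPoints f ρ).1 hη'⟩)

theorem isUnit_baseGerm {y : Y} (hy : y ∈ V) (h : y ∈ genericPoints Y) {a : BaseRing f V}
    (ha : a ≠ 0) : IsUnit (baseGerm f V y hy a) := by
  rw [← notMem_baseIdeal]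
  change a ∉ pointIdeal V y hy
  rw [pointIdeal_eq_bot_of_mem_genericPoints hy h]
  exact ha

theorem isUnit_coverGerm {x : X} (hx : x ∈ π ⁻¹ᵁ V) (h : x ∈ genericPoints X) {a : BaseRing f V}
    (ha : a ≠ 0) :
    IsUnit (coverGerm f ρ V x hx (algebraMap (BaseRing f V) (CoverRing f ρ V) a)) := by
  have hy : π x ∈ V := hx
  rw [coverGerm_algebraMap hx hy]
  exact (isUnit_baseGerm hy ((apply_mem_genericPoints f ρ).2 h) ha).map _

theorem stalkSpecializes_coverGerm {x z : X} (hx : x ∈ π ⁻¹ᵁ V) (hz : z ∈ π ⁻¹ᵁ V) (h : z ⤳ x)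
    (b : CoverRing f ρ V) :
    (X.presheaf.stalkSpecializes h).hom (coverGerm f ρ V x hx b) = coverGerm f ρ V z hz b :=
  congrArg (fun k => k.hom b) (X.presheaf.germ_stalkSpecializes (U := π ⁻¹ᵁ V) hx h)

theorem stalkSpecializes_baseGerm {x z : Y} (hx : x ∈ V) (hz : z ∈ V) (h : z ⤳ x)
    (a : BaseRing f V) :
    (Y.presheaf.stalkSpecializes h).hom (baseGerm f V x hx a) = baseGerm f V z hz a :=
  congrArg (fun k => k.hom a) (Y.presheaf.germ_stalkSpecializes (U := V) hx h)

theorem ordGE_coverGerm_iff {x z : X} (hx : x ∈ π ⁻¹ᵁ V) (hz : z ∈ π ⁻¹ᵁ V) (h : z ⤳ x)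
    (hc : Order.coheight x = 1) (d : ℤ) {s : X.presheaf.stalk z} {a b : CoverRing f ρ V} {i j : ℕ}
    (hb : HasOrdAt (coverIdeal f ρ V x hx) b i) (ha : HasOrdAt (coverIdeal f ρ V x hx) a j)
    (e : coverGerm f ρ V z hz a * s = coverGerm f ρ V z hz b) :
    OrdGE h d s ↔ -d ≤ (i : ℤ) - j := by
  rw [ordGE_iff h hc d (hasOrd_coverGerm_iff.2 ha) (hasOrd_coverGerm_iff.2 hb)
    (by rw [stalkSpecializes_coverGerm hx hz, stalkSpecializes_coverGerm hx hz, e])]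
  omega

theorem ordGE_baseGerm_iff {x z : Y} (hx : x ∈ V) (hz : z ∈ V) (h : z ⤳ x)
    (hc : Order.coheight x = 1) (d : ℤ) {s : Y.presheaf.stalk z} {a b : BaseRing f V} {i j : ℕ}
    (hb : HasOrdAt (baseIdeal f V x hx) b i) (ha : HasOrdAt (baseIdeal f V x hx) a j)
    (e : baseGerm f V z hz a * s = baseGerm f V z hz b) :
    OrdGE h d s ↔ -d ≤ (i : ℤ) - j := by
  rw [ordGE_iff h hc d (hasOrd_baseGerm_iff.2 ha) (hasOrd_baseGerm_iff.2 hb)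
    (by rw [stalkSpecializes_baseGerm hx hz, stalkSpecializes_baseGerm hx hz, e])]
  omega

theorem meroPush_smul_apply (r : BaseRing f V) (s : MeroPush π V)
    (ξ : {ξ : X // ξ ∈ π ⁻¹ᵁ V ∧ ξ ∈ genericPoints X}) :
    ((show Γ(Y, V) from r) • s) ξ =
      coverGerm f ρ V ξ.1 ξ.2.1 (algebraMap (BaseRing f V) (CoverRing f ρ V) r) * s ξ :=
  rfl

theorem scalar_smul_apply (r : R) (s : MeroPush π V)
    (ξ : {ξ : X // ξ ∈ π ⁻¹ᵁ V ∧ ξ ∈ genericPoints X}) :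
    (scalar f V r • s) ξ = coverGerm f ρ V ξ.1 ξ.2.1 (algebraMap R (CoverRing f ρ V) r) * s ξ :=
  rfl

theorem coverGerm_eq_of_forall {b c : CoverRing f ρ V}
    (h : ∀ ξ : {ξ : X // ξ ∈ π ⁻¹ᵁ V ∧ ξ ∈ genericPoints X},
      coverGerm f ρ V ξ.1 ξ.2.1 b = coverGerm f ρ V ξ.1 ξ.2.1 c) : b = c :=
  toMero_injective (isAffineOpen_cover ρ V) (funext h)

/-- The product of all conjugates of `d` is invariant; the cofactor is the product over the
nontrivial elements. -/
theorem exists_mul_eq_algebraMap {A B G : Type*} [CommRing A] [CommRing B] [Algebra A B] [Group G]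
    [Finite G] [MulSemiringAction G B] [Algebra.IsInvariant A B G] [Nontrivial B] {d : B}
    (hd : d ∈ nonZeroDivisors B) : ∃ (c : B) (a : A), a ≠ 0 ∧ c * d = algebraMap A B a := by
  classical
  cases nonempty_fintype G
  obtain ⟨a, ha⟩ := Algebra.IsInvariant.isInvariant (A := A) (G := G) (∏ g : G, g • d)
    fun h => by
      rw [Finset.smul_prod']
      simp only [smul_smul]
      exact Fintype.prod_equiv (Equiv.mulLeft h) _ _ fun g => rfl
  have hne : ∏ g : G, g • d ∈ nonZeroDivisors B := by
    refine Submonoid.prod_mem _ fun g _ => ?_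
    rw [mem_nonZeroDivisors_iff_right] at hd ⊢
    intro z hz
    have h1 := congrArg (g⁻¹ • ·) hz
    simp only [smul_mul', inv_smul_smul, smul_zero] at h1
    have h2 := congrArg (g • ·) (hd _ h1)
    simpa using h2
  refine ⟨∏ g ∈ Finset.univ.erase (1 : G), g • d, a, ?_, ?_⟩
  · rintro rfl
    rw [map_zero] at ha
    exact zero_notMem_nonZeroDivisors (ha ▸ hne)
  · rw [ha, ← Finset.prod_erase_mul _ _ (Finset.mem_univ (1 : G)), one_smul]

/-- Replacing the denominator by its norm makes it invariant, and then the numerator inherits the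
character of the rational function. -/
theorem exists_eq_div_of_forall_smul_eq {φ : G →* Rˣ} {t : MeroPush π V}
    (ht : ∀ g, pullbackMero ρ g V t = scalar f V (φ g) • t) :
    ∃ β ∈ eigen (BaseRing f V) φ (B := CoverRing f ρ V), ∃ α : BaseRing f V, α ≠ 0 ∧
      ∀ ξ : {ξ : X // ξ ∈ π ⁻¹ᵁ V ∧ ξ ∈ genericPoints X},
        coverGerm f ρ V ξ.1 ξ.2.1 (algebraMap (BaseRing f V) (CoverRing f ρ V) α) * t ξ =
          coverGerm f ρ V ξ.1 ξ.2.1 β := by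
  obtain ⟨d, b, hdb⟩ : ∃ d b : CoverRing f ρ V,
      ∀ ξ : {ξ : X // ξ ∈ π ⁻¹ᵁ V ∧ ξ ∈ genericPoints X},
        IsUnit (coverGerm f ρ V ξ.1 ξ.2.1 d) ∧
        coverGerm f ρ V ξ.1 ξ.2.1 d * t ξ = coverGerm f ρ V ξ.1 ξ.2.1 b := by
    obtain ⟨d, b, h⟩ := exists_common_denominator (isAffineOpen_cover ρ V) t
    exact ⟨d, b, fun ξ => ⟨notMem_pointIdeal.1 (h ξ).1, (h ξ).2⟩⟩
  have hd : d ∈ nonZeroDivisors (CoverRing f ρ V) := by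
    rw [mem_nonZeroDivisors_iff_right]
    intro z hz
    refine coverGerm_eq_of_forall fun ξ => ?_
    have h1 := congrArg (coverGerm f ρ V ξ.1 ξ.2.1) hz
    rw [map_mul, map_zero] at h1
    rw [map_zero]
    exact ((hdb ξ).1.mul_left_eq_zero).1 h1
  obtain ⟨c, α, hα, hc⟩ := exists_mul_eq_algebraMap (A := BaseRing f V) (G := G) hd
  have key : ∀ ξ : {ξ : X // ξ ∈ π ⁻¹ᵁ V ∧ ξ ∈ genericPoints X},
      coverGerm f ρ V ξ.1 ξ.2.1 (algebraMap (BaseRing f V) (CoverRing f ρ V) α) * t ξ =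
        coverGerm f ρ V ξ.1 ξ.2.1 (c * b) := fun ξ => by
    rw [← hc, map_mul, map_mul, mul_assoc, (hdb ξ).2]
  refine ⟨c * b, fun g => coverGerm_eq_of_forall fun ξ => ?_, α, hα, key⟩
  have h1 := key (actGeneric ρ g V ξ)
  have h2 := (map_mul _ _ _).symm.trans (congrArg ((act ρ g).stalkMap ξ.1).hom h1)
  have h3 : ((act ρ g).stalkMap ξ.1).hom (t (actGeneric ρ g V ξ)) =
      coverGerm f ρ V ξ.1 ξ.2.1 (algebraMap R (CoverRing f ρ V) (φ g)) * t ξ :=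
    congrFun (ht g) ξ
  rw [h3] at h2
  have h4 := coverGerm_smul (f := f) g ξ.2.1 (c * b)
  have h5 := coverGerm_smul (f := f) g ξ.2.1 (algebraMap (BaseRing f V) (CoverRing f ρ V) α)
  rw [smul_algebraMap] at h5
  refine h4.trans ?_
  rw [Algebra.smul_def]
  refine Eq.trans ?_ (map_mul (coverGerm f ρ V ξ.1 ξ.2.1) _ _).symm
  rw [← key ξ, mul_left_comm]
  refine h2.symm.trans ?_
  congr 1
  exact h5.symm

/-- The rational function `b / a` on `π⁻¹V`. -/
noncomputable def coverDiv (b : CoverRing f ρ V) (a : BaseRing f V) : MeroPush π V :=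
  fun ξ : {ξ : X // ξ ∈ π ⁻¹ᵁ V ∧ ξ ∈ genericPoints X} => Ring.inverse
    (coverGerm f ρ V ξ.1 ξ.2.1 (algebraMap (BaseRing f V) (CoverRing f ρ V) a)) *
      coverGerm f ρ V ξ.1 ξ.2.1 b

/-- The rational function `b / a` on `V`. -/
noncomputable def baseDiv (b a : BaseRing f V) : Mero Y V :=
  fun ξ : {ξ : Y // ξ ∈ V ∧ ξ ∈ genericPoints Y} => Ring.inverse
    (baseGerm f V ξ.1 ξ.2.1 a) * baseGerm f V ξ.1 ξ.2.1 b

theorem coverGerm_mul_coverDiv (b : CoverRing f ρ V) {a : BaseRing f V} (ha : a ≠ 0)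
    (ξ : {ξ : X // ξ ∈ π ⁻¹ᵁ V ∧ ξ ∈ genericPoints X}) :
    coverGerm f ρ V ξ.1 ξ.2.1 (algebraMap (BaseRing f V) (CoverRing f ρ V) a) * coverDiv b a ξ =
      coverGerm f ρ V ξ.1 ξ.2.1 b :=
  Ring.mul_inverse_cancel_left _ _ (isUnit_coverGerm ξ.2.1 ξ.2.2 ha)

theorem baseGerm_mul_baseDiv (b : BaseRing f V) {a : BaseRing f V} (ha : a ≠ 0)
    (ξ : {ξ : Y // ξ ∈ V ∧ ξ ∈ genericPoints Y}) :
    baseGerm f V ξ.1 ξ.2.1 a * baseDiv b a ξ = baseGerm f V ξ.1 ξ.2.1 b :=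
  Ring.mul_inverse_cancel_left _ _ (isUnit_baseGerm ξ.2.1 ξ.2.2 ha)

theorem coverDiv_mem_resolventSheaf {D : X → ℤ} {φ : G →* Rˣ} {b : CoverRing f ρ V}
    (hb : b ∈ eigen (BaseRing f V) φ) {a : BaseRing f V} (ha : a ≠ 0)
    (h : ∀ (P : Ideal (CoverRing f ρ V)) [P.IsPrime], P.height = 1 → ∃ i j : ℕ, HasOrdAt P b i ∧
      HasOrdAt P (algebraMap (BaseRing f V) (CoverRing f ρ V) a) j ∧
        -coverFun f ρ V D P ≤ (i : ℤ) - j) :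
    coverDiv b a ∈ resolventSheaf f ρ D φ V := by
  constructor
  · intro x hx hc ξ hξ
    obtain ⟨i, j, hi, hj, hij⟩ := h (coverIdeal f ρ V x hx) ((height_coverIdeal f ρ hx).trans hc)
    rw [coverFun_coverIdeal] at hij
    exact (ordGE_coverGerm_iff hx ξ.2.1 hξ hc (D x) hi hj (coverGerm_mul_coverDiv b ha ξ)).2 hij
  · intro g
    funext ξ
    rw [scalar_smul_apply (ρ := ρ)]
    refine (isUnit_coverGerm (f := f) (ρ := ρ) ξ.2.1 ξ.2.2 ha).mul_left_cancel ?_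
    rw [mul_left_comm, coverGerm_mul_coverDiv b ha ξ, ← map_mul, ← Algebra.smul_def]
    have h1 : (φ g : R) • b = g • b := (hb g).symm
    rw [h1, coverGerm_smul]
    have h5 := coverGerm_smul (f := f) g ξ.2.1 (algebraMap (BaseRing f V) (CoverRing f ρ V) a)
    rw [smul_algebraMap] at h5
    rw [h5]
    have h2 := coverGerm_mul_coverDiv b ha (actGeneric ρ g V ξ)
    exact (map_mul _ _ _).symm.trans (congrArg ((act ρ g).stalkMap ξ.1).hom h2)

theorem baseDiv_mem_divisorSheaf {E : Y → ℤ} {b a : BaseRing f V} (ha : a ≠ 0)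
    (h : ∀ (q : Ideal (BaseRing f V)) [q.IsPrime], q.height = 1 → ∃ i j : ℕ, HasOrdAt q b i ∧
      HasOrdAt q a j ∧ -baseFun f V E q ≤ (i : ℤ) - j) :
    baseDiv b a ∈ divisorSheaf Y E V := by
  intro x hx hc ξ hξ
  obtain ⟨i, j, hi, hj, hij⟩ := h (baseIdeal f V x hx) ((height_baseIdeal f hx).trans hc)
  rw [baseFun_baseIdeal] at hij
  exact (ordGE_baseGerm_iff hx ξ.2.1 hξ hc (E x) hi hj (baseGerm_mul_baseDiv b ha ξ)).2 hij

theorem exists_hasOrdAt_of_mem_divisorSheaf {D : X → ℤ} {t : MeroPush π V}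
    (ht : t ∈ divisorSheaf X D (π ⁻¹ᵁ V)) {β : CoverRing f ρ V}
    (hβ : β ∈ nonZeroDivisors (CoverRing f ρ V)) {α : BaseRing f V} (hα : α ≠ 0)
    (h : ∀ ξ : {ξ : X // ξ ∈ π ⁻¹ᵁ V ∧ ξ ∈ genericPoints X},
        coverGerm f ρ V ξ.1 ξ.2.1 (algebraMap (BaseRing f V) (CoverRing f ρ V) α) * t ξ =
          coverGerm f ρ V ξ.1 ξ.2.1 β) (P : Ideal (CoverRing f ρ V)) [P.IsPrime]
    (hP : P.height = 1) : ∃ i j : ℕ, HasOrdAt P β i ∧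
      HasOrdAt P (algebraMap (BaseRing f V) (CoverRing f ρ V) α) j ∧
        -coverFun f ρ V D P ≤ (i : ℤ) - j := by
  obtain ⟨x, hx, rfl⟩ := exists_coverIdeal_eq P
  obtain ⟨i, hi⟩ := exists_hasOrdAt hP hβ
  obtain ⟨j, hj⟩ := exists_hasOrdAt hP
    (algebraMap_mem_nonZeroDivisors (BaseRing f V) (CoverRing f ρ V) G hα)
  refine ⟨i, j, hi, hj, ?_⟩
  rw [coverFun_coverIdeal]
  have hc := (height_coverIdeal f ρ hx).symm.trans hP
  obtain ⟨ξ, hξ⟩ := exists_mem_genericPoints_specializes (isAffineOpen_cover ρ V) hx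
  exact (ordGE_coverGerm_iff hx ξ.2.1 hξ hc (D x) hi hj (h ξ)).1 (ht x hx hc ξ hξ)

theorem exists_hasOrdAt_of_mem_divisorSheaf_base {E : Y → ℤ} {t : Mero Y V}
    (ht : t ∈ divisorSheaf Y E V) {β α : BaseRing f V} (hβ : β ≠ 0) (hα : α ≠ 0)
    (h : ∀ ξ : {ξ : Y // ξ ∈ V ∧ ξ ∈ genericPoints Y},
        baseGerm f V ξ.1 ξ.2.1 α * t ξ = baseGerm f V ξ.1 ξ.2.1 β)
    (q : Ideal (BaseRing f V)) [q.IsPrime] (hq : q.height = 1) :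
    ∃ i j : ℕ, HasOrdAt q β i ∧ HasOrdAt q α j ∧ -baseFun f V E q ≤ (i : ℤ) - j := by
  obtain ⟨x, hx, rfl⟩ := exists_baseIdeal_eq q
  obtain ⟨i, hi⟩ := exists_hasOrdAt hq (mem_nonZeroDivisors_of_ne_zero hβ)
  obtain ⟨j, hj⟩ := exists_hasOrdAt hq (mem_nonZeroDivisors_of_ne_zero hα)
  refine ⟨i, j, hi, hj, ?_⟩
  rw [baseFun_baseIdeal]
  have hc := (height_baseIdeal f hx).symm.trans hq
  obtain ⟨ξ, hξ⟩ := exists_mem_genericPoints_specializes hV.isAffineOpen hx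
  exact (ordGE_baseGerm_iff hx ξ.2.1 hξ hc (E x) hi hj (h ξ)).1 (ht x hx hc ξ hξ)

end Local

end TameCover

namespace TameCover
open IsLocalRing Pointwise

set_option linter.unusedSectionVars false
set_option linter.overlappingInstances false

section Generator

variable {X Y : Scheme.{u}} {π : X ⟶ Y} {G : Type v} [CommGroup G] [Finite G]
  {R : Type u} [CommRing R] [IsDomain R] [IsTameGroup R G]
  [IsRegularScheme X] [IsRegularScheme Y]
  {f : Y ⟶ Spec (CommRingCat.of R)} {ρ : G →* Aut (Over.mk π)} [hρ : IsGenericTorsorCover ρ]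

theorem mero_smul_apply {V : Y.Opens} (r : BaseRing f V) (s : Mero Y V)
    (ξ : {ξ : Y // ξ ∈ V ∧ ξ ∈ genericPoints Y}) :
    ((show Γ(Y, V) from r) • s) ξ = baseGerm f V ξ.1 ξ.2.1 r * s ξ :=
  rfl

variable (f) in
/-- Locally, the resolvent sheaf is generated by a section whose `n`-th power generates the
sheaf attached to the resolvent divisor. -/
theorem exists_generator_resolventSheaf (V : Y.Opens) [hV : IsIntegralAffine V] {n : ℕ}
    (hn0 : n ≠ 0) (hn : ∀ g : G, g ^ n = 1) {D : X → ℤ}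
    (hD : ∀ x : X, inertia ρ x = ⊥ → D x = 0)
    (hDG : ∀ (g : G) (x : X), D (act ρ g x) = D x) (φ : G →* Rˣ) (p : Ideal Γ(Y, V)) [hp : p.IsPrime] :
    ∃ s ∈ resolventSheaf f ρ D φ V,
      ∃ σ ∈ divisorSheaf Y (resolventDivisorCoeff f ρ D φ n) V, s ^ n = meroPullback f ρ V σ ∧
      (∀ t ∈ resolventSheaf f ρ D φ V, ∃ r ∉ p, ∃ c : Γ(Y, V), r • t = c • s) ∧
      (∀ t ∈ divisorSheaf Y (resolventDivisorCoeff f ρ D φ n) V,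
        ∃ r ∉ p, ∃ c : Γ(Y, V), r • t = c • σ) ∧
      ∀ c : Γ(Y, V), c • s ^ n = 0 → c = 0 := by
  let p' : Ideal (BaseRing f V) := p
  have hp' : p'.IsPrime := hp
  have hone : (1 : BaseRing f V) ∉ p' := (Ideal.ne_top_iff_one _).1 hp'.ne_top
  have hE : ∀ (P : Ideal (CoverRing f ρ V)) [P.IsPrime], P.height = 1 →
      (Nat.card (P.inertia G) : ℤ) *
        baseFun f V (resolventDivisorCoeff f ρ D φ n) (P.under (BaseRing f V)) =
          -(n * coverFun f ρ V (leastOrder f ρ D φ) P) := by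
    intro P _ hP
    obtain ⟨x, hx, rfl⟩ := exists_coverIdeal_eq P
    have hy : π x ∈ V := hx
    rw [coverFun_coverIdeal, under_coverIdeal hx hy, baseFun_baseIdeal,
      ← inertia_eq_inertia_coverIdeal]
    exact card_inertia_mul_resolventDivisorCoeff hn hD hDG φ
      ((height_coverIdeal f ρ hx).symm.trans hP)
  obtain ⟨β₀, hβ₀, γ₀, α₀, hγ₀0, hα₀, hγ₀, hs, hσ, htop, hbase⟩ :=
    exists_local_generator (genericallyFree_coverRing (f := f) (ρ := ρ) (V := V)) φ hn0 hn
      (isLeastEigenOrder_leastOrder hD hDG φ) hE p'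
  have hα₀n : α₀ ^ n ≠ 0 := pow_ne_zero _ hα₀
  refine ⟨coverDiv β₀ α₀, coverDiv_mem_resolventSheaf hβ₀ hα₀ hs, baseDiv γ₀ (α₀ ^ n),
    baseDiv_mem_divisorSheaf hα₀n hσ, ?_, ?_, ?_, ?_⟩
  · funext ξ
    have hy : π ξ.1 ∈ V := ξ.2.1
    refine (isUnit_coverGerm (f := f) (ρ := ρ) ξ.2.1 ξ.2.2 hα₀n).mul_left_cancel ?_
    have h1 := congrArg (· ^ n) (coverGerm_mul_coverDiv β₀ hα₀ ξ)
    simp only [mul_pow, ← map_pow] at h1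
    refine h1.trans ?_
    have h2 := congrArg (π.stalkMap ξ.1).hom (baseGerm_mul_baseDiv γ₀ hα₀n
      ⟨π ξ.1, hy, (apply_mem_genericPoints f ρ).2 ξ.2.2⟩)
    rw [← hγ₀, coverGerm_algebraMap ξ.2.1 hy, coverGerm_algebraMap ξ.2.1 hy]
    exact h2.symm.trans (map_mul _ _ _)
  · intro t ht
    obtain ⟨β, hβ, α, hα, h⟩ := exists_eq_div_of_forall_smul_eq (f := f) ht.2
    obtain ⟨r, hr, c, hrc⟩ : ∃ r ∉ p', ∃ c : BaseRing f V,
        algebraMap (BaseRing f V) (CoverRing f ρ V) (r * α₀) * β =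
          algebraMap (BaseRing f V) (CoverRing f ρ V) (c * α) * β₀ := by
      rcases eq_or_ne β 0 with rfl | hβ0
      · exact ⟨1, hone, 0, by simp⟩
      · exact htop β hβ α hα (exists_hasOrdAt_of_mem_divisorSheaf ht.1
          (eigen_mem_nonZeroDivisors hβ hβ0) hα h)
    refine ⟨r, hr, c, funext fun ξ => ?_⟩
    refine (isUnit_coverGerm (f := f) (ρ := ρ) ξ.2.1 ξ.2.2 (mul_ne_zero hα₀ hα)).mul_left_cancel ?_
    rw [meroPush_smul_apply (f := f) (ρ := ρ), meroPush_smul_apply (f := f) (ρ := ρ)]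
    have h1 := congrArg (coverGerm f ρ V ξ.1 ξ.2.1) hrc
    have h2 := h ξ
    have h3 := coverGerm_mul_coverDiv β₀ hα₀ ξ
    simp only [map_mul] at h1 ⊢
    rw [← h2, ← h3] at h1
    linear_combination h1
  · intro t ht
    obtain ⟨d, b, hdb⟩ : ∃ d b : BaseRing f V,
        ∀ ξ : {ξ : Y // ξ ∈ V ∧ ξ ∈ genericPoints Y},
          IsUnit (baseGerm f V ξ.1 ξ.2.1 d) ∧
          baseGerm f V ξ.1 ξ.2.1 d * t ξ = baseGerm f V ξ.1 ξ.2.1 b := by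
      obtain ⟨d, b, h⟩ := exists_common_denominator hV.isAffineOpen t
      exact ⟨d, b, fun ξ => ⟨notMem_pointIdeal.1 (h ξ).1, (h ξ).2⟩⟩
    obtain ⟨y, hy, -⟩ := exists_baseIdeal_eq p'
    obtain ⟨η, -⟩ := exists_mem_genericPoints_specializes hV.isAffineOpen hy
    have hd : d ≠ 0 := by
      rintro rfl
      have := (hdb η).1
      rw [map_zero] at this
      exact not_isUnit_zero this
    obtain ⟨r, hr, c, hrc⟩ : ∃ r ∉ p', ∃ c : BaseRing f V, r * α₀ ^ n * b = c * d * γ₀ := by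
      rcases eq_or_ne b 0 with rfl | hb0
      · exact ⟨1, hone, 0, by simp⟩
      · exact hbase b d hd (exists_hasOrdAt_of_mem_divisorSheaf_base ht hb0 hd fun ξ => (hdb ξ).2)
    refine ⟨r, hr, c, funext fun ξ => ?_⟩
    refine (isUnit_baseGerm (f := f) ξ.2.1 ξ.2.2 (mul_ne_zero hα₀n hd)).mul_left_cancel ?_
    rw [mero_smul_apply (f := f), mero_smul_apply (f := f)]
    have h1 := congrArg (baseGerm f V ξ.1 ξ.2.1) hrc
    have h2 := (hdb ξ).2
    have h3 := baseGerm_mul_baseDiv γ₀ hα₀n ξ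
    rw [map_mul, map_mul, map_mul, map_mul, ← h2, ← h3] at h1
    rw [map_mul]
    linear_combination h1
  · intro c hc
    -- At a generic point the germs of `c` and of the `n`-th power are both units, so their product
    -- cannot be zero there.
    by_contra hc0
    obtain ⟨y, hy, -⟩ := exists_baseIdeal_eq p'
    obtain ⟨x, hxy⟩ := exists_apply_eq f ρ y
    have hx : π x ∈ V := hxy ▸ hy
    obtain ⟨ξ, -⟩ := exists_mem_genericPoints_specializes (isAffineOpen_cover ρ V)
      (show x ∈ π ⁻¹ᵁ V from hx)
    have h1 := (meroPush_smul_apply (f := f) (ρ := ρ) c _ ξ).symm.trans (congrFun hc ξ)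
    have h2 := congrArg (· ^ n) (coverGerm_mul_coverDiv β₀ hα₀ ξ)
    simp only [mul_pow, ← map_pow, ← hγ₀] at h2
    have h3 := isUnit_coverGerm (f := f) (ρ := ρ) ξ.2.1 ξ.2.2 hγ₀0
    rw [← h2] at h3
    have h4 := (isUnit_coverGerm (f := f) (ρ := ρ) ξ.2.1 ξ.2.2
      (show (c : BaseRing f V) ≠ 0 from hc0)).mul (isUnit_of_mul_isUnit_right h3)
    exact not_isUnit_zero (M₀ := X.presheaf.stalk ξ.1) ((congrArg IsUnit h1).mp h4)

end Generator

end TameCover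

namespace TameCover
open IsLocalRing Pointwise

set_option linter.unusedSectionVars false
set_option linter.overlappingInstances false

/-! ### Restriction and extension by zero of meromorphic functions -/

section Extension

variable {X Y : Scheme.{u}} {π : X ⟶ Y} {G : Type v} [CommGroup G]
  {R : Type u} [CommRing R] {f : Y ⟶ Spec (CommRingCat.of R)} {ρ : G →* Aut (Over.mk π)}

/-- The restriction of a meromorphic function. -/
def restrictMero {X : Scheme.{u}} {U U' : X.Opens} (h : U' ≤ U) (t : Mero X U) : Mero X U' :=
  fun ξ => t ⟨ξ.1, h ξ.2.1, ξ.2.2⟩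

open Classical in
/-- The extension by zero of a meromorphic function. -/
noncomputable def extendMero {X : Scheme.{u}} {U' : X.Opens} (U : X.Opens) (t : Mero X U') :
    Mero X U :=
  fun ξ => if h : ξ.1 ∈ U' then t ⟨ξ.1, h, ξ.2.2⟩ else 0

theorem extendMero_of_mem {X : Scheme.{u}} {U U' : X.Opens} (t : Mero X U')
    (ξ : {ξ : X // ξ ∈ U ∧ ξ ∈ genericPoints X}) (h : ξ.1 ∈ U') :
    extendMero U t ξ = t ⟨ξ.1, h, ξ.2.2⟩ :=
  dif_pos h

theorem extendMero_of_notMem {X : Scheme.{u}} {U U' : X.Opens} (t : Mero X U')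
    (ξ : {ξ : X // ξ ∈ U ∧ ξ ∈ genericPoints X}) (h : ξ.1 ∉ U') : extendMero U t ξ = 0 :=
  dif_neg h

theorem restrictMero_mem_divisorSheaf {X : Scheme.{u}} {D : X → ℤ} {U U' : X.Opens} (h : U' ≤ U)
    {t : Mero X U} (ht : t ∈ divisorSheaf X D U) : restrictMero h t ∈ divisorSheaf X D U' :=
  fun x hx hc ξ hξ => ht x (h hx) hc ⟨ξ.1, h ξ.2.1, ξ.2.2⟩ hξ

theorem extendMero_mem_divisorSheaf {X : Scheme.{u}} {D : X → ℤ} {U U' : X.Opens}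
    (hU : ∀ ξ x : X, ξ ⤳ x → x ∈ U → ξ ∈ U' → x ∈ U') {t : Mero X U'}
    (ht : t ∈ divisorSheaf X D U') : extendMero U t ∈ divisorSheaf X D U := by
  intro x hx hc ξ hξ
  by_cases h : ξ.1 ∈ U'
  · rw [extendMero_of_mem t ξ h]
    exact ht x (hU _ _ hξ hx h) hc ⟨ξ.1, h, ξ.2.2⟩ hξ
  · rw [extendMero_of_notMem t ξ h]
    exact OrdGE.zero hξ (D x)

/-- The restriction of a section of `π_* 𝒦_X`. -/
def restrictPush {V W : Y.Opens} (h : W ≤ V) (t : MeroPush π V) : MeroPush π W :=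
  restrictMero (fun _ hx => h hx : π ⁻¹ᵁ W ≤ π ⁻¹ᵁ V) t

/-- The extension by zero of a section of `π_* 𝒦_X`. -/
noncomputable def extendPush {W : Y.Opens} (V : Y.Opens) (t : MeroPush π W) : MeroPush π V :=
  extendMero (π ⁻¹ᵁ V) t

theorem extendPush_of_mem {V W : Y.Opens} (t : MeroPush π W)
    (ξ : {ξ : X // ξ ∈ π ⁻¹ᵁ V ∧ ξ ∈ genericPoints X}) (h : ξ.1 ∈ π ⁻¹ᵁ W) :
    extendPush V t ξ = t ⟨ξ.1, h, ξ.2.2⟩ :=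
  dif_pos h

theorem extendPush_of_notMem {V W : Y.Opens} (t : MeroPush π W)
    (ξ : {ξ : X // ξ ∈ π ⁻¹ᵁ V ∧ ξ ∈ genericPoints X}) (h : ξ.1 ∉ π ⁻¹ᵁ W) :
    extendPush V t ξ = 0 :=
  dif_neg h

theorem push_smul_apply {V : Y.Opens} (r : Γ(Y, V)) (s : MeroPush π V)
    (ξ : {ξ : X // ξ ∈ π ⁻¹ᵁ V ∧ ξ ∈ genericPoints X}) (hy : π ξ.1 ∈ V) :
    (r • s) ξ = (π.stalkMap ξ.1).hom ((Y.presheaf.germ V (π ξ.1) hy).hom r) * s ξ :=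
  congrArg (· * s ξ) (Scheme.Hom.germ_stalkMap_apply π V ξ.1 ξ.2.1 r).symm

theorem germ_scalar {V : Y.Opens} {y : Y} (hy : y ∈ V) (r : R) :
    (Y.presheaf.germ V y hy).hom (scalar f V r) = scalarStalk f y r := by
  have h2 : f.appLE ⊤ ⊤ le_top ≫ Y.presheaf.germ ⊤ y trivial =
      f.appLE ⊤ V le_top ≫ Y.presheaf.germ V y hy := by
    rw [← Scheme.Hom.appLE_map f (le_top : (⊤ : Y.Opens) ≤ _)
      (homOfLE (le_top : V ≤ ⊤)).op, Category.assoc, Y.presheaf.germ_res]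
  exact (congrArg (fun k => k.hom ((Scheme.ΓSpecIso (CommRingCat.of R)).inv.hom r)) h2).symm

theorem mem_resolventSheaf_iff {D : X → ℤ} {φ : G →* Rˣ} {V : Y.Opens} {t : MeroPush π V} :
    t ∈ resolventSheaf f ρ D φ V ↔ t ∈ divisorSheaf X D (π ⁻¹ᵁ V) ∧
      ∀ (g : G) (ξ : {ξ : X // ξ ∈ π ⁻¹ᵁ V ∧ ξ ∈ genericPoints X}),
        ((act ρ g).stalkMap ξ.1).hom (t (actGeneric ρ g V ξ)) =
          (π.stalkMap ξ.1).hom (scalarStalk f (π ξ.1) (φ g)) * t ξ := by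
  refine and_congr_right fun _ => forall_congr' fun g => ?_
  refine funext_iff.trans (forall_congr' fun ξ => ?_)
  have hy : π ξ.1 ∈ V := ξ.2.1
  rw [push_smul_apply _ _ ξ hy, germ_scalar hy]
  rfl

theorem restrictPush_mem_resolventSheaf {D : X → ℤ} {φ : G →* Rˣ} {V W : Y.Opens} (h : W ≤ V)
    {t : MeroPush π V} (ht : t ∈ resolventSheaf f ρ D φ V) :
    restrictPush h t ∈ resolventSheaf f ρ D φ W := by
  rw [mem_resolventSheaf_iff] at ht ⊢
  exact ⟨restrictMero_mem_divisorSheaf _ ht.1, fun g ξ => ht.2 g ⟨ξ.1, h ξ.2.1, ξ.2.2⟩⟩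

theorem extendPush_mem_resolventSheaf {D : X → ℤ} {φ : G →* Rˣ} {V W : Y.Opens}
    (hW : ∀ η y : Y, η ⤳ y → y ∈ V → η ∈ W → y ∈ W)
    {t : MeroPush π W} (ht : t ∈ resolventSheaf f ρ D φ W) :
    extendPush V t ∈ resolventSheaf f ρ D φ V := by
  rw [mem_resolventSheaf_iff] at ht ⊢
  refine ⟨extendMero_mem_divisorSheaf (fun ξ x hξ hx h => ?_) ht.1, fun g ξ => ?_⟩
  · exact hW _ _ (hξ.map π.continuous) hx h
  · by_cases h : ξ.1 ∈ π ⁻¹ᵁ W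
    · have h1 := act_mem_preimage ρ g h
      rw [extendPush_of_mem t (actGeneric ρ g V ξ) h1, extendPush_of_mem t ξ h]
      exact ht.2 g ⟨ξ.1, h, ξ.2.2⟩
    · have h1 : act ρ g ξ.1 ∉ π ⁻¹ᵁ W := fun h1 => h (by
        have h2 : π (act ρ g ξ.1) ∈ W := h1
        rw [← Scheme.Hom.comp_apply, act_comp] at h2
        exact h2)
      rw [extendPush_of_notMem t (actGeneric ρ g V ξ) h1, extendPush_of_notMem t ξ h, mul_zero]
      exact map_zero _

end Extension

/-! ### Gluing over the components of an affine open -/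

section Global

variable {X Y : Scheme.{u}} {π : X ⟶ Y} {G : Type v} [CommGroup G] [Finite G]
  {R : Type u} [CommRing R] [IsDomain R] [IsTameGroup R G]
  [IsRegularScheme X] [IsRegularScheme Y]
  {ρ : G →* Aut (Over.mk π)} [hρ : IsGenericTorsorCover ρ]

theorem exists_piTensorProduct_resolventSheaf_equiv (f : Y ⟶ Spec (CommRingCat.of R)) {n : ℕ}
    (hn0 : n ≠ 0) (hn : ∀ g : G, g ^ n = 1) {D : X → ℤ}
    (hD : ∀ x : X, inertia ρ x = ⊥ → D x = 0)
    (hDG : ∀ (g : G) (x : X), D (act ρ g x) = D x) (φ : G →* Rˣ) {V : Y.Opens}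
    (hV : IsAffineOpen V) :
    ∃ e : (⨂[Γ(Y, V)] _ : Fin n, resolventSheaf f ρ D φ V) ≃ₗ[Γ(Y, V)]
        divisorSheaf Y (resolventDivisorCoeff f ρ D φ n) V,
      ∀ a : Fin n → resolventSheaf f ρ D φ V,
        IsPullback π V (e (PiTensorProduct.tprod Γ(Y, V) a)).1 (∏ i, (a i : MeroPush π V)) := by
  -- On a cover, the pullback relation is the graph of an injective algebra map, so the algebraic
  -- criterion for tensor powers applies.
  simp only [isPullback_iff (f := f) (ρ := ρ)]
  refine exists_piTensorProduct_equiv (meroPullback f ρ V) (meroPullback_injective f ρ V) _ _ n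
    fun p hp => ?_
  have hpp := hp.isPrime
  obtain ⟨ε, hε, hεp, hW⟩ := exists_isIntegralAffine_basicOpen hV p
  set W := Y.basicOpen ε with hWdef
  have hWV : W ≤ V := Y.basicOpen_le ε
  obtain ⟨y, hy, rfl⟩ := exists_pointIdeal_eq hV p
  have hyW : y ∈ W := (Y.mem_basicOpen ε y hy).2 (notMem_pointIdeal.1 hεp)
  have hclosed : ∀ η z : Y, η ⤳ z → z ∈ V → η ∈ W → z ∈ W := fun η z h hz hη => by
    by_contra hzW
    exact notMem_basicOpen_of_specializes hε h hz hzW hη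
  obtain ⟨s, hs, σ, hσ, hsσ, hM, hN, htf⟩ :=
    exists_generator_resolventSheaf f W hn0 hn hD hDG φ (pointIdeal W y hyW)
  -- Coefficients found on the component `W` are lifted to `V` by zero elsewhere: restriction to `W`
  -- is surjective, and multiplication by the idempotent kills the lift off `W`.
  have hlift : ∀ c : Γ(Y, W), ∃ c' : Γ(Y, V), (∀ (z : Y) (hz : z ∈ V) (hzW : z ∈ W),
      (Y.presheaf.germ V z hz).hom c' = (Y.presheaf.germ W z hzW).hom c) ∧
      ∀ (z : Y) (hz : z ∈ V), z ∉ W → (Y.presheaf.germ V z hz).hom c' = 0 := by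
    intro c
    have := hV.isLocalization_basicOpen ε
    obtain ⟨a, rfl⟩ := surjective_of_isIdempotentElem (S := Γ(Y, Y.basicOpen ε)) hε c
    have hres : ∀ (z : Y) (hz : z ∈ V) (hzW : z ∈ W) (b : Γ(Y, V)),
        (Y.presheaf.germ V z hz).hom b =
          (Y.presheaf.germ W z hzW).hom (algebraMap Γ(Y, V) Γ(Y, Y.basicOpen ε) b) :=
      fun z hz hzW b => congrArg (fun k => k.hom b)
        (Y.presheaf.germ_res (homOfLE hWV) z hzW).symm
    refine ⟨ε * a, fun z hz hzW => ?_, fun z hz hzW => ?_⟩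
    · have h1 : (Y.presheaf.germ V z hz).hom ε = 1 := by
        have h2 : IsUnit ((Y.presheaf.germ V z hz).hom ε) := (Y.mem_basicOpen ε z hz).1 hzW
        refine h2.mul_left_cancel ?_
        rw [← map_mul, hε, mul_one]
      rw [map_mul, h1, one_mul]
      exact hres z hz hzW a
    · rw [map_mul, germ_eq_zero_of_isIdempotentElem hε hz hzW, zero_mul]
  refine ⟨extendPush V s, extendPush_mem_resolventSheaf hclosed hs, extendMero V σ,
    extendMero_mem_divisorSheaf hclosed hσ, ?_, ?_, ?_, ?_⟩
  · funext ξ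
    have hyV : π ξ.1 ∈ V := ξ.2.1
    have h1 : (extendPush V s ξ) ^ n = (π.stalkMap ξ.1).hom (extendMero V σ
        ⟨π ξ.1, hyV, (apply_mem_genericPoints f ρ).2 ξ.2.2⟩) := by
      by_cases h : π ξ.1 ∈ W
      · rw [extendPush_of_mem s ξ h, extendMero_of_mem σ
          ⟨π ξ.1, hyV, (apply_mem_genericPoints f ρ).2 ξ.2.2⟩ h]
        exact congrFun hsσ ⟨ξ.1, h, ξ.2.2⟩
      · rw [extendPush_of_notMem s ξ h, extendMero_of_notMem σ
          ⟨π ξ.1, hyV, (apply_mem_genericPoints f ρ).2 ξ.2.2⟩ h, zero_pow hn0, map_zero]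
    exact h1
  · intro t ht
    obtain ⟨r, hr, c, hrc⟩ := hM _ (restrictPush_mem_resolventSheaf hWV ht)
    obtain ⟨r', hr', hr'0⟩ := hlift r
    obtain ⟨c', hc', hc'0⟩ := hlift c
    refine ⟨r', ?_, c', funext fun ξ => ?_⟩
    · rw [notMem_pointIdeal, hr' y hy hyW]
      exact notMem_pointIdeal.1 hr
    · have hyV : π ξ.1 ∈ V := ξ.2.1
      rw [push_smul_apply _ _ ξ hyV, push_smul_apply _ _ ξ hyV]
      by_cases h : π ξ.1 ∈ W
      · have h1 := congrFun hrc ⟨ξ.1, h, ξ.2.2⟩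
        have h2 := (push_smul_apply r _ ⟨ξ.1, h, ξ.2.2⟩ h).symm.trans
          (h1.trans (push_smul_apply c _ ⟨ξ.1, h, ξ.2.2⟩ h))
        rw [hr' _ hyV h, hc' _ hyV h, extendPush_of_mem s ξ h]
        exact h2
      · rw [hr'0 _ hyV h, hc'0 _ hyV h, map_zero, zero_mul, zero_mul]
  · intro t ht
    obtain ⟨r, hr, c, hrc⟩ := hN _ (restrictMero_mem_divisorSheaf hWV ht)
    obtain ⟨r', hr', hr'0⟩ := hlift r
    obtain ⟨c', hc', hc'0⟩ := hlift c
    refine ⟨r', ?_, c', funext fun η => ?_⟩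
    · rw [notMem_pointIdeal, hr' y hy hyW]
      exact notMem_pointIdeal.1 hr
    · change (Y.presheaf.germ V η.1 η.2.1).hom r' * t η =
        (Y.presheaf.germ V η.1 η.2.1).hom c' * extendMero V σ η
      by_cases h : η.1 ∈ W
      · rw [hr' _ η.2.1 h, hc' _ η.2.1 h, extendMero_of_mem σ η h]
        exact congrFun hrc ⟨η.1, h, η.2.2⟩
      · rw [hr'0 _ η.2.1 h, hc'0 _ η.2.1 h, zero_mul, zero_mul]
  · intro c hc
    -- Torsion-freeness holds only on the component of `p`: from `c` vanishing on `W` one concludes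
    -- that a power of the idempotent, which is outside `p`, kills `c`.
    have h0 : algebraMap Γ(Y, V) Γ(Y, Y.basicOpen ε) c = 0 := by
      refine htf _ (funext fun ξ => ?_)
      have hyW : π ξ.1 ∈ W := ξ.2.1
      have h1 := (push_smul_apply c _ ⟨ξ.1, hWV ξ.2.1, ξ.2.2⟩ (hWV hyW)).symm.trans
        (congrFun hc ⟨ξ.1, hWV ξ.2.1, ξ.2.2⟩)
      have h2 : (extendPush V s ^ n) ⟨ξ.1, hWV ξ.2.1, ξ.2.2⟩ = (s ^ n) ξ :=
        congrArg (· ^ n) (extendPush_of_mem s ⟨ξ.1, hWV ξ.2.1, ξ.2.2⟩ ξ.2.1)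
      have h3 : (Y.presheaf.germ V (π ξ.1) (hWV hyW)).hom c =
          (Y.presheaf.germ W (π ξ.1) hyW).hom (algebraMap Γ(Y, V) Γ(Y, Y.basicOpen ε) c) :=
        congrArg (fun k => k.hom c) (Y.presheaf.germ_res (homOfLE hWV) (π ξ.1) hyW).symm
      refine (push_smul_apply _ _ ξ hyW).trans ?_
      rw [← h3, ← h2]
      exact h1
    have := hV.isLocalization_basicOpen ε
    obtain ⟨⟨_, k, rfl⟩, hk⟩ := (IsLocalization.map_eq_zero_iff (.powers ε) _ c).1 h0
    exact ⟨ε ^ k, fun h => hεp (Ideal.IsPrime.mem_of_pow_mem ‹_› _ h), hk⟩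

end Global

end TameCover

/-! ### The proposition -/

theorem proposition3p2 {R : Type u} [CommRing R] [IsDomain R] [IsDiscreteValuationRing R]
    [IsAdicComplete (IsLocalRing.maximalIdeal R) R]
    (n : ℕ) (hn : IsUnit (n : R)) (hζ : ∃ ζ : R, IsPrimitiveRoot ζ n)
    {G : Type v} [CommGroup G] [Finite G] (hG : Monoid.exponent G ∣ n)
    {X Y : Scheme.{u}} (f : Y ⟶ Spec (CommRingCat.of R)) [Flat f]
    [TameCover.IsRegularScheme X] [TameCover.IsRegularScheme Y]
    (π : X ⟶ Y) (ρ : G →* Aut (Over.mk π)) (hcover : TameCover.IsGCover ρ)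
    (htorsor : ∃ U : Y.Opens, Dense (U : Set Y) ∧ TameCover.IsTorsorOver ρ U)
    (hram : ∀ x : X, Order.coheight x = 1 → TameCover.inertia ρ x ≠ ⊥ →
      f (π x) = IsLocalRing.closedPoint R)
    (D : AlgebraicCycle X ℤ) (hD : ∀ x : X, Order.coheight x ≠ 1 → D x = 0)
    (hDG : ∀ (g : G) (x : X), D (TameCover.act ρ g x) = D x)
    (hDbranch : ∀ x : X, TameCover.inertia ρ x = ⊥ → D x = 0)
    (φ : G →* Rˣ) :
    ∃ E : AlgebraicCycle Y ℤ,
      (∀ y : Y, Order.coheight y = 1 → f y = IsLocalRing.closedPoint R →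
        ∀ x : X, π x = y → (E y : ℚ) = n * TameCover.resolventCoeff f ρ D φ x) ∧
      (∀ y : Y, ¬ (Order.coheight y = 1 ∧ f y = IsLocalRing.closedPoint R) → E y = 0) ∧
      ∀ V : Y.Opens, IsAffineOpen V →
        ∃ e : (⨂[Γ(Y, V)] _ : Fin n, TameCover.resolventSheaf f ρ D φ V) ≃ₗ[Γ(Y, V)]
            TameCover.divisorSheaf Y E V,
          ∀ a : Fin n → TameCover.resolventSheaf f ρ D φ V,
            TameCover.IsPullback π V (e (PiTensorProduct.tprod Γ(Y, V) a)).1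
              (∏ i, (a i : TameCover.MeroPush π V)) := by
  have := TameCover.IsTameGroup.of_exponent_dvd hn hζ hG
  have : TameCover.IsGenericTorsorCover ρ := ⟨hcover, htorsor⟩
  have hgn : ∀ g : G, g ^ n = 1 := Monoid.exponent_dvd_iff_forall_pow_eq_one.1 hG
  have hn0 : n ≠ 0 := by
    rintro rfl
    simp at hn
  refine ⟨TameCover.resolventDivisor f ρ hgn hDbranch hDG φ, ?_, ?_, ?_⟩
  · rintro _ hc - x rfl
    rw [TameCover.coheight_apply f ρ] at hc
    have h := TameCover.card_inertia_mul_resolventDivisorCoeff (f := f) hgn hDbranch hDG φ hc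
    have he : (Nat.card (TameCover.inertia ρ x) : ℚ) ≠ 0 := by exact_mod_cast Nat.card_pos.ne'
    change ((TameCover.resolventDivisorCoeff f ρ D φ n (π x) : ℤ) : ℚ) = _
    rw [TameCover.resolventCoeff_eq, mul_div_assoc', eq_div_iff he, mul_comm]
    have h' := congrArg (Int.cast (R := ℚ)) h
    push_cast at h'
    rw [h', mul_neg]
  · intro y hy
    obtain ⟨x, rfl⟩ := TameCover.exists_apply_eq f ρ y
    rw [TameCover.coheight_apply f ρ] at hy
    -- Outside the special fibre a codimension one point has trivial inertia, so its coefficient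
    -- vanishes; in other codimensions the coefficient is zero by definition.
    by_cases hc : Order.coheight x = 1
    · refine TameCover.resolventDivisorCoeff_eq_zero hgn hDbranch hDG φ ?_
      by_contra hI
      exact hy ⟨hc, hram x hc hI⟩
    · refine (if_neg ?_ : TameCover.resolventDivisorCoeff f ρ D φ n (π x) = 0)
      rwa [TameCover.coheight_apply f ρ]
  · intro V hV
    exact TameCover.exists_piTensorProduct_resolventSheaf_equiv f hn0 hgn hDbranch hDG φ hV
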